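/- **Setting.** Fix integers $N\ge 0$, $L\ge1$, $j_0\ge 0$, put $S_{j,k}=2^{-j}[k-L+1,k+L)\cap[0,1)$, and let $\varphi_{j,k},\psi_{j,k}$ ($j\ge j_0$, $0\le k<2^j$) be a compactly supported orthonormal wavelet basis of $L^2([0,1])$ of Cohen–Daubechies–Vial type: for each $i\ge j_0$ the functions $\varphi_{i,k}$ and $\psi_{j,k}$ ($j\ge i$) form an orthonormal basis; $\varphi_{j,k},\psi_{j,k}$ vanish outside $S_{j,k}$ (if $1$ is the right end point of $S_{j,k}$, the value at the point $1$ is free); they are linear combinations of those $\varphi_{j+1,l}$ with $S_{j+1,l}\subseteq S_{j,k}$; $\int x^d\psi_{j,k}(x)\,dx=0$ for $0\le d<N$; for $L\le k<2^j-L$ they equal $2^{j/2}\varphi(2^jx-k)$, $2^{j/2}\psi(2^jx-k)$ with $\int\varphi=1$, while if $2^j\ge 2L$ the first $L$ and the last $L$ are of the form $2^{j/2}g(2^jx)$, respectively $2^{j/2}g(2^j(1-x))$, with $g$ not depending on $j$; and either the functions generating the $\varphi_{j,k}$ are Hölder continuous of some order greater than $\frac12$, or $\varphi_{j,k}=2^{j/2}$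 on $S_{j,k}$ (Haar basis). For $f\in L^2([0,1])$ write $\alpha_{j,k}=\int f\varphi_{j,k}$, $\beta_{j,k}=\int f\psi_{j,k}$. For $s,M>0$ and $I\subseteq[0,1]$, $C^s(M,I)$ is the class of those $f\in L^2([0,1])$ that equal the sum of their wavelet series at every point of $[0,1]$ and satisfy $2^{j_0(s+1/2)}|\alpha_{j_0,k}|\le M$ whenever $S_{j_0,k}\subseteq I$, and $2^{j(s+1/2)}|\beta_{j,k}|\le M$ whenever $j\ge j_0$, $S_{j,k}\subseteq I$; $C^s(M)=C^s(M,[0,1])$. We observe $Y_n=f(x_n)+\varepsilon_n$, $n\ge1$, with $\varepsilon_n$ i.i.d. $N(0,\sigma^2)$, $\sigma>0$ known, where $x_n$ is a measurable function of $Y_1,\dots,Y_{n-1}$. Let $\xi_n=\{x_1,\dots,x_n\}$ (the $x_n$ will be distinct) and write $Y(x_t)=Y_t$. **Constants.** Let $\kappa>1$, $\lambda>0$, $A>0$; let $n_0<n_1<\cdots$ be integers with $n_0$ a power of two and $n_m/n_{m-1}$ bounded away from $1$ and $\infty$; let $j_n^{\max}>j_0$ be integers with $2^{j_n^{\max}}\asymp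 n/\log n$, such that the first step of each stage below never needs more than $n_m-n_{m-1}$ points. **Estimator.** For $i>j$, $\hat\alpha^i_{j_0,k}$ and $\hat\beta^i_{j,k}$ are the coefficients at $\varphi_{j_0,k}$ and $\psi_{j,k}$ of $\sum_l2^{-i/2}Y(2^{-i}l)\varphi_{i,l}$ (only observations in $S_{j,k}\cap2^{-i}\mathbb Z$ matter). Let $i_n(j,k)=\max\{i>j:\ S_{j,k}\cap2^{-i}\mathbb Z\subseteq\xi_n\}$, $\hat\alpha_{j_0,k}=\hat\alpha_{j_0,k}^{i_n(j_0,k)}$, $\hat\beta_{j,k}=\hat\beta_{j,k}^{i_n(j,k)}$, $e_n(j,k)=\sigma2^{-i_n(j,k)/2}\sqrt{2\log n}$, let $\hat\beta^T_{j,k}=\hat\beta_{j,k}$ if $|\hat\beta_{j,k}|\ge\kappa e_n(j,k)$ and $\hat\beta^T_{j,k}=0$ otherwise (also if $i_n(j,k)$ is undefined), and $$\hat f_n=\sum_{k<2^{j_0}}\hat\alpha_{j_0,k}\varphi_{j_0,k}+\sum_{j=j_0}^{j_n^{\max}-1}\sum_{k<2^j}\hat\beta^T_{j,k}\psi_{j,k}.$$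 **Algorithm 1.** Initially $x_t=(t-1)/n_0$ for $1\le t\le n_0$. In stage $m\ge1$, put $J=j^{\max}_{n_m}$, $j'=j^{\max}_{n_{m-1}}$, $I_{l}=2^{-J}[l,l+1)$ for $0\le l<2^J$; for each $j_0\le j<j'$ let $r_j$ rank the values $|\hat\beta^T_{j,k}|$ at time $n_{m-1}$ in decreasing order, from $1$ to $2^j$, and put $$p_{l}=A\max\Big(\{\lambda\}\cup\Big\{\tfrac{2^j}{r_j(k)j'^2}:\ j_0\le j<j',\ I_{l}\subseteq S_{j,k},\ \hat\beta^T_{j,k}\ne0\Big\}\Big),\qquad q_{l,n}=n^{-1}\max\{2^i:2^{-i}\mathbb Z\cap I_{l}\subseteq\xi_n\}.$$ (The value of $A$ does not affect the design; it may be chosen so that $2^{-J}\sum_lp_l\le1$ always.) First add all points of $2^{-J}\mathbb Z\cap[0,1)\setminus\xi_{n_{m-1}}$. Then repeat, until there are $n_m$ points: with $n$ the current number of points, choose $l$ maximising $p_{l}/q_{l,n}$, and add the points of $2^{-i}\mathbb Z\cap I_{l}\setminus\xi_n$, for the smallest $i$ for which this set is non-empty, one after the other, until all are added or there are $n_m$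 points. Ties in the rankings and in the choice of $l$, and the orders in which points are added, are arbitrary. **Theorem.** Let $s\in[\frac12,N)$, $M>0$, let $I$ be an interval open in $[0,1]$ and $J\subseteq I$ closed (for example, a closed interval). Then Algorithm 1, which does not depend on $s,M,I,J$, satisfies $$\sup_{x\in J}|\hat f_n(x)-f(x)|=O_p\big((n/\log n)^{-\alpha(s)}\big),\qquad \alpha(s)=\frac{s}{2s+1},$$ as $n\to\infty$, uniformly over $f\in C^s(M,I)\cap C^{1/2}(M)$; that is, for every $\delta>0$ there are $K>0$ and $n^*$ such that for all $n\ge n^*$ and all such $f$, the probability that $\sup_{x\in J}|\hat f_n(x)-f(x)|>K(n/\log n)^{-\alpha(s)}$ is at most $\delta$. -/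

import Mathlib

open MeasureTheory ProbabilityTheory Set Filter Topology
open scoped NNReal ENNReal

noncomputable section

namespace AdaptiveSensing

/-! ### Wavelet bases of `L²([0,1])` -/

/-- The interval `S_{j,k} = 2^{-j}[k - L + 1, k + L) ∩ [0, 1)`. -/
def suppInterval (L j k : ℕ) : Set ℝ :=
  Ico (((k : ℝ) - L + 1) / 2 ^ j) (((k : ℝ) + L) / 2 ^ j) ∩ Ico 0 1

/-- The inner product of `L²([0,1])`. -/
def ip (f g : ℝ → ℝ) : ℝ := ∫ x in Icc (0 : ℝ) 1, f x * g x

/-- The normalisation `2^{j/2}`. -/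
def scale (j : ℕ) : ℝ := (2 : ℝ) ^ ((j : ℝ) / 2)

/-- A compactly supported orthonormal wavelet basis of `L²([0,1])` of the type constructed by Cohen,
Daubechies and Vial, with `N` vanishing moments, coarsest level `j₀` and supports `S_{j,k}`.
All functions are considered on `[0,1]` only, and indices range over `j ≥ j₀`, `k < 2^j`. -/
structure WaveletBasis (N L j₀ : ℕ) where
  /-- scaling functions `φ_{j,k}` -/
  φ : ℕ → ℕ → ℝ → ℝ
  /-- wavelets `ψ_{j,k}` -/
  ψ : ℕ → ℕ → ℝ → ℝ
  /-- interior generators -/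
  φ₀ : ℝ → ℝ
  ψ₀ : ℝ → ℝ
  /-- generators at the left end point -/
  φl : ℕ → ℝ → ℝ
  ψl : ℕ → ℝ → ℝ
  /-- generators at the right end point -/
  φr : ℕ → ℝ → ℝ
  ψr : ℕ → ℝ → ℝ
  one_le_L : 1 ≤ L
  memLp_φ : ∀ j ≥ j₀, ∀ k < 2 ^ j, MemLp (φ j k) 2 (volume.restrict (Icc 0 1))
  memLp_ψ : ∀ j ≥ j₀, ∀ k < 2 ^ j, MemLp (ψ j k) 2 (volume.restrict (Icc 0 1))
  /-- away from the end points, the basis functions are dilates and translates of one function -/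
  interior : ∀ j ≥ j₀, ∀ k, L ≤ k → k + L < 2 ^ j → ∀ x ∈ Icc (0 : ℝ) 1,
    φ j k x = scale j * φ₀ (2 ^ j * x - k) ∧ ψ j k x = scale j * ψ₀ (2 ^ j * x - k)
  /-- at the end points, they are dilates of finitely many functions -/
  left : ∀ j ≥ j₀, 2 * L ≤ 2 ^ j → ∀ k < L, ∀ x ∈ Icc (0 : ℝ) 1,
    φ j k x = scale j * φl k (2 ^ j * x) ∧ ψ j k x = scale j * ψl k (2 ^ j * x)
  right : ∀ j ≥ j₀, 2 * L ≤ 2 ^ j → ∀ k < L, ∀ x ∈ Icc (0 : ℝ) 1,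
    φ j (2 ^ j - 1 - k) x = scale j * φr k (2 ^ j * (1 - x)) ∧
      ψ j (2 ^ j - 1 - k) x = scale j * ψr k (2 ^ j * (1 - x))
  /-- the interior scaling function has integral one -/
  integral_φ₀ : ∫ x, φ₀ x = 1
  /-- supports; a function whose interval `S_{j,k}` reaches up to the end point `1` may take any
  value (for instance its left limit) at the point `1` itself -/
  support : ∀ j ≥ j₀, ∀ k < 2 ^ j, ∀ x ∈ Icc (0 : ℝ) 1, x ∉ suppInterval L j k →
    (x = 1 → k + L < 2 ^ j) → φ j k x = 0 ∧ ψ j k x = 0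
  orthonormal_φ : ∀ j ≥ j₀, ∀ k < 2 ^ j, ∀ k' < 2 ^ j,
    ip (φ j k) (φ j k') = if k = k' then 1 else 0
  orthonormal_ψ : ∀ j ≥ j₀, ∀ j' ≥ j₀, ∀ k < 2 ^ j, ∀ k' < 2 ^ j',
    ip (ψ j k) (ψ j' k') = if j = j' ∧ k = k' then 1 else 0
  orthogonal_φ_ψ : ∀ i ≥ j₀, ∀ j ≥ i, ∀ k < 2 ^ i, ∀ k' < 2 ^ j, ip (φ i k) (ψ j k') = 0
  complete : ∀ g : ℝ → ℝ, MemLp g 2 (volume.restrict (Icc 0 1)) →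
    (∀ k < 2 ^ j₀, ip g (φ j₀ k) = 0) → (∀ j ≥ j₀, ∀ k < 2 ^ j, ip g (ψ j k) = 0) →
    g =ᵐ[volume.restrict (Icc 0 1)] 0
  /-- two-scale relations: `φ_{j,k}` and `ψ_{j,k}` are combinations of those `φ_{j+1,l}` whose
  support interval lies in `S_{j,k}` -/
  two_scale_φ : ∀ j ≥ j₀, ∀ k < 2 ^ j, ∃ h : ℕ → ℝ,
    (∀ l, ¬ suppInterval L (j + 1) l ⊆ suppInterval L j k → h l = 0) ∧
    ∀ x ∈ Icc (0 : ℝ) 1, φ j k x = ∑ l ∈ Finset.range (2 ^ (j + 1)), h l * φ (j + 1) l x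
  two_scale_ψ : ∀ j ≥ j₀, ∀ k < 2 ^ j, ∃ h : ℕ → ℝ,
    (∀ l, ¬ suppInterval L (j + 1) l ⊆ suppInterval L j k → h l = 0) ∧
    ∀ x ∈ Icc (0 : ℝ) 1, ψ j k x = ∑ l ∈ Finset.range (2 ^ (j + 1)), h l * φ (j + 1) l x
  vanishing_moments : ∀ j ≥ j₀, ∀ k < 2 ^ j, ∀ d < N, ∫ x in Icc (0 : ℝ) 1, x ^ d * ψ j k x = 0
  /-- the generators are Hölder continuous of some order greater than `1/2`, or the basis is the
  Haar basis -/
  regular :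
    (∃ C γ : ℝ≥0, 1 / 2 < γ ∧ HolderWith C γ φ₀ ∧
      ∀ k < L, HolderOnWith C γ (φl k) (Ici 0) ∧ HolderOnWith C γ (φr k) (Ici 0)) ∨
    (∀ j ≥ j₀, ∀ k < 2 ^ j, ∀ x ∈ suppInterval L j k, φ j k x = scale j)

variable {N L j₀ : ℕ}

/-- The local Hölder class `C^s(M, I)`. Its elements are functions whose point values are those of
their wavelet series (for continuous wavelets: the continuous representatives, when `s > 0` and
`I = [0,1]`). -/
def holderClass (W : WaveletBasis N L j₀) (s M : ℝ) (I : Set ℝ) : Set (ℝ → ℝ) :=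
  {f | MemLp f 2 (volume.restrict (Icc 0 1)) ∧
    (∀ x ∈ Icc (0 : ℝ) 1, Tendsto (fun i => ∑ k ∈ Finset.range (2 ^ j₀), ip f (W.φ j₀ k) * W.φ j₀ k x
        + ∑ j ∈ Finset.Ico j₀ i, ∑ k ∈ Finset.range (2 ^ j), ip f (W.ψ j k) * W.ψ j k x)
      atTop (𝓝 (f x))) ∧
    (∀ k < 2 ^ j₀, suppInterval L j₀ k ⊆ I →
      (2 : ℝ) ^ ((j₀ : ℝ) * (s + 1 / 2)) * |ip f (W.φ j₀ k)| ≤ M) ∧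
    (∀ j ≥ j₀, ∀ k < 2 ^ j, suppInterval L j k ⊆ I →
      (2 : ℝ) ^ ((j : ℝ) * (s + 1 / 2)) * |ip f (W.ψ j k)| ≤ M)}

/-! ### The estimator

Designs are sequences `x : ℕ → ℝ`, observations are sequences `y : ℕ → ℝ`, both indexed from `0`,
so that the first `n` of them have indices `t < n`. -/

/-- The grid `2^{-i}ℤ`. -/
def grid (i : ℕ) : Set ℝ := {p | ∃ k : ℤ, p = k / 2 ^ i}

/-- The set `ξ_n` of the first `n` design points. -/
def designSet (x : ℕ → ℝ) (n : ℕ) : Set ℝ := x '' Iio n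

/-- The observation `Y(p)` made at the point `p` among the first `n` (design points are distinct);
`0` if there is none. -/
def obsAt (x y : ℕ → ℝ) (n : ℕ) (p : ℝ) : ℝ :=
  ∑ t ∈ Finset.range n, if x t = p then y t else 0

/-- The coefficient with respect to the basis function `b` of the function
`∑_l 2^{-i/2} Y(2^{-i} l) φ_{i,l}`. For `b = φ_{j₀,k}` or `b = ψ_{j,k}` with `j < i`, this
is the estimate obtained from the grid `2^{-i}ℤ` by the orthogonal change of basis; it involves only
the observations on `2^{-i}ℤ ∩ S_{j,k}`. -/
def gridCoeff (W : WaveletBasis N L j₀) (x y : ℕ → ℝ) (n i : ℕ) (b : ℝ → ℝ) : ℝ :=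
  ∑ l ∈ Finset.range (2 ^ i), (scale i)⁻¹ * obsAt x y n ((l : ℝ) / 2 ^ i) * ip (W.φ i l) b

/-- The set of those `i > j` with `S_{j,k} ∩ 2^{-i}ℤ ⊆ ξ_n`. -/
def levels (L : ℕ) (x : ℕ → ℝ) (n j k : ℕ) : Set ℕ :=
  {i | j < i ∧ suppInterval L j k ∩ grid i ⊆ designSet x n}

/-- The index `i_n(j,k)`, the maximum of `levels L x n j k`. -/
def levelIndex (L : ℕ) (x : ℕ → ℝ) (n j k : ℕ) : ℕ := sSup (levels L x n j k)

/-- The constants of the procedure. -/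
structure Tuning (j₀ : ℕ) where
  /-- noise level -/
  σ : ℝ
  /-- threshold constant -/
  κ : ℝ
  /-- lower bound for the target density, up to `A` -/
  lam : ℝ
  /-- normalising constant of the target density; the design does not depend on it -/
  A : ℝ
  /-- the numbers `n_m` of observations at the end of stage `m` -/
  stage : ℕ → ℕ
  /-- the maximal resolution levels `j_n^max` -/
  jmax : ℕ → ℕ
  σ_pos : 0 < σ
  one_lt_κ : 1 < κ
  lam_pos : 0 < lam
  A_pos : 0 < A
  stage_zero : ∃ i, stage 0 = 2 ^ i
  stage_ratio : ∃ a b : ℝ, 1 < a ∧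
    ∀ m, a * stage m ≤ stage (m + 1) ∧ (stage (m + 1) : ℝ) ≤ b * stage m
  lt_jmax : ∀ n, j₀ < jmax n
  jmax_theta : (fun n => (2 : ℝ) ^ jmax n) =Θ[atTop] (fun n : ℕ => (n : ℝ) / Real.log n)

/-- The estimates `α̂_{j₀,k}` from the first `n` observations. -/
def alphaHat (W : WaveletBasis N L j₀) (x y : ℕ → ℝ) (n k : ℕ) : ℝ :=
  gridCoeff W x y n (levelIndex L x n j₀ k) (W.φ j₀ k)

/-- The estimates `β̂_{j,k}` from the first `n` observations. -/
def betaHat (W : WaveletBasis N L j₀) (x y : ℕ → ℝ) (n j k : ℕ) : ℝ :=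
  gridCoeff W x y n (levelIndex L x n j k) (W.ψ j k)

/-- The size `e_n(j,k) = σ 2^{-i_n(j,k)/2} √(2 log n)`. -/
def noiseSize (L : ℕ) (σ : ℝ) (x : ℕ → ℝ) (n j k : ℕ) : ℝ :=
  σ * (scale (levelIndex L x n j k))⁻¹ * √(2 * Real.log n)

open Classical in
/-- The hard-threshold estimates `β̂ᵀ_{j,k}`. If `i_n(j,k)` is undefined, they are `0`. -/
def betaThr (W : WaveletBasis N L j₀) (T : Tuning j₀) (x y : ℕ → ℝ) (n j k : ℕ) : ℝ :=
  if (levels L x n j k).Nonempty ∧ T.κ * noiseSize L T.σ x n j k ≤ |betaHat W x y n j k|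
  then betaHat W x y n j k else 0

/-- The estimator `f̂_n`. -/
def estimator (W : WaveletBasis N L j₀) (T : Tuning j₀) (x y : ℕ → ℝ) (n : ℕ) (u : ℝ) : ℝ :=
  ∑ k ∈ Finset.range (2 ^ j₀), alphaHat W x y n k * W.φ j₀ k u +
    ∑ j ∈ Finset.Ico j₀ (T.jmax n), ∑ k ∈ Finset.range (2 ^ j), betaThr W T x y n j k * W.ψ j k u

/-! ### The adaptive choice of design points -/

/-- The interval `2^{-J}[l, l + 1)`. -/
def cell (J l : ℕ) : Set ℝ := Ico ((l : ℝ) / 2 ^ J) (((l : ℝ) + 1) / 2 ^ J)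

/-- `r j` ranks `|b j 0|, …, |b j (2^j - 1)|` in decreasing order, from `1` to `2^j`, for all
`j₀ ≤ j < j₁`. -/
def IsRanking (j₀ j₁ : ℕ) (b : ℕ → ℕ → ℝ) (r : ℕ → ℕ → ℕ) : Prop :=
  ∀ j, j₀ ≤ j → j < j₁ → BijOn (r j) (Iio (2 ^ j)) (Icc 1 (2 ^ j)) ∧
    ∀ k < 2 ^ j, ∀ k' < 2 ^ j, r j k ≤ r j k' → |b j k'| ≤ |b j k|

/-- The target density on the `l`-th cell of level `J`, computed from the estimates `b` at levels
`j₀ ≤ j < j₁` with ranking `r` (the supremum is over a finite non-empty set). -/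
def targetDensity (L j₀ : ℕ) (A lam : ℝ) (J j₁ : ℕ) (b : ℕ → ℕ → ℝ) (r : ℕ → ℕ → ℕ) (l : ℕ) : ℝ :=
  A * sSup ({lam} ∪ {v | ∃ j k, j₀ ≤ j ∧ j < j₁ ∧ k < 2 ^ j ∧ cell J l ⊆ suppInterval L j k ∧
    b j k ≠ 0 ∧ v = 2 ^ j / ((r j k : ℝ) * (j₁ : ℝ) ^ 2)})

/-- The effective density at time `n` on the `l`-th cell of level `J`. -/
def effectiveDensity (J : ℕ) (x : ℕ → ℝ) (n l : ℕ) : ℝ :=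
  (n : ℝ)⁻¹ * 2 ^ sSup {i | grid i ∩ cell J l ⊆ designSet x n}

/-- The points of `2^{-i}ℤ` in the `l`-th cell of level `J` which are not yet in the design. -/
def newPoints (J : ℕ) (x : ℕ → ℝ) (n l i : ℕ) : Set ℝ := (grid i ∩ cell J l) \ designSet x n

/-- `LoopHead J p total x start n` says that the while loop of a stage, entered with `start` points,
reaches its head with the `n` points `x 0, …, x (n - 1)`. In each pass, a cell `l` maximising
`p/q` is chosen, and the missing points of the coarsest incomplete grid in this cell are
added, in any order, until they are all there or the total number is `total`. -/
inductive LoopHead (J : ℕ) (p : ℕ → ℝ) (total : ℕ) (x : ℕ → ℝ) (start : ℕ) : ℕ → Prop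
  | enter : LoopHead J p total x start start
  | pass (n n' l i : ℕ) : LoopHead J p total x start n → n < total → l < 2 ^ J →
      (∀ l' < 2 ^ J, p l' / effectiveDensity J x n l' ≤ p l / effectiveDensity J x n l) →
      IsLeast {i | (newPoints J x n l i).Nonempty} i →
      n < n' → n' ≤ total → InjOn x (Ico n n') → x '' Ico n n' ⊆ newPoints J x n l i →
      (x '' Ico n n' = newPoints J x n l i ∨ n' = total) →
      LoopHead J p total x start n'

/-- The points with indices `n_m ≤ t < n_{m+1}` are chosen as in stage `m + 1` of the algorithm:
first the missing points of the grid of level `J = j^max_{n_{m+1}}`, in any order, and then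
those of the while loop. -/
def IsStage (W : WaveletBasis N L j₀) (T : Tuning j₀) (y x : ℕ → ℝ) (m : ℕ) : Prop :=
  ∃ r : ℕ → ℕ → ℕ, IsRanking j₀ (T.jmax (T.stage m)) (betaThr W T x y (T.stage m)) r ∧
  ∃ n' : ℕ, T.stage m ≤ n' ∧ n' ≤ T.stage (m + 1) ∧ InjOn x (Ico (T.stage m) n') ∧
    x '' Ico (T.stage m) n' =
      (grid (T.jmax (T.stage (m + 1))) ∩ Ico 0 1) \ designSet x (T.stage m) ∧
    LoopHead (T.jmax (T.stage (m + 1)))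
      (targetDensity L j₀ T.A T.lam (T.jmax (T.stage (m + 1))) (T.jmax (T.stage m))
        (betaThr W T x y (T.stage m)) r)
      (T.stage (m + 1)) x n' (T.stage (m + 1))

/-- `x` is a design which the algorithm may choose when the observations are `y`. -/
def IsRun (W : WaveletBasis N L j₀) (T : Tuning j₀) (y x : ℕ → ℝ) : Prop :=
  (∀ t < T.stage 0, x t = (t : ℝ) / T.stage 0) ∧ ∀ m, IsStage W T y x m

/-- An implementation of the algorithm: each design point is a measurable function of the previous
observations, and all choices comply with the rules, whatever the observations. -/
structure Implementation (W : WaveletBasis N L j₀) (T : Tuning j₀) where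
  /-- the next design point, given the first `n` observations -/
  point : (n : ℕ) → (Fin n → ℝ) → ℝ
  measurable_point : ∀ n, Measurable (point n)
  isRun : ∀ y : ℕ → ℝ, IsRun W T y (fun n => point n (fun i => y i))

/-- The observations `Y_n = f(x_n) + ε_n` for the design points `x_n` given by the rule `point`,
with noise `e`. -/
def observations (point : (n : ℕ) → (Fin n → ℝ) → ℝ) (f : ℝ → ℝ) (e : ℕ → ℝ) (n : ℕ) : ℝ :=
  f (point n (fun i => observations point f e i)) + e n
termination_by n
decreasing_by exact i.2

/-- The estimate `f̂_n` of the algorithm when the regression function is `f` and the noise is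
`e`. -/
def algorithmEstimate {W : WaveletBasis N L j₀} {T : Tuning j₀} (D : Implementation W T)
    (f : ℝ → ℝ) (e : ℕ → ℝ) (n : ℕ) : ℝ → ℝ :=
  estimator W T (fun t => D.point t (fun i => observations D.point f e i))
    (observations D.point f e) n

/-- The exponent `α(s) = s / (2 s + 1)`. -/
def rateExponent (s : ℝ) : ℝ := s / (2 * s + 1)

end AdaptiveSensing

end

namespace AdaptiveSensing

variable {N L j₀ : ℕ}

/-! ### Powers of `√2` and supports -/

/-! The adaptive part of the design cannot spoil the rate. The target density is at least `A * lam`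
on every cell, while its sum over the `2^J` cells is at most `2^J * A * (lam + 2L)`. The loop always
refines a cell with the largest `p/q`, so if the grid in one cell stayed coarse, the grids in all
cells would be coarse in proportion to `p`, and the loop could not have placed a fixed fraction of
the points (`LoopHead.invariant`, `LoopHead.count`). Hence for large `n` every run contains a
uniform grid of mesh of order `1/n` (`exists_grid_subset`), every coefficient of level below `jmax
n` is estimated from a grid with `2^i` at least of order `n`, and its noise size is `O(√(log n /
n))`.

A grid estimate equals the true coefficient plus bias plus noise (`gridCoeff_eq`). The class
`C^{1/2}(M)` makes the bias `O(2^{-i/2})` (`exists_bias_bound`): `f` oscillates by `O(2^{-i/2})` on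
the interval `S_{i,l}`, so replacing scaling coefficients by point values costs `O(2^{-i})` at each
interior index and `O(2^{-i/2})` at no more than `2L` boundary indices; pairing with a unit vector
leaves `O(2^{-i/2})`. This is smaller than the threshold by a factor `√(log n)`.

The design depends on the observations, so for fixed `i` the noise term is a sum with predictable
weights, not a Gaussian variable. The squares of the weights still sum to at most `2^{-i}` for every
design, and the exponential martingale gives the Gaussian tail (`measure_abs_sum_ge_le`). A union
bound over all coefficients and all possible grid levels costs `O(n^{1-κ'^2})`, which vanishes for
any `κ' > 1` (`eventually_measure_exceptional_le`).

Outside the exceptional event, thresholding errs by at most a constant times both `|β|` and the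
noise size (`abs_sub_le_of_threshold`). At a point of `J` no more than `2L` wavelets of each level
matter. At fine levels their supports lie in `I`, so `|β|` is `O(2^{-j(s+1/2)})`; the finitely many
coarse levels only change constants. Coefficients from level `jmax n` on are estimated by zero and
are `O(log n / n)` by `C^{1/2}(M)`. The sum of `2^{j/2} min(2^{-j(s+1/2)}, √(log n / n))` over the
levels is dominated by its crossover level and gives the rate (`exists_sum_min_le`). -/

lemma scale_eq_pow (j : ℕ) : scale j = √2 ^ j := by
  rw [scale, Real.sqrt_eq_rpow, ← Real.rpow_natCast, ← Real.rpow_mul (by norm_num)]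
  congr 1; ring

lemma scale_pos (j : ℕ) : 0 < scale j := by rw [scale_eq_pow]; positivity

lemma scale_mul_self (j : ℕ) : scale j * scale j = 2 ^ j := by
  rw [scale_eq_pow, ← mul_pow, Real.mul_self_sqrt (by norm_num)]

lemma scale_succ (j : ℕ) : scale (j + 1) = √2 * scale j := by
  rw [scale_eq_pow, scale_eq_pow, pow_succ, mul_comm]

lemma two_pow_inv_mul_scale (j : ℕ) : ((2 : ℝ) ^ j)⁻¹ * scale j = (scale j)⁻¹ := by
  have := scale_pos j
  rw [← scale_mul_self]; field_simp

lemma scale_inv_eq_pow (j : ℕ) : (scale j)⁻¹ = (√2)⁻¹ ^ j := by rw [scale_eq_pow, inv_pow]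

lemma inv_sqrt_two_lt_one : (√2)⁻¹ < 1 := by
  apply inv_lt_one_of_one_lt₀
  rw [Real.lt_sqrt] <;> norm_num

lemma measurableSet_suppInterval (L j k : ℕ) : MeasurableSet (suppInterval L j k) :=
  measurableSet_Ico.inter measurableSet_Ico

lemma suppInterval_subset_Icc (L j k : ℕ) : suppInterval L j k ⊆ Icc 0 1 :=
  inter_subset_right.trans Ico_subset_Icc_self

lemma mem_suppInterval_iff {j k : ℕ} {x : ℝ} :
    x ∈ suppInterval L j k ↔ ((k : ℝ) - L + 1 ≤ 2 ^ j * x ∧ 2 ^ j * x < k + L) ∧ 0 ≤ x ∧ x < 1 := by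
  rw [suppInterval, mem_inter_iff, mem_Ico, mem_Ico, div_le_iff₀ (by positivity),
    lt_div_iff₀ (by positivity), mul_comm x]

lemma cell_left_mem_suppInterval (hL : 1 ≤ L) {j k : ℕ} (hk : k < 2 ^ j) :
    (k : ℝ) / 2 ^ j ∈ suppInterval L j k := by
  have h1 : (1 : ℝ) ≤ L := by exact_mod_cast hL
  have h2 : (k : ℝ) < 2 ^ j := by exact_mod_cast hk
  rw [mem_suppInterval_iff, mul_div_cancel₀ _ (by positivity), div_lt_one (by positivity)]
  exact ⟨⟨by linarith, by linarith⟩, by positivity, h2⟩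

lemma abs_sub_le_of_mem_suppInterval {j k : ℕ} {x y : ℝ} (hx : x ∈ suppInterval L j k)
    (hy : y ∈ suppInterval L j k) : 2 ^ j * |x - y| ≤ 2 * L := by
  rw [mem_suppInterval_iff] at hx hy
  rw [← abs_of_pos (show (0 : ℝ) < 2 ^ j by positivity), ← abs_mul, abs_le, mul_sub]
  constructor <;> linarith [hx.1.1, hx.1.2, hy.1.1, hy.1.2]

lemma volume_suppInterval_le (hL : 1 ≤ L) (j k : ℕ) :
    volume.real (suppInterval L j k) ≤ 2 * L / 2 ^ j := by
  have h1 : (1 : ℝ) ≤ L := by exact_mod_cast hL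
  have h : suppInterval L j k ⊆ Ico (((k : ℝ) - L + 1) / 2 ^ j) (((k : ℝ) + L) / 2 ^ j) :=
    inter_subset_left
  refine (measureReal_mono h (by simp)).trans ?_
  have h0 : (0 : ℝ) < 2 ^ j := by positivity
  rw [Real.volume_real_Ico, ← sub_div]
  refine max_le ?_ (by positivity)
  gcongr; linarith

/-! ### Active indices -/

open Classical in
/-- The indices `k < 2^j` such that `φ_{j,k}` or `ψ_{j,k}` need not vanish at `x`. -/
noncomputable def active (L j : ℕ) (x : ℝ) : Finset ℕ :=
  (Finset.range (2 ^ j)).filter (fun k => x ∈ suppInterval L j k ∨ (x = 1 ∧ 2 ^ j ≤ k + L))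

lemma mem_active {j k : ℕ} {x : ℝ} :
    k ∈ active L j x ↔ k < 2 ^ j ∧ (x ∈ suppInterval L j k ∨ (x = 1 ∧ 2 ^ j ≤ k + L)) := by
  simp [active]

lemma active_subset (L j : ℕ) (x : ℝ) : active L j x ⊆ Finset.range (2 ^ j) :=
  fun _ hk => Finset.mem_range.2 (mem_active.1 hk).1

/-- Shifted by `L`, the active indices fall into an integer interval of length `2L` starting at
`⌊2^j x⌋`; the shift avoids truncated subtraction. The bound includes the point `1`, where functions
reaching the right end are free. -/
lemma card_active_le (L j : ℕ) (x : ℝ) : (active L j x).card ≤ 2 * L := by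
  have h : (active L j x).image (· + L) ⊆ Finset.Ico ⌊2 ^ j * x⌋₊ (⌊2 ^ j * x⌋₊ + 2 * L) := by
    intro q hq
    obtain ⟨k, hk, rfl⟩ := Finset.mem_image.1 hq
    obtain ⟨hk1, hk2⟩ := mem_active.1 hk
    rw [Finset.mem_Ico]
    rcases hk2 with hk2 | ⟨rfl, hk2⟩
    · rw [mem_suppInterval_iff] at hk2
      have hx : (0 : ℝ) ≤ 2 ^ j * x := mul_nonneg (by positivity) hk2.2.1
      constructor
      · apply Nat.le_of_lt_succ
        rw [Nat.floor_lt hx]; push_cast; linarith [hk2.1.2]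
      · have : 2 ^ j * x < ⌊2 ^ j * x⌋₊ + 1 := Nat.lt_floor_add_one _
        have : ((k + L : ℕ) : ℝ) < ((⌊2 ^ j * x⌋₊ + 2 * L : ℕ) : ℝ) := by
          push_cast; linarith [hk2.1.1]
        exact_mod_cast this
    · have : ⌊(2 : ℝ) ^ j * 1⌋₊ = 2 ^ j := by
        rw [mul_one]; exact_mod_cast Nat.floor_natCast (2 ^ j)
      rw [this]; omega
  have h2 := Finset.card_le_card h
  rw [Finset.card_image_of_injective _ (add_left_injective L)] at h2
  simpa using h2

lemma suppInterval_subset_of_mem_active {j k : ℕ} {x : ℝ} (hk : k ∈ active L j x) :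
    ∀ y ∈ suppInterval L j k, 2 ^ j * |y - x| ≤ 2 * L := by
  intro y hy
  obtain ⟨hk1, hk2⟩ := mem_active.1 hk
  rcases hk2 with hk2 | ⟨rfl, hk2⟩
  · exact abs_sub_le_of_mem_suppInterval hy hk2
  · rw [mem_suppInterval_iff] at hy
    rw [abs_of_nonpos (by linarith [hy.2.2])]
    have : (2 : ℝ) ^ j ≤ k + L := by exact_mod_cast hk2
    nlinarith [hy.1.1]

lemma abs_sum_le_of_active {j : ℕ} {x B : ℝ} {a : ℕ → ℝ}
    (h0 : ∀ k < 2 ^ j, k ∉ active L j x → a k = 0) (hB : ∀ k ∈ active L j x, |a k| ≤ B)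
    (hB0 : 0 ≤ B) : |∑ k ∈ Finset.range (2 ^ j), a k| ≤ 2 * L * B := by
  have hsub := active_subset L j x
  rw [← Finset.sum_subset hsub (fun k hk hk' => h0 k (Finset.mem_range.1 hk) hk')]
  calc |∑ k ∈ active L j x, a k| ≤ ∑ k ∈ active L j x, |a k| := Finset.abs_sum_le_sum_abs _ _
    _ ≤ (active L j x).card • B := Finset.sum_le_card_nsmul _ _ _ hB
    _ ≤ 2 * L * B := by
      rw [nsmul_eq_mul]
      gcongr
      exact_mod_cast card_active_le L j x

lemma WaveletBasis.eq_zero_of_notMem_active (W : WaveletBasis N L j₀) {j k : ℕ} (hj : j₀ ≤ j)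
    (hk : k < 2 ^ j) {x : ℝ} (hx : x ∈ Icc (0 : ℝ) 1) (h : k ∉ active L j x) :
    W.φ j k x = 0 ∧ W.ψ j k x = 0 := by
  rw [mem_active] at h
  push Not at h
  exact W.support j hj k hk x hx (h hk).1 (h hk).2

/-! ### Inner products and expansions at finer levels -/

lemma ip_comm (f g : ℝ → ℝ) : ip f g = ip g f := by
  simp only [ip, mul_comm]

lemma ip_eq_sum {f b : ℝ → ℝ} (hf : MemLp f 2 (volume.restrict (Icc 0 1))) {s : Finset ℕ}
    {h : ℕ → ℝ} {g : ℕ → ℝ → ℝ} (hg : ∀ l ∈ s, MemLp (g l) 2 (volume.restrict (Icc 0 1)))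
    (hb : ∀ x ∈ Icc (0 : ℝ) 1, b x = ∑ l ∈ s, h l * g l x) :
    ip f b = ∑ l ∈ s, h l * ip f (g l) := by
  have h1 : ip f b = ∫ x in Icc (0 : ℝ) 1, ∑ l ∈ s, h l * (f x * g l x) := by
    refine setIntegral_congr_fun measurableSet_Icc fun x hx => ?_
    simp only [hb x hx, Finset.mul_sum]
    exact Finset.sum_congr rfl fun l _ => by ring
  rw [h1, integral_finsetSum]
  · exact Finset.sum_congr rfl fun l _ => by rw [integral_const_mul, ip]
  · intro l hl
    exact (hf.integrable_mul (hg l hl)).const_mul _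

/-- `b` is, on `[0,1]`, a combination of those `φ_{i,l}` whose support intervals lie in
`S_{j,k}`, for each `i > j`. -/
def Refines (W : WaveletBasis N L j₀) (j k : ℕ) (b : ℝ → ℝ) : Prop :=
  ∀ i > j, ∃ h : ℕ → ℝ, (∀ l < 2 ^ i, ¬ suppInterval L i l ⊆ suppInterval L j k → h l = 0) ∧
    ∀ x ∈ Icc (0 : ℝ) 1, b x = ∑ l ∈ Finset.range (2 ^ i), h l * W.φ i l x

/-- Iterating the two-scale relation composes the coefficient matrices, and nested supports keep the
expansion inside `S_{j,k}`. -/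
lemma refines_of_succ (W : WaveletBasis N L j₀) {j k : ℕ} (hj : j₀ ≤ j) {b : ℝ → ℝ}
    (hb : ∃ h : ℕ → ℝ, (∀ l, ¬ suppInterval L (j + 1) l ⊆ suppInterval L j k → h l = 0) ∧
      ∀ x ∈ Icc (0 : ℝ) 1, b x = ∑ l ∈ Finset.range (2 ^ (j + 1)), h l * W.φ (j + 1) l x) :
    Refines W j k b := by
  intro i hi
  induction i, hi using Nat.le_induction with
  | base =>
    obtain ⟨h, h1, h2⟩ := hb
    exact ⟨h, fun l _ => h1 l, h2⟩
  | succ i hi ih =>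
    obtain ⟨h, h1, h2⟩ := ih
    have hi' : j₀ ≤ i := by omega
    have key : ∀ l : ℕ, ∃ g : ℕ → ℝ, l < 2 ^ i →
        (∀ m, ¬ suppInterval L (i + 1) m ⊆ suppInterval L i l → g m = 0) ∧
        ∀ x ∈ Icc (0 : ℝ) 1, W.φ i l x = ∑ m ∈ Finset.range (2 ^ (i + 1)), g m * W.φ (i + 1) m x := by
      intro l
      by_cases hl : l < 2 ^ i
      · obtain ⟨g, hg⟩ := W.two_scale_φ i hi' l hl
        exact ⟨g, fun _ => hg⟩
      · exact ⟨0, fun h => absurd h hl⟩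
    choose g hg using key
    refine ⟨fun m => ∑ l ∈ Finset.range (2 ^ i), h l * g l m, ?_, ?_⟩
    · intro m _ hm'
      refine Finset.sum_eq_zero fun l hl => ?_
      have hl := Finset.mem_range.1 hl
      by_cases hs : suppInterval L i l ⊆ suppInterval L j k
      · rw [(hg l hl).1 m (fun hs' => hm' (hs'.trans hs)), mul_zero]
      · rw [h1 l hl hs, zero_mul]
    · intro x hx
      rw [h2 x hx]
      simp_rw [Finset.sum_mul]
      rw [Finset.sum_comm]
      refine Finset.sum_congr rfl fun l hl => ?_
      rw [(hg l (Finset.mem_range.1 hl)).2 x hx, Finset.mul_sum]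
      exact Finset.sum_congr rfl fun m _ => by ring

lemma refines_φ (W : WaveletBasis N L j₀) {j k : ℕ} (hj : j₀ ≤ j) (hk : k < 2 ^ j) :
    Refines W j k (W.φ j k) := refines_of_succ W hj (W.two_scale_φ j hj k hk)

lemma refines_ψ (W : WaveletBasis N L j₀) {j k : ℕ} (hj : j₀ ≤ j) (hk : k < 2 ^ j) :
    Refines W j k (W.ψ j k) := refines_of_succ W hj (W.two_scale_ψ j hj k hk)

/-- The coefficients of the expansion at level `i` are inner products. -/
lemma Refines.expansion {W : WaveletBasis N L j₀} {j k : ℕ} {b : ℝ → ℝ} (hb : Refines W j k b)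
    {i : ℕ} (hi : j < i) (hi₀ : j₀ ≤ i) :
    (∀ l < 2 ^ i, ¬ suppInterval L i l ⊆ suppInterval L j k → ip (W.φ i l) b = 0) ∧
    ∀ x ∈ Icc (0 : ℝ) 1, b x = ∑ l ∈ Finset.range (2 ^ i), ip (W.φ i l) b * W.φ i l x := by
  obtain ⟨h, h1, h2⟩ := hb i hi
  have key : ∀ l < 2 ^ i, ip (W.φ i l) b = h l := by
    intro l hl
    rw [ip_eq_sum (W.memLp_φ i hi₀ l hl)
      (fun m hm => W.memLp_φ i hi₀ m (Finset.mem_range.1 hm)) h2]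
    rw [Finset.sum_congr rfl fun m hm => by
      rw [W.orthonormal_φ i hi₀ l hl m (Finset.mem_range.1 hm)]]
    simp [hl]
  refine ⟨fun l hl hs => by rw [key l hl, h1 l hl hs], fun x hx => ?_⟩
  rw [h2 x hx]
  exact Finset.sum_congr rfl fun l hl => by rw [key l (Finset.mem_range.1 hl)]

lemma Refines.ip_eq {W : WaveletBasis N L j₀} {j k : ℕ} {b : ℝ → ℝ} (hb : Refines W j k b)
    {i : ℕ} (hi : j < i) (hi₀ : j₀ ≤ i) {f : ℝ → ℝ} (hf : MemLp f 2 (volume.restrict (Icc 0 1))) :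
    ip f b = ∑ l ∈ Finset.range (2 ^ i), ip (W.φ i l) b * ip f (W.φ i l) :=
  ip_eq_sum hf (fun m hm => W.memLp_φ i hi₀ m (Finset.mem_range.1 hm)) (hb.expansion hi hi₀).2

/-- A unit vector of the multiresolution analysis, of level `j` and located at `S_{j,k}`. -/
structure IsAtom (W : WaveletBasis N L j₀) (j k : ℕ) (b : ℝ → ℝ) : Prop where
  le : j₀ ≤ j
  refines : Refines W j k b
  memLp : MemLp b 2 (volume.restrict (Icc 0 1))
  norm : ip b b = 1

lemma isAtom_φ (W : WaveletBasis N L j₀) {j k : ℕ} (hj : j₀ ≤ j) (hk : k < 2 ^ j) :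
    IsAtom W j k (W.φ j k) :=
  ⟨hj, refines_φ W hj hk, W.memLp_φ j hj k hk, by rw [W.orthonormal_φ j hj k hk k hk]; simp⟩

lemma isAtom_ψ (W : WaveletBasis N L j₀) {j k : ℕ} (hj : j₀ ≤ j) (hk : k < 2 ^ j) :
    IsAtom W j k (W.ψ j k) :=
  ⟨hj, refines_ψ W hj hk, W.memLp_ψ j hj k hk, by rw [W.orthonormal_ψ j hj j hj k hk k hk]; simp⟩

/-- Parseval at level `i`. It controls both the bias, by Cauchy–Schwarz, and the total squared
weight of the noise. -/
lemma IsAtom.sum_sq {W : WaveletBasis N L j₀} {j k : ℕ} {b : ℝ → ℝ} (hb : IsAtom W j k b)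
    {i : ℕ} (hi : j < i) : ∑ l ∈ Finset.range (2 ^ i), ip (W.φ i l) b ^ 2 = 1 := by
  have := hb.refines.ip_eq hi (hb.le.trans hi.le) hb.memLp
  rw [hb.norm] at this
  rw [this]
  exact Finset.sum_congr rfl fun l _ => by rw [ip_comm b, sq]

lemma IsAtom.abs_ip_le_one {W : WaveletBasis N L j₀} {j k : ℕ} {b : ℝ → ℝ} (hb : IsAtom W j k b)
    {i l : ℕ} (hi : j < i) (hl : l < 2 ^ i) : |ip (W.φ i l) b| ≤ 1 := by
  rw [← sq_le_one_iff_abs_le_one, ← hb.sum_sq hi]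
  exact Finset.single_le_sum (f := fun l => ip (W.φ i l) b ^ 2) (fun _ _ => sq_nonneg _)
    (Finset.mem_range.2 hl)

/-! ### Size and oscillation of the basis functions -/

/-- The dilation formulas hold only at levels with `2^j ≥ 2L`. A constant obtained there is carried
down to `j₀` by two-scale relations; only finitely many steps occur, so each may lose an arbitrary
factor. -/
lemma exists_forall_ge_of_extend_down {P : ℕ → ℝ → Prop}
    (mono : ∀ j C C', C ≤ C' → P j C → P j C') (j₁ : ℕ) (h1 : ∃ C, ∀ j ≥ j₁, P j C)
    (hd : ∀ j ≥ j₀, (∃ C, P (j + 1) C) → ∃ C, P j C) : ∃ C, 0 ≤ C ∧ ∀ j ≥ j₀, P j C := by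
  have key : ∀ d : ℕ, ∃ C, ∀ j, j₀ ≤ j → j₁ ≤ j + d → P j C := by
    intro d
    induction d with
    | zero =>
      obtain ⟨C, hC⟩ := h1
      exact ⟨C, fun j _ hj => hC j hj⟩
    | succ d ih =>
      obtain ⟨C, hC⟩ := ih
      by_cases hd' : j₀ + d + 1 ≤ j₁
      · obtain ⟨C', hC'⟩ := hd (j₁ - (d + 1)) (by omega) ⟨C, hC _ (by omega) (by omega)⟩
        refine ⟨max C C', fun j hj hj1 => ?_⟩
        by_cases h : j₁ ≤ j + d
        · exact mono _ _ _ (le_max_left _ _) (hC j hj h)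
        · have : j = j₁ - (d + 1) := by omega
          rw [this]; exact mono _ _ _ (le_max_right _ _) hC'
      · exact ⟨C, fun j hj _ => hC j hj (by omega)⟩
  obtain ⟨C, hC⟩ := key j₁
  exact ⟨max C 0, le_max_right _ _, fun j hj => mono _ _ _ (le_max_left _ _) (hC j hj (by omega))⟩

/-- The three forms of `φ_{j,k}` at fine levels. -/
lemma WaveletBasis.forms (W : WaveletBasis N L j₀) {j k : ℕ} (hj : j₀ ≤ j) (h2 : 2 * L ≤ 2 ^ j)
    (hk : k < 2 ^ j) :
    (L ≤ k ∧ k + L < 2 ^ j ∧ ∀ x ∈ Icc (0 : ℝ) 1, W.φ j k x = scale j * W.φ₀ (2 ^ j * x - k)) ∨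
    (k < L ∧ ∀ x ∈ Icc (0 : ℝ) 1, W.φ j k x = scale j * W.φl k (2 ^ j * x)) ∨
    (∃ k' < L, k + k' + 1 = 2 ^ j ∧
      ∀ x ∈ Icc (0 : ℝ) 1, W.φ j k x = scale j * W.φr k' (2 ^ j * (1 - x))) := by
  by_cases h1 : k < L
  · exact Or.inr (Or.inl ⟨h1, fun x hx => (W.left j hj h2 k h1 x hx).1⟩)
  by_cases h3 : k + L < 2 ^ j
  · exact Or.inl ⟨by omega, h3, fun x hx => (W.interior j hj k (by omega) h3 x hx).1⟩
  · refine Or.inr (Or.inr ⟨2 ^ j - 1 - k, by omega, by omega, fun x hx => ?_⟩)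
    have := (W.right j hj h2 (2 ^ j - 1 - k) (by omega) x hx).1
    rwa [show 2 ^ j - 1 - (2 ^ j - 1 - k) = k by omega] at this

lemma HolderOnWith.abs_sub_le {C γ : ℝ≥0} {f : ℝ → ℝ} {s : Set ℝ} (h : HolderOnWith C γ f s)
    {x y d : ℝ} (hx : x ∈ s) (hy : y ∈ s) (hd : |x - y| ≤ d) :
    |f x - f y| ≤ C * d ^ (γ : ℝ) := by
  have := h.dist_le_of_le hx hy (d := d) (by rwa [Real.dist_eq])
  rwa [Real.dist_eq] at this

lemma exists_bound_generators (W : WaveletBasis N L j₀) : ∃ B : ℝ, 1 ≤ B ∧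
    |W.φ₀ 0| ≤ B ∧ ∀ k < L, |W.φl k 0| ≤ B ∧ |W.φr k 0| ≤ B := by
  refine ⟨1 + |W.φ₀ 0| + ∑ k ∈ Finset.range L, (|W.φl k 0| + |W.φr k 0|), ?_, ?_, ?_⟩
  · have : 0 ≤ ∑ k ∈ Finset.range L, (|W.φl k 0| + |W.φr k 0|) := by positivity
    linarith [abs_nonneg (W.φ₀ 0)]
  · have : 0 ≤ ∑ k ∈ Finset.range L, (|W.φl k 0| + |W.φr k 0|) := by positivity
    linarith
  · intro k hk
    have := Finset.single_le_sum (f := fun k => |W.φl k 0| + |W.φr k 0|)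
      (fun _ _ => by positivity) (Finset.mem_range.2 hk)
    constructor <;> linarith [abs_nonneg (W.φ₀ 0), abs_nonneg (W.φl k 0), abs_nonneg (W.φr k 0)]

lemma exists_level (L : ℕ) : ∃ j : ℕ, ∀ i ≥ j, 4 * L ≤ 2 ^ i := by
  refine ⟨4 * L, fun i hi => ?_⟩
  exact hi.trans Nat.lt_two_pow_self.le

/-- At fine levels, the argument of the generator stays within `2L` of `0` on the support, so its
value at `0` and the Hölder condition bound it. In the Haar case only the free value at the end
point `1` is not prescribed, and there it is a value of `φr` at `0`. -/
lemma exists_abs_φ_le (W : WaveletBasis N L j₀) : ∃ C : ℝ, 0 ≤ C ∧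
    ∀ j ≥ j₀, ∀ k < 2 ^ j, ∀ x ∈ Icc (0 : ℝ) 1, |W.φ j k x| ≤ C * scale j := by
  obtain ⟨B, hB1, hB0, hBk⟩ := exists_bound_generators W
  obtain ⟨j₂, hj₂⟩ := exists_level L
  refine exists_forall_ge_of_extend_down (j₀ := j₀)
    (P := fun j C => ∀ k < 2 ^ j, ∀ x ∈ Icc (0 : ℝ) 1, |W.φ j k x| ≤ C * scale j)
    ?_ (max j₀ j₂) ?_ ?_
  · intro j C C' hC h k hk x hx
    exact (h k hk x hx).trans (mul_le_mul_of_nonneg_right hC (scale_pos j).le)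
  · rcases W.regular with ⟨C, γ, hγ, h0, hlr⟩ | hH
    · refine ⟨B + C * (2 * L) ^ (γ : ℝ), fun j hj k hk x hx => ?_⟩
      have hj' := le_of_max_le_left hj
      have hp : (0 : ℝ) ≤ C * (2 * L) ^ (γ : ℝ) := by positivity
      by_cases ha : k ∈ active L j x
      swap
      · rw [(W.eq_zero_of_notMem_active hj' hk hx ha).1, abs_zero]
        have := scale_pos j; positivity
      have hL : (1 : ℝ) ≤ L := by exact_mod_cast W.one_le_L
      have hmain : ∀ (g : ℝ → ℝ) (s : Set ℝ) (u : ℝ), HolderOnWith C γ g s → 0 ∈ s → u ∈ s →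
          |g 0| ≤ B → |u| ≤ 2 * L → |scale j * g u| ≤ (B + C * (2 * L) ^ (γ : ℝ)) * scale j := by
        intro g s u hg hs hu hg0 hu2
        rw [abs_mul, abs_of_pos (scale_pos j), mul_comm]
        refine mul_le_mul_of_nonneg_right ?_ (scale_pos j).le
        have := HolderOnWith.abs_sub_le hg hu hs (d := 2 * L) (by simpa using hu2)
        have h3 := abs_sub_abs_le_abs_sub (g u) (g 0)
        linarith
      have h1L : (L : ℝ) ≤ 2 ^ j := by
        have := hj₂ j (le_of_max_le_right hj)
        have : L ≤ 2 ^ j := by omega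
        exact_mod_cast this
      have ha' := (mem_active.1 ha).2
      rcases W.forms hj' (by have := hj₂ j (le_of_max_le_right hj); omega) hk with
        ⟨_, hkL, hf⟩ | ⟨hkL, hf⟩ | ⟨k', hk', hkk, hf⟩
      · rw [hf x hx]
        refine hmain _ univ _ (holderOnWith_univ.2 h0) (mem_univ _) (mem_univ _) hB0 ?_
        rcases ha' with h | h
        · rw [mem_suppInterval_iff] at h
          rw [abs_le]; constructor <;> linarith [h.1.1, h.1.2]
        · omega
      · rw [hf x hx]
        refine hmain _ (Ici 0) _ (hlr k hkL).1 (mem_Ici.2 le_rfl)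
          (mem_Ici.2 (mul_nonneg (by positivity) hx.1)) (hBk k hkL).1 ?_
        rw [abs_of_nonneg (mul_nonneg (by positivity) hx.1)]
        rcases ha' with h | h
        · rw [mem_suppInterval_iff] at h
          have : (k : ℝ) < L := by exact_mod_cast hkL
          linarith [h.1.2]
        · have := hj₂ j (le_of_max_le_right hj)
          omega
      · rw [hf x hx]
        refine hmain _ (Ici 0) _ (hlr k' hk').2 (mem_Ici.2 le_rfl)
          (mem_Ici.2 (mul_nonneg (by positivity) (by linarith [hx.2]))) (hBk k' hk').2 ?_
        rw [abs_of_nonneg (mul_nonneg (by positivity) (by linarith [hx.2]))]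
        rcases ha' with h | h
        · rw [mem_suppInterval_iff] at h
          have h1 : (k' : ℝ) < L := by exact_mod_cast hk'
          have h2 : (k : ℝ) + k' + 1 = 2 ^ j := by exact_mod_cast hkk
          linarith [h.1.1]
        · rw [h.1]; simp
    · refine ⟨B, fun j hj k hk x hx => ?_⟩
      have hj' := le_of_max_le_left hj
      by_cases ha : k ∈ active L j x
      swap
      · rw [(W.eq_zero_of_notMem_active hj' hk hx ha).1, abs_zero]
        have := scale_pos j; positivity
      rcases (mem_active.1 ha).2 with h | ⟨rfl, h⟩
      · rw [hH j hj' k hk x h, abs_of_pos (scale_pos j)]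
        exact le_mul_of_one_le_left (scale_pos j).le hB1
      · have h4 := hj₂ j (le_of_max_le_right hj)
        rcases W.forms hj' (by omega) hk with ⟨_, hkL, hf⟩ | ⟨hkL, hf⟩ | ⟨k', hk', hkk, hf⟩
        · omega
        · omega
        · rw [hf 1 hx, sub_self, mul_zero, abs_mul, abs_of_pos (scale_pos j), mul_comm]
          exact mul_le_mul_of_nonneg_right (hBk k' hk').2 (scale_pos j).le
  · rintro j hj ⟨C, hC⟩
    refine ⟨2 ^ (j + 1) * (C * scale (j + 1)) / scale j, fun k hk x hx => ?_⟩
    have hat := isAtom_φ W hj hk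
    rw [div_mul_cancel₀ _ (scale_pos j).ne', (hat.refines.expansion (Nat.lt_succ_self j) (by omega)).2 x hx]
    refine (Finset.abs_sum_le_sum_abs _ _).trans ?_
    refine (Finset.sum_le_card_nsmul _ _ (C * scale (j + 1)) fun l hl => ?_).trans ?_
    · rw [abs_mul]
      have hl := Finset.mem_range.1 hl
      exact (mul_le_of_le_one_left (abs_nonneg _) (hat.abs_ip_le_one (Nat.lt_succ_self j) hl)).trans
        (hC l hl x hx)
    · simp

/-- In the two-scale expansion all coefficients are at most `1` in modulus, and only `2L` terms are
active at a point. -/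
lemma exists_abs_ψ_le (W : WaveletBasis N L j₀) : ∃ C : ℝ, 0 ≤ C ∧
    ∀ j ≥ j₀, ∀ k < 2 ^ j, ∀ x ∈ Icc (0 : ℝ) 1, |W.ψ j k x| ≤ C * scale j := by
  obtain ⟨C, hC0, hC⟩ := exists_abs_φ_le W
  refine ⟨2 * L * (C * √2), by positivity, fun j hj k hk x hx => ?_⟩
  have hat := isAtom_ψ W hj hk
  rw [(hat.refines.expansion (Nat.lt_succ_self j) (by omega)).2 x hx]
  have := scale_pos j
  rw [mul_assoc, mul_assoc C, ← scale_succ]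
  refine abs_sum_le_of_active (x := x) ?_ ?_ (mul_nonneg hC0 (scale_pos _).le)
  · intro l hl hl'
    rw [(W.eq_zero_of_notMem_active (by omega) hl hx hl').1, mul_zero]
  · intro l hl
    rw [abs_mul]
    have hl' := (mem_active.1 hl).1
    exact (mul_le_of_le_one_left (abs_nonneg _) (hat.abs_ip_le_one (Nat.lt_succ_self j) hl')).trans
        (hC (j + 1) (by omega) l hl' x hx)

/-- In the Haar case, supports are single dyadic intervals. -/
lemma eq_one_of_haar (W : WaveletBasis N L j₀)
    (hH : ∀ j ≥ j₀, ∀ k < 2 ^ j, ∀ x ∈ suppInterval L j k, W.φ j k x = scale j) : L = 1 := by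
  obtain ⟨j₂, hj₂⟩ := exists_level L
  set j := max j₀ j₂
  have hj : j₀ ≤ j := le_max_left _ _
  have h4 := hj₂ j (le_max_right _ _)
  have hL1 := W.one_le_L
  have hk : L < 2 ^ j := by omega
  have h1 := W.orthonormal_φ j hj L hk L hk
  have hS : suppInterval L j L = Ico (1 / 2 ^ j : ℝ) ((L + L) / 2 ^ j) := by
    rw [suppInterval, inter_eq_left.2]
    · congr 1; ring
    · refine Ico_subset_Ico (by rw [sub_self]; positivity) ?_
      rw [div_le_one (by positivity)]
      have : L + L ≤ 2 ^ j := by omega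
      exact_mod_cast this
  have h5 : ip (W.φ j L) (W.φ j L) = ∫ x in Icc (0 : ℝ) 1, (suppInterval L j L).indicator (fun _ => (2 : ℝ) ^ j) x := by
    refine setIntegral_congr_fun measurableSet_Icc fun x hx => ?_
    by_cases hxs : x ∈ suppInterval L j L
    · simp only [indicator_of_mem hxs, hH j hj L hk x hxs, scale_mul_self]
    · simp only [indicator_of_notMem hxs, (W.support j hj L hk x hx hxs (fun _ => by omega)).1, mul_zero]
  rw [h5, setIntegral_indicator (measurableSet_suppInterval _ _ _),
    inter_eq_right.2 (suppInterval_subset_Icc _ _ _), setIntegral_const, hS, Real.volume_real_Ico,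
    ← sub_div, if_pos rfl] at h1
  have hLr : (1 : ℝ) ≤ L := by exact_mod_cast hL1
  rw [max_eq_left (div_nonneg (by linarith) (by positivity)), smul_eq_mul,
    div_mul_cancel₀ _ (by positivity)] at h1
  have : (L : ℝ) = 1 := by linarith
  exact_mod_cast this

/-- With `L = 1` the supports are dyadic intervals, which are nested or disjoint. -/
lemma haar_const (W : WaveletBasis N L j₀)
    (hH : ∀ j ≥ j₀, ∀ k < 2 ^ j, ∀ x ∈ suppInterval L j k, W.φ j k x = scale j)
    {j k i l : ℕ} (hj : j₀ ≤ j) (hk : k < 2 ^ j) (hi : j ≤ i) {x y : ℝ}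
    (hx : x ∈ suppInterval L i l) (hy : y ∈ suppInterval L i l) : W.φ j k x = W.φ j k y := by
  have hL := eq_one_of_haar W hH
  have key : ∀ x y, x ∈ suppInterval L i l → y ∈ suppInterval L i l → x ∈ suppInterval L j k →
      y ∈ suppInterval L j k := by
    intro x y hx hy hxj
    rw [mem_suppInterval_iff] at *
    refine ⟨?_, hy.2⟩
    obtain ⟨d, rfl⟩ := Nat.exists_eq_add_of_le hi
    rw [hL] at *
    simp only [Nat.cast_one, sub_add_cancel] at *
    have hd : (0 : ℝ) < 2 ^ d := by positivity
    rw [pow_add] at hx hy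
    have e1 : (2 : ℝ) ^ j * 2 ^ d * x = 2 ^ d * (2 ^ j * x) := by ring
    have e2 : (2 : ℝ) ^ j * 2 ^ d * y = 2 ^ d * (2 ^ j * y) := by ring
    rw [e1] at hx
    rw [e2] at hy
    have a1 : (2 : ℝ) ^ d * k < l + 1 := by nlinarith
    have a2 : (l : ℝ) < 2 ^ d * (k + 1) := by nlinarith
    have b1 : 2 ^ d * k < l + 1 := by exact_mod_cast a1
    have b2 : l < 2 ^ d * (k + 1) := by exact_mod_cast a2
    have c1 : ((2 ^ d * k : ℕ) : ℝ) ≤ l := by exact_mod_cast (by omega)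
    have c2 : ((l + 1 : ℕ) : ℝ) ≤ ((2 ^ d * (k + 1) : ℕ) : ℝ) := by exact_mod_cast b2
    push_cast at c1 c2
    constructor
    · by_contra hc; push Not at hc; nlinarith
    · by_contra hc; push Not at hc; nlinarith
  have hx1 := suppInterval_subset_Icc _ _ _ hx
  have hy1 := suppInterval_subset_Icc _ _ _ hy
  by_cases h : x ∈ suppInterval L j k
  · rw [hH j hj k hk x h, hH j hj k hk y (key x y hx hy h)]
  · have h' : y ∉ suppInterval L j k := fun h' => h (key y x hy hx h')
    rw [(W.support j hj k hk x hx1 h (fun e => by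
        rw [mem_suppInterval_iff] at hx; linarith [hx.2.2])).1,
      (W.support j hj k hk y hy1 h' (fun e => by
        rw [mem_suppInterval_iff] at hy; linarith [hy.2.2])).1]

/-- After dilation, points of `S_{i,l}` are `O(2^{-(i-j)})` apart, so Hölder order `γ` gives the
ratio `θ = 2^{-γ}`. The assumption `γ > 1/2` is what makes `√2 * θ < 1`, needed to sum the
oscillations of a function in `C^{1/2}`. -/
lemma exists_osc_φ (W : WaveletBasis N L j₀) : ∃ C θ : ℝ, 0 ≤ C ∧ 0 < θ ∧ √2 * θ < 1 ∧
    ∀ j ≥ j₀, ∀ k < 2 ^ j, ∀ i ≥ j, ∀ l, ∀ x ∈ suppInterval L i l, ∀ y ∈ suppInterval L i l,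
      |W.φ j k x - W.φ j k y| ≤ C * scale j * θ ^ (i - j) := by
  rcases W.regular with ⟨C, γ, hγ, h0, hlr⟩ | hH
  swap
  -- Haar functions do not oscillate on finer supports, so any positive `θ < 1/√2` serves.
  · refine ⟨0, (√2)⁻¹ / 2, le_rfl, by positivity, ?_, fun j hj k hk i hi l x hx y hy => ?_⟩
    · rw [mul_div_assoc', mul_inv_cancel₀ (by positivity)]; norm_num
    · rw [haar_const W hH hj hk hi hx hy]; simp
  obtain ⟨j₂, hj₂⟩ := exists_level L
  obtain ⟨B, hB0, hB⟩ := exists_abs_φ_le W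
  set θ : ℝ := (2 : ℝ) ^ (-(γ : ℝ)) with hθ
  have hθ0 : 0 < θ := by positivity
  have hθ1 : √2 * θ < 1 := by
    rw [hθ, Real.sqrt_eq_rpow, ← Real.rpow_add (by norm_num)]
    apply Real.rpow_lt_one_of_one_lt_of_neg (by norm_num)
    have : ((1 / 2 : ℝ≥0) : ℝ) < γ := by exact_mod_cast hγ
    push_cast at this
    linarith
  suffices h : ∃ C, 0 ≤ C ∧ ∀ j ≥ j₀, ∀ k < 2 ^ j, ∀ i ≥ j, ∀ l, ∀ x ∈ suppInterval L i l,
      ∀ y ∈ suppInterval L i l, |W.φ j k x - W.φ j k y| ≤ C * scale j * θ ^ (i - j) by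
    obtain ⟨C, hC0, hC⟩ := h
    exact ⟨C, θ, hC0, hθ0, hθ1, hC⟩
  refine exists_forall_ge_of_extend_down (j₀ := j₀)
    (P := fun j C => ∀ k < 2 ^ j, ∀ i ≥ j, ∀ l, ∀ x ∈ suppInterval L i l, ∀ y ∈ suppInterval L i l,
      |W.φ j k x - W.φ j k y| ≤ C * scale j * θ ^ (i - j)) ?_ (max j₀ j₂) ?_ ?_
  · intro j C C' hC h k hk i hi l x hx y hy
    refine (h k hk i hi l x hx y hy).trans ?_
    have := scale_pos j
    gcongr
  · refine ⟨C * (2 * L) ^ (γ : ℝ), fun j hj k hk i hi l x hx y hy => ?_⟩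
    have hj' := le_of_max_le_left hj
    have hx1 := suppInterval_subset_Icc _ _ _ hx
    have hy1 := suppInterval_subset_Icc _ _ _ hy
    have hd : |2 ^ j * x - 2 ^ j * y| ≤ 2 * L * 2⁻¹ ^ (i - j) := by
      have h := abs_sub_le_of_mem_suppInterval hx hy
      rw [← mul_sub, abs_mul, abs_of_pos (by positivity : (0 : ℝ) < 2 ^ j), inv_pow,
        ← div_eq_mul_inv, le_div_iff₀ (by positivity)]
      calc (2 : ℝ) ^ j * |x - y| * 2 ^ (i - j) = 2 ^ (j + (i - j)) * |x - y| := by rw [pow_add]; ring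
        _ ≤ 2 * L := by rwa [Nat.add_sub_cancel' hi]
    have hpow : ((2 : ℝ) * L * 2⁻¹ ^ (i - j)) ^ (γ : ℝ) = (2 * L) ^ (γ : ℝ) * θ ^ (i - j) := by
      rw [Real.mul_rpow (by positivity) (by positivity)]
      congr 1
      rw [hθ, ← Real.rpow_natCast, ← Real.rpow_natCast, ← Real.rpow_mul (by positivity),
        ← Real.rpow_mul (by positivity), Real.inv_rpow (by norm_num), ← Real.rpow_neg (by norm_num)]
      congr 1; ring
    have hmain : ∀ (g : ℝ → ℝ) (s : Set ℝ) (u v : ℝ), HolderOnWith C γ g s → u ∈ s → v ∈ s →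
        |u - v| ≤ 2 * L * 2⁻¹ ^ (i - j) →
        |scale j * g u - scale j * g v| ≤ C * (2 * L) ^ (γ : ℝ) * scale j * θ ^ (i - j) := by
      intro g s u v hg hu hv huv
      have := HolderOnWith.abs_sub_le hg hu hv huv
      rw [hpow] at this
      rw [← mul_sub, abs_mul, abs_of_pos (scale_pos j)]
      calc scale j * |g u - g v| ≤ scale j * (C * ((2 * L) ^ (γ : ℝ) * θ ^ (i - j))) :=
            mul_le_mul_of_nonneg_left this (scale_pos j).le
        _ = _ := by ring
    rcases W.forms hj' (by have := hj₂ j (le_of_max_le_right hj); omega) hk with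
        ⟨_, hkL, hf⟩ | ⟨hkL, hf⟩ | ⟨k', hk', hkk, hf⟩
    · rw [hf x hx1, hf y hy1]
      refine hmain _ univ _ _ (holderOnWith_univ.2 h0) (mem_univ _) (mem_univ _) ?_
      rwa [sub_sub_sub_cancel_right]
    · rw [hf x hx1, hf y hy1]
      exact hmain _ (Ici 0) _ _ (hlr k hkL).1 (mem_Ici.2 (mul_nonneg (by positivity) hx1.1))
          (mem_Ici.2 (mul_nonneg (by positivity) hy1.1)) hd
    · rw [hf x hx1, hf y hy1]
      refine hmain _ (Ici 0) _ _ (hlr k' hk').2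
        (mem_Ici.2 (mul_nonneg (by positivity) (by linarith [hx1.2])))
        (mem_Ici.2 (mul_nonneg (by positivity) (by linarith [hy1.2]))) ?_
      rw [show (2 : ℝ) ^ j * (1 - x) - 2 ^ j * (1 - y) = -(2 ^ j * x - 2 ^ j * y) by ring, abs_neg]
      exact hd
  · rintro j hj ⟨C, hC⟩
    have hsj := scale_pos j
    refine ⟨max (2 * B) (2 ^ (j + 1) * (C * √2) / θ), fun k hk i hi l x hx y hy => ?_⟩
    have hx1 := suppInterval_subset_Icc _ _ _ hx
    have hy1 := suppInterval_subset_Icc _ _ _ hy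
    -- The bound at level `j + 1` says nothing when `i = j`; there the sup bound is used.
    rcases hi.eq_or_lt with rfl | hi'
    · rw [Nat.sub_self, pow_zero, mul_one]
      refine (abs_sub _ _).trans ?_
      have a1 := hB j hj k hk x hx1
      have a2 := hB j hj k hk y hy1
      have := mul_le_mul_of_nonneg_right (le_max_left (2 * B) (2 ^ (j + 1) * (C * √2) / θ)) hsj.le
      linarith
    · have hat := isAtom_φ W hj hk
      have hexp := (hat.refines.expansion (Nat.lt_succ_self j) (by omega)).2
      rw [hexp x hx1, hexp y hy1, ← Finset.sum_sub_distrib]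
      refine (Finset.abs_sum_le_sum_abs _ _).trans ?_
      refine (Finset.sum_le_card_nsmul _ _ (C * scale (j + 1) * θ ^ (i - (j + 1))) fun l' hl => ?_).trans ?_
      · have hl := Finset.mem_range.1 hl
        rw [← mul_sub, abs_mul]
        exact (mul_le_of_le_one_left (abs_nonneg _) (hat.abs_ip_le_one (Nat.lt_succ_self j) hl)).trans
          (hC l' hl i hi' l x hx y hy)
      · rw [Finset.card_range, nsmul_eq_mul, scale_succ]
        push_cast
        have e : θ ^ (i - j) = θ * θ ^ (i - (j + 1)) := by
          rw [← pow_succ']; congr 1; omega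
        have := mul_le_mul_of_nonneg_right
          (mul_le_mul_of_nonneg_right (le_max_right (2 * B) (2 ^ (j + 1) * (C * √2) / θ)) hsj.le)
          (pow_pos hθ0 (i - j)).le
        refine le_trans (le_of_eq ?_) this
        rw [e]; field_simp

/-- The wavelets inherit the bound from level `j + 1`, hence `i > j`. Only indices active at `x` or
at `y` contribute, so the factor `4L` does not depend on the level. -/
lemma exists_osc (W : WaveletBasis N L j₀) : ∃ C θ : ℝ, 0 ≤ C ∧ 0 < θ ∧ √2 * θ < 1 ∧
    ∀ j ≥ j₀, ∀ k < 2 ^ j, ∀ i > j, ∀ l, ∀ x ∈ suppInterval L i l, ∀ y ∈ suppInterval L i l,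
      |W.φ j k x - W.φ j k y| ≤ C * scale j * θ ^ (i - j) ∧
      |W.ψ j k x - W.ψ j k y| ≤ C * scale j * θ ^ (i - j) := by
  obtain ⟨C, θ, hC0, hθ0, hθ1, hC⟩ := exists_osc_φ W
  refine ⟨max C (2 * (2 * L * (C * √2)) / θ), θ, hC0.trans (le_max_left _ _), hθ0, hθ1,
    fun j hj k hk i hi l x hx y hy => ⟨?_, ?_⟩⟩
  · refine (hC j hj k hk i hi.le l x hx y hy).trans ?_
    have := scale_pos j
    gcongr
    exact le_max_left _ _
  · have hat := isAtom_ψ W hj hk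
    have hx1 := suppInterval_subset_Icc _ _ _ hx
    have hy1 := suppInterval_subset_Icc _ _ _ hy
    have hsj := scale_pos j
    have hsj1 := scale_pos (j + 1)
    have hexp := (hat.refines.expansion (Nat.lt_succ_self j) (by omega)).2
    rw [hexp x hx1, hexp y hy1, ← Finset.sum_sub_distrib]
    set D := C * scale (j + 1) * θ ^ (i - (j + 1))
    have hD : 0 ≤ D := by positivity
    have hterm : ∀ m < 2 ^ (j + 1), |ip (W.φ (j + 1) m) (W.ψ j k) * W.φ (j + 1) m x -
        ip (W.φ (j + 1) m) (W.ψ j k) * W.φ (j + 1) m y| ≤ D := by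
      intro m hm
      rw [← mul_sub, abs_mul]
      exact (mul_le_of_le_one_left (abs_nonneg _) (hat.abs_ip_le_one (Nat.lt_succ_self j) hm)).trans
        (hC (j + 1) (by omega) m hm i hi l x hx y hy)
    have hsub : active L (j + 1) x ∪ active L (j + 1) y ⊆ Finset.range (2 ^ (j + 1)) :=
      Finset.union_subset (active_subset _ _ _) (active_subset _ _ _)
    rw [← Finset.sum_subset hsub]
    · refine (Finset.abs_sum_le_sum_abs _ _).trans ?_
      refine (Finset.sum_le_card_nsmul _ _ D fun m hm =>
        hterm m (Finset.mem_range.1 (hsub hm))).trans ?_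
      have hcard : (((active L (j + 1) x ∪ active L (j + 1) y).card : ℕ) : ℝ) ≤ 2 * (2 * L) := by
        have h1 := Finset.card_union_le (active L (j + 1) x) (active L (j + 1) y)
        have h2 := card_active_le L (j + 1) x
        have h3 := card_active_le L (j + 1) y
        exact_mod_cast (by omega : (active L (j + 1) x ∪ active L (j + 1) y).card ≤ 2 * (2 * L))
      rw [nsmul_eq_mul]
      have e : θ ^ (i - j) = θ * θ ^ (i - (j + 1)) := by
        rw [← pow_succ']; congr 1; omega
      calc _ ≤ 2 * (2 * L) * D := mul_le_mul_of_nonneg_right hcard hD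
        _ = (2 * (2 * L * (C * √2)) / θ) * scale j * θ ^ (i - j) := by
          simp only [D]; rw [e, scale_succ]; field_simp
        _ ≤ _ := by gcongr; exact le_max_right _ _
    · intro m hm hm'
      rw [Finset.mem_union] at hm'
      push Not at hm'
      rw [(W.eq_zero_of_notMem_active (by omega) (Finset.mem_range.1 hm) hx1 hm'.1).1,
        (W.eq_zero_of_notMem_active (by omega) (Finset.mem_range.1 hm) hy1 hm'.2).1]
      simp

/-! ### Functions of Hölder order `1/2` -/

/-- The partial sums of the wavelet series. -/
noncomputable def partialSum (W : WaveletBasis N L j₀) (f : ℝ → ℝ) (i : ℕ) (x : ℝ) : ℝ :=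
  ∑ k ∈ Finset.range (2 ^ j₀), ip f (W.φ j₀ k) * W.φ j₀ k x
    + ∑ j ∈ Finset.Ico j₀ i, ∑ k ∈ Finset.range (2 ^ j), ip f (W.ψ j k) * W.ψ j k x

/-- Point values in the class are limits of the wavelet series, so bounds for partial sums pass to
`f` at every point, not just almost everywhere. -/
lemma abs_sub_le_of_partialSum {W : WaveletBasis N L j₀} {s M : ℝ} {I : Set ℝ} {f : ℝ → ℝ}
    (hf : f ∈ holderClass W s M I) {x : ℝ} (hx : x ∈ Icc (0 : ℝ) 1) {y B : ℝ} {i₀ : ℕ}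
    (h : ∀ i ≥ i₀, |partialSum W f i x - y| ≤ B) : |f x - y| ≤ B := by
  have h1 : Tendsto (fun i => |partialSum W f i x - y|) atTop (𝓝 |f x - y|) :=
    ((hf.2.1 x hx).sub_const y).abs
  exact le_of_tendsto h1 (eventually_atTop.2 ⟨i₀, h⟩)

lemma abs_coeff_φ_le {W : WaveletBasis N L j₀} {M : ℝ} {f : ℝ → ℝ}
    (hf : f ∈ holderClass W (1 / 2) M (Icc 0 1)) {k : ℕ} (hk : k < 2 ^ j₀) :
    |ip f (W.φ j₀ k)| ≤ M := by
  refine le_trans ?_ (hf.2.2.1 k hk (suppInterval_subset_Icc _ _ _))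
  refine le_mul_of_one_le_left (abs_nonneg _) (Real.one_le_rpow (by norm_num) ?_)
  positivity

lemma abs_coeff_ψ_le {W : WaveletBasis N L j₀} {M : ℝ} {f : ℝ → ℝ}
    (hf : f ∈ holderClass W (1 / 2) M (Icc 0 1)) {j k : ℕ} (hj : j₀ ≤ j) (hk : k < 2 ^ j) :
    |ip f (W.ψ j k)| ≤ M * (2 ^ j)⁻¹ := by
  have := hf.2.2.2 j hj k hk (suppInterval_subset_Icc _ _ _)
  rw [show (j : ℝ) * (1 / 2 + 1 / 2) = j by ring, Real.rpow_natCast, mul_comm] at this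
  rwa [← div_eq_mul_inv, le_div_iff₀ (by positivity)]

lemma sum_Ico_pow_le {t : ℝ} (h0 : 0 ≤ t) (h1 : t < 1) (m n : ℕ) :
    ∑ j ∈ Finset.Ico m n, t ^ j ≤ t ^ m / (1 - t) :=
  geom_sum_Ico_le_of_lt_one h0 h1

/-- Level `j` contributes at most `2L` terms of size `2^{-j} * 2^{j/2}`, a geometric series. -/
lemma exists_abs_sub_partialSum_le (W : WaveletBasis N L j₀) {M : ℝ} (hM : 0 ≤ M) :
    ∃ C, 0 ≤ C ∧ ∀ f ∈ holderClass W (1 / 2) M (Icc 0 1), ∀ i ≥ j₀, ∀ x ∈ Icc (0 : ℝ) 1,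
      |f x - partialSum W f i x| ≤ C * (scale i)⁻¹ := by
  obtain ⟨B, hB0, hB⟩ := exists_abs_ψ_le W
  have ht := inv_sqrt_two_lt_one
  have ht' : 0 < 1 - (√2)⁻¹ := by linarith
  refine ⟨2 * L * (M * B) / (1 - (√2)⁻¹), by positivity, fun f hf i hi x hx => ?_⟩
  refine abs_sub_le_of_partialSum hf hx (i₀ := i) fun i' hi' => ?_
  have e : partialSum W f i' x - partialSum W f i x =
      ∑ j ∈ Finset.Ico i i', ∑ k ∈ Finset.range (2 ^ j), ip f (W.ψ j k) * W.ψ j k x := by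
    rw [partialSum, partialSum, ← Finset.sum_Ico_consecutive _ hi hi']
    ring
  rw [e]
  refine (Finset.abs_sum_le_sum_abs _ _).trans ?_
  calc ∑ j ∈ Finset.Ico i i', |∑ k ∈ Finset.range (2 ^ j), ip f (W.ψ j k) * W.ψ j k x|
      ≤ ∑ j ∈ Finset.Ico i i', 2 * L * (M * B) * (√2)⁻¹ ^ j := by
        refine Finset.sum_le_sum fun j hj => ?_
        have hj' : j₀ ≤ j := hi.trans (Finset.mem_Ico.1 hj).1
        rw [mul_assoc (2 * (L : ℝ)), ← scale_inv_eq_pow]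
        have hsj := scale_pos j
        refine abs_sum_le_of_active (x := x) (fun k hk hk' => ?_) (fun k hk => ?_) (by positivity)
        · rw [(W.eq_zero_of_notMem_active hj' hk hx hk').2, mul_zero]
        · have hk' := (mem_active.1 hk).1
          rw [abs_mul, ← two_pow_inv_mul_scale]
          calc _ ≤ (M * (2 ^ j)⁻¹) * (B * scale j) :=
                mul_le_mul (abs_coeff_ψ_le hf hj' hk') (hB j hj' k hk' x hx) (abs_nonneg _)
                  (by positivity)
            _ = _ := by ring
    _ ≤ 2 * L * (M * B) * ((√2)⁻¹ ^ i / (1 - (√2)⁻¹)) := by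
        rw [← Finset.mul_sum]
        exact mul_le_mul_of_nonneg_left (sum_Ico_pow_le (by positivity) ht _ _) (by positivity)
    _ = _ := by rw [scale_inv_eq_pow]; ring

lemma exists_abs_le_of_mem_holderClass (W : WaveletBasis N L j₀) {M : ℝ} (hM : 0 ≤ M) :
    ∃ C, 0 ≤ C ∧ ∀ f ∈ holderClass W (1 / 2) M (Icc 0 1), ∀ x ∈ Icc (0 : ℝ) 1, |f x| ≤ C := by
  obtain ⟨B, hB0, hB⟩ := exists_abs_φ_le W
  obtain ⟨C, hC0, hC⟩ := exists_abs_sub_partialSum_le W hM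
  have hs := scale_pos j₀
  refine ⟨C * (scale j₀)⁻¹ + 2 ^ j₀ * (M * (B * scale j₀)), by positivity, fun f hf x hx => ?_⟩
  have h1 := hC f hf j₀ le_rfl x hx
  have h2 : |partialSum W f j₀ x| ≤ 2 ^ j₀ * (M * (B * scale j₀)) := by
    rw [partialSum, Finset.Ico_self, Finset.sum_empty, add_zero]
    refine (Finset.abs_sum_le_sum_abs _ _).trans ?_
    refine (Finset.sum_le_card_nsmul _ _ (M * (B * scale j₀)) fun k hk => ?_).trans (by simp)
    have hk := Finset.mem_range.1 hk
    rw [abs_mul]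
    exact mul_le_mul (abs_coeff_φ_le hf hk) (hB j₀ le_rfl k hk x hx) (abs_nonneg _) hM
  have h3 : |f x| ≤ |f x - partialSum W f j₀ x| + |partialSum W f j₀ x| := by
    simpa using abs_add_le (f x - partialSum W f j₀ x) (partialSum W f j₀ x)
  linarith

lemma sum_Ico_pow_sub_le {t : ℝ} (h0 : 0 ≤ t) (h1 : t < 1) (m n : ℕ) :
    ∑ j ∈ Finset.Ico m n, t ^ (n - j) ≤ 1 / (1 - t) := by
  calc ∑ j ∈ Finset.Ico m n, t ^ (n - j) ≤ ∑ j ∈ Finset.range (n + 1), t ^ (n - j) :=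
        Finset.sum_le_sum_of_subset_of_nonneg
          (fun j hj => by rw [Finset.mem_Ico] at hj; rw [Finset.mem_range]; omega)
          (fun _ _ _ => by positivity)
    _ = ∑ j ∈ Finset.range (n + 1), t ^ j := Finset.sum_flip (fun j => t ^ j)
    _ ≤ 1 / (1 - t) := by
        have := sum_Ico_pow_le h0 h1 0 (n + 1)
        rwa [← Finset.range_eq_Ico, pow_zero] at this

/-- Levels `j ≥ i` form a tail of order `2^{-i/2}`. A level `j < i` contributes `2^{-j} * 2^{j/2} *
θ^(i-j) = 2^{-i/2} * (√2 θ)^(i-j)`, which is summable because `√2 * θ < 1`. -/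
lemma exists_osc_of_mem_holderClass (W : WaveletBasis N L j₀) {M : ℝ} (hM : 0 ≤ M) :
    ∃ C, 0 ≤ C ∧ ∀ f ∈ holderClass W (1 / 2) M (Icc 0 1), ∀ i > j₀, ∀ l,
      ∀ x ∈ suppInterval L i l, ∀ y ∈ suppInterval L i l, |f x - f y| ≤ C * (scale i)⁻¹ := by
  obtain ⟨C, θ, hC0, hθ0, hθ1, hC⟩ := exists_osc W
  obtain ⟨D, hD0, hD⟩ := exists_abs_sub_partialSum_le W hM
  have hs0 := scale_pos j₀
  have hθ' : 0 < 1 - √2 * θ := by linarith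
  refine ⟨2 * D + (2 ^ j₀ * (M * (C * (scale j₀ * scale j₀))) + 2 * (2 * L * (M * C)) / (1 - √2 * θ)),
    by positivity, fun f hf i hi l x hx y hy => ?_⟩
  have hx1 := suppInterval_subset_Icc _ _ _ hx
  have hy1 := suppInterval_subset_Icc _ _ _ hy
  have hsi := scale_pos i
  have hscale : ∀ j ≤ i, scale j * θ ^ (i - j) = scale j * scale j * (scale i)⁻¹ * (√2 * θ) ^ (i - j) := by
    intro j hj
    have : scale i = scale j * √2 ^ (i - j) := by
      rw [scale_eq_pow, scale_eq_pow, ← pow_add, Nat.add_sub_cancel' hj]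
    have h2 := scale_pos j
    rw [this, mul_pow]; field_simp
  have h1 : |∑ k ∈ Finset.range (2 ^ j₀), ip f (W.φ j₀ k) * W.φ j₀ k x -
      ∑ k ∈ Finset.range (2 ^ j₀), ip f (W.φ j₀ k) * W.φ j₀ k y| ≤
      2 ^ j₀ * (M * (C * (scale j₀ * scale j₀))) * (scale i)⁻¹ := by
    rw [← Finset.sum_sub_distrib]
    refine (Finset.abs_sum_le_sum_abs _ _).trans ?_
    refine (Finset.sum_le_card_nsmul _ _ (M * (C * (scale j₀ * scale j₀)) * (scale i)⁻¹)
      fun k hk => ?_).trans ?_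
    · have hk := Finset.mem_range.1 hk
      rw [← mul_sub, abs_mul]
      have h3 := (hC j₀ le_rfl k hk i hi l x hx y hy).1
      rw [mul_assoc, hscale j₀ (by omega)] at h3
      have h4 : (√2 * θ) ^ (i - j₀) ≤ 1 := pow_le_one₀ (by positivity) hθ1.le
      calc _ ≤ M * (C * (scale j₀ * scale j₀ * (scale i)⁻¹ * (√2 * θ) ^ (i - j₀))) :=
            mul_le_mul (abs_coeff_φ_le hf hk) h3 (abs_nonneg _) hM
        _ ≤ M * (C * (scale j₀ * scale j₀ * (scale i)⁻¹ * 1)) := by gcongr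
        _ = _ := by ring
    · rw [Finset.card_range, nsmul_eq_mul]; push_cast; exact le_of_eq (by ring)
  have h2 : |∑ j ∈ Finset.Ico j₀ i, ∑ k ∈ Finset.range (2 ^ j), ip f (W.ψ j k) * W.ψ j k x -
      ∑ j ∈ Finset.Ico j₀ i, ∑ k ∈ Finset.range (2 ^ j), ip f (W.ψ j k) * W.ψ j k y| ≤
      2 * (2 * L * (M * C)) / (1 - √2 * θ) * (scale i)⁻¹ := by
    rw [← Finset.sum_sub_distrib]
    refine (Finset.abs_sum_le_sum_abs _ _).trans ?_
    calc _ ≤ ∑ j ∈ Finset.Ico j₀ i, 2 * (2 * L * (M * C)) * (scale i)⁻¹ * (√2 * θ) ^ (i - j) := by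
          refine Finset.sum_le_sum fun j hj => ?_
          obtain ⟨hj1, hj2⟩ := Finset.mem_Ico.1 hj
          have hsj := scale_pos j
          rw [← Finset.sum_sub_distrib]
          have hsub : active L j x ∪ active L j y ⊆ Finset.range (2 ^ j) :=
            Finset.union_subset (active_subset _ _ _) (active_subset _ _ _)
          rw [← Finset.sum_subset hsub]
          · have hb : ∀ k ∈ active L j x ∪ active L j y,
                |ip f (W.ψ j k) * W.ψ j k x - ip f (W.ψ j k) * W.ψ j k y| ≤
                  M * C * ((scale i)⁻¹ * (√2 * θ) ^ (i - j)) := by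
              intro k hk
              have hk := Finset.mem_range.1 (hsub hk)
              have h3 := (hC j hj1 k hk i hj2 l x hx y hy).2
              rw [mul_assoc, hscale j hj2.le, scale_mul_self] at h3
              rw [← mul_sub, abs_mul]
              calc _ ≤ (M * (2 ^ j)⁻¹) * (C * (2 ^ j * (scale i)⁻¹ * (√2 * θ) ^ (i - j))) :=
                    mul_le_mul (abs_coeff_ψ_le hf hj1 hk) h3 (abs_nonneg _) (by positivity)
                _ = _ := by field_simp
            refine (Finset.abs_sum_le_sum_abs _ _).trans ?_
            refine (Finset.sum_le_card_nsmul _ _ _ hb).trans ?_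
            have hcard : (((active L j x ∪ active L j y).card : ℕ) : ℝ) ≤ 2 * (2 * L) := by
              have h1 := Finset.card_union_le (active L j x) (active L j y)
              have h2 := card_active_le L j x
              have h3 := card_active_le L j y
              exact_mod_cast (by omega : (active L j x ∪ active L j y).card ≤ 2 * (2 * L))
            rw [nsmul_eq_mul]
            calc _ ≤ 2 * (2 * L) * (M * C * ((scale i)⁻¹ * (√2 * θ) ^ (i - j))) :=
                  mul_le_mul_of_nonneg_right hcard (by positivity)
              _ = _ := by ring
          · intro k hk hk'
            rw [Finset.mem_union] at hk'
            push Not at hk'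
            rw [(W.eq_zero_of_notMem_active hj1 (Finset.mem_range.1 hk) hx1 hk'.1).2,
              (W.eq_zero_of_notMem_active hj1 (Finset.mem_range.1 hk) hy1 hk'.2).2]
            simp
      _ ≤ 2 * (2 * L * (M * C)) * (scale i)⁻¹ * (1 / (1 - √2 * θ)) := by
          rw [← Finset.mul_sum]
          exact mul_le_mul_of_nonneg_left (sum_Ico_pow_sub_le (by positivity) hθ1 _ _) (by positivity)
      _ = _ := by ring
  have h3 := hD f hf i hi.le x hx1
  have h4 := hD f hf i hi.le y hy1
  have h5 : |partialSum W f i x - partialSum W f i y| ≤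
      (2 ^ j₀ * (M * (C * (scale j₀ * scale j₀))) + 2 * (2 * L * (M * C)) / (1 - √2 * θ)) * (scale i)⁻¹ := by
    rw [partialSum, partialSum, add_sub_add_comm, add_mul]
    exact (abs_add_le _ _).trans (add_le_add h1 h2)
  rw [abs_le] at *
  constructor <;> linarith [h3.1, h3.2, h4.1, h4.2, h5.1, h5.2]

/-! ### Scaling coefficients and point values -/

/-- The support of the interior generator is read off from that of `φ_{i,k}` with `k = 2^(i-1)`, at
a level `i` so fine that `(u + k)/2^i` lies in `[0,1]`. -/
lemma φ₀_eq_zero (W : WaveletBasis N L j₀) {u : ℝ} (hu : ¬ (1 - (L : ℝ) ≤ u ∧ u < L)) :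
    W.φ₀ u = 0 := by
  obtain ⟨m, hm⟩ := exists_nat_ge |u|
  obtain ⟨hm1, hm2⟩ := abs_le.1 hm
  have hL := W.one_le_L
  set i := j₀ + L + m + 1
  set k := 2 ^ (j₀ + L + m)
  have hi : j₀ ≤ i := by omega
  have hkL : j₀ + L + m < k := Nat.lt_two_pow_self
  have h2i : 2 ^ i = 2 * k := by simp only [i, k, pow_succ]; ring
  have h2ir : (2 : ℝ) ^ i = 2 * k := by exact_mod_cast h2i
  have hmk : (m : ℝ) ≤ k := by exact_mod_cast (by omega : m ≤ k)
  have hpos : (0 : ℝ) < 2 ^ i := by positivity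
  have hx : (u + k) / 2 ^ i ∈ Icc (0 : ℝ) 1 := by
    rw [mem_Icc, div_le_one hpos]
    exact ⟨div_nonneg (by linarith) hpos.le, by linarith⟩
  have h1 := (W.interior i hi k (by omega) (by omega) _ hx).1
  have h2 := (W.support i hi k (by omega) _ hx (by
    rw [mem_suppInterval_iff, mul_div_cancel₀ _ hpos.ne']
    exact fun h => hu ⟨by linarith [h.1.1], by linarith [h.1.2]⟩) (fun _ => by omega)).1
  rw [h2, mul_div_cancel₀ _ hpos.ne', add_sub_cancel_right] at h1
  exact (mul_eq_zero.1 h1.symm).resolve_left (scale_pos i).ne'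

lemma integral_φ_interior (W : WaveletBasis N L j₀) {i l : ℕ} (hi : j₀ ≤ i) (h1 : L ≤ l)
    (h2 : l + L < 2 ^ i) : ∫ x in Icc (0 : ℝ) 1, W.φ i l x = (scale i)⁻¹ := by
  have hpos : (0 : ℝ) < 2 ^ i := by positivity
  have e1 : ∫ x in Icc (0 : ℝ) 1, W.φ i l x =
      ∫ x in Icc (0 : ℝ) 1, scale i * W.φ₀ (2 ^ i * x - l) :=
    setIntegral_congr_fun measurableSet_Icc fun x hx => (W.interior i hi l h1 h2 x hx).1
  rw [e1, setIntegral_eq_integral_of_forall_compl_eq_zero, integral_const_mul,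
    Measure.integral_comp_mul_left (fun y => W.φ₀ (y - l)), integral_sub_right_eq_self,
    W.integral_φ₀, abs_of_pos (by positivity), smul_eq_mul, mul_one, mul_comm,
    two_pow_inv_mul_scale]
  intro x hx
  rw [φ₀_eq_zero W, mul_zero]
  rintro ⟨h3, h4⟩
  apply hx
  have h1' : (L : ℝ) ≤ l := by exact_mod_cast h1
  have h2' : (l : ℝ) + L < 2 ^ i := by exact_mod_cast h2
  constructor
  · by_contra hc; push Not at hc; nlinarith
  · by_contra hc; push Not at hc; nlinarith

lemma abs_integral_mul_φ_le (W : WaveletBasis N L j₀) {i l : ℕ} (hi : j₀ ≤ i) (hl : l < 2 ^ i)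
    {g : ℝ → ℝ} {A B : ℝ} (hA : 0 ≤ A) (hB : 0 ≤ B) (hg : ∀ x ∈ suppInterval L i l, |g x| ≤ A)
    (hφ : ∀ x ∈ Icc (0 : ℝ) 1, |W.φ i l x| ≤ B * scale i) :
    |∫ x in Icc (0 : ℝ) 1, g x * W.φ i l x| ≤ 2 * L * (A * B) * (scale i)⁻¹ := by
  have hs := scale_pos i
  rw [integral_Icc_eq_integral_Ico,
    setIntegral_eq_of_subset_of_forall_sdiff_eq_zero measurableSet_Ico
      (s := suppInterval L i l) inter_subset_right]
  · rw [← Real.norm_eq_abs]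
    refine (norm_setIntegral_le_of_norm_le_const (C := A * (B * scale i)) ?_ ?_).trans ?_
    · exact (measure_mono (suppInterval_subset_Icc L i l)).trans_lt (by simp)
    · intro x hx
      rw [Real.norm_eq_abs, abs_mul]
      exact mul_le_mul (hg x hx) (hφ x (suppInterval_subset_Icc _ _ _ hx)) (abs_nonneg _) hA
    · calc _ ≤ A * (B * scale i) * (2 * L / 2 ^ i) :=
            mul_le_mul_of_nonneg_left (volume_suppInterval_le W.one_le_L i l) (by positivity)
        _ = _ := by rw [← two_pow_inv_mul_scale]; ring
  · intro x hx
    rw [(W.support i hi l hl x (Ico_subset_Icc_self hx.1) hx.2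
      (fun h => absurd h hx.1.2.ne)).1, mul_zero]

/-- An interior `φ_{i,l}` has integral `2^{-i/2}`, so the difference is the integral of `f(l/2^i) -
f(x)` against it and gains the oscillation of `f`. Boundary functions need not be normalised this
way; for them boundedness of `f` gives the weaker rate, which suffices because there are at most
`2L` of them. -/
lemma exists_scaling_coeff_bound (W : WaveletBasis N L j₀) {M : ℝ} (hM : 0 ≤ M) :
    ∃ C, 0 ≤ C ∧ ∀ f ∈ holderClass W (1 / 2) M (Icc 0 1), ∀ i > j₀, ∀ l : ℕ, l < 2 ^ i →
      |(scale i)⁻¹ * f (l / 2 ^ i) - ip f (W.φ i l)| ≤ C * (scale i)⁻¹ ∧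
      (L ≤ l → l + L < 2 ^ i →
        |(scale i)⁻¹ * f (l / 2 ^ i) - ip f (W.φ i l)| ≤ C * (2 ^ i)⁻¹) := by
  obtain ⟨B, hB0, hB⟩ := exists_abs_φ_le W
  obtain ⟨D, hD0, hD⟩ := exists_abs_le_of_mem_holderClass W hM
  obtain ⟨E, hE0, hE⟩ := exists_osc_of_mem_holderClass W hM
  refine ⟨max (D + 2 * L * (D * B)) (2 * L * (E * B)), by positivity, fun f hf i hi l hl => ?_⟩
  have hs := scale_pos i
  have hi' : j₀ ≤ i := le_of_lt hi
  have hp := cell_left_mem_suppInterval W.one_le_L hl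
  constructor
  · have h1 := abs_integral_mul_φ_le W hi' hl hD0 hB0 (g := f)
      (fun x hx => hD f hf x (suppInterval_subset_Icc _ _ _ hx)) (hB i hi' l hl)
    have h2 : |(scale i)⁻¹ * f (l / 2 ^ i)| ≤ (scale i)⁻¹ * D := by
      rw [abs_mul, abs_of_pos (inv_pos.2 hs)]
      exact mul_le_mul_of_nonneg_left (hD f hf _ (suppInterval_subset_Icc _ _ _ hp)) (inv_pos.2 hs).le
    calc _ ≤ (D + 2 * L * (D * B)) * (scale i)⁻¹ := by
          refine (abs_sub _ _).trans ?_
          rw [ip]; linarith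
      _ ≤ _ := by gcongr; exact le_max_left _ _
  · intro h1 h2
    have e : (scale i)⁻¹ * f (l / 2 ^ i) - ip f (W.φ i l) =
        ∫ x in Icc (0 : ℝ) 1, (f (l / 2 ^ i) - f x) * W.φ i l x := by
      simp_rw [sub_mul]
      rw [integral_sub, integral_const_mul, integral_φ_interior W hi' h1 h2, ip, mul_comm]
      · exact ((W.memLp_φ i hi' l hl).integrable (by norm_num)).const_mul _
      · exact hf.1.integrable_mul (W.memLp_φ i hi' l hl)
    have h3 := abs_integral_mul_φ_le W hi' hl (A := E * (scale i)⁻¹) (by positivity) hB0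
      (g := fun x => f (l / 2 ^ i) - f x) (fun x hx => hE f hf i hi l _ hp x hx) (hB i hi' l hl)
    rw [e]
    calc _ ≤ 2 * L * (E * B) * (2 ^ i)⁻¹ := by
          refine h3.trans (le_of_eq ?_)
          rw [← scale_mul_self]; field_simp
      _ ≤ _ := by gcongr; exact le_max_right _ _

/-- The bias of the grid estimates of the coefficients is at most of the order of the noise. -/
lemma exists_bias_bound (W : WaveletBasis N L j₀) {M : ℝ} (hM : 0 ≤ M) :
    ∃ C, 0 ≤ C ∧ ∀ f ∈ holderClass W (1 / 2) M (Icc 0 1), ∀ j k b, IsAtom W j k b → ∀ i > j,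
      |∑ l ∈ Finset.range (2 ^ i), (scale i)⁻¹ * f (l / 2 ^ i) * ip (W.φ i l) b - ip f b| ≤
        C * (scale i)⁻¹ := by
  classical
  obtain ⟨C, hC0, hC⟩ := exists_scaling_coeff_bound W hM
  refine ⟨C * (1 + 2 * L), by positivity, fun f hf j k b hb i hi => ?_⟩
  have hs := scale_pos i
  have hj := hb.le
  have hi₀ : j₀ < i := lt_of_le_of_lt hj hi
  set d : ℕ → ℝ := fun l => (scale i)⁻¹ * f (l / 2 ^ i) - ip f (W.φ i l) with hd
  rw [hb.refines.ip_eq hi hi₀.le hf.1, ← Finset.sum_sub_distrib]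
  have e : ∑ l ∈ Finset.range (2 ^ i), ((scale i)⁻¹ * f (l / 2 ^ i) * ip (W.φ i l) b -
      ip (W.φ i l) b * ip f (W.φ i l)) = ∑ l ∈ Finset.range (2 ^ i), d l * ip (W.φ i l) b :=
    Finset.sum_congr rfl fun l _ => by simp only [hd]; ring
  rw [e]
  -- By Cauchy–Schwarz against a unit vector it remains to bound the sum of the `d l ^ 2`: at most
  -- `2^i` terms of order `2^{-2i}`, and in addition at most `2L` boundary terms of order `2^{-i}`.
  have hcs := Finset.sum_mul_sq_le_sq_mul_sq (Finset.range (2 ^ i)) d (fun l => ip (W.φ i l) b)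
  rw [hb.sum_sq hi, mul_one] at hcs
  set bd := (Finset.range (2 ^ i)).filter (fun l => l < L ∨ 2 ^ i ≤ l + L) with hbd
  have hcard : (bd.card : ℝ) ≤ 2 * L := by
    have h1 : bd ⊆ Finset.range L ∪ Finset.Ico (2 ^ i - L) (2 ^ i) := by
      intro l hl
      rw [hbd, Finset.mem_filter, Finset.mem_range] at hl
      rw [Finset.mem_union, Finset.mem_range, Finset.mem_Ico]
      omega
    have h2 := (Finset.card_le_card h1).trans (Finset.card_union_le _ _)
    rw [Finset.card_range, Nat.card_Ico] at h2
    exact_mod_cast (by omega : bd.card ≤ 2 * L)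
  have hsum : ∑ l ∈ Finset.range (2 ^ i), d l ^ 2 ≤ (1 + 2 * L) * (C ^ 2 * (2 ^ i)⁻¹) := by
    have h1 : ∀ l ∈ Finset.range (2 ^ i), d l ^ 2 ≤
        C ^ 2 * ((2 ^ i)⁻¹) ^ 2 + if l < L ∨ 2 ^ i ≤ l + L then C ^ 2 * (2 ^ i)⁻¹ else 0 := by
      intro l hl
      obtain ⟨h2, h3⟩ := hC f hf i hi₀ l (Finset.mem_range.1 hl)
      split_ifs with h
      · have h5 : d l ^ 2 ≤ (C * (scale i)⁻¹) ^ 2 := by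
          rw [← sq_abs]; exact pow_le_pow_left₀ (abs_nonneg _) h2 2
        have h6 : (C * (scale i)⁻¹) ^ 2 = C ^ 2 * (2 ^ i)⁻¹ := by
          rw [← scale_mul_self, mul_pow]; field_simp
        rw [h6] at h5
        have : 0 ≤ C ^ 2 * (((2 : ℝ) ^ i)⁻¹) ^ 2 := by positivity
        linarith
      · push Not at h
        have := pow_le_pow_left₀ (abs_nonneg _) (h3 h.1 h.2) 2
        rw [sq_abs, mul_pow] at this
        rw [add_zero]; exact this
    refine (Finset.sum_le_sum h1).trans ?_
    rw [Finset.sum_add_distrib, Finset.sum_const, Finset.card_range, ← Finset.sum_filter, ← hbd,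
      Finset.sum_const, nsmul_eq_mul, nsmul_eq_mul]
    have e1 : ((2 ^ i : ℕ) : ℝ) * (C ^ 2 * ((2 ^ i)⁻¹) ^ 2) = C ^ 2 * (2 ^ i)⁻¹ := by
      push_cast; field_simp
    rw [e1, add_mul, one_mul]
    gcongr
  apply abs_le_of_sq_le_sq _ (by positivity)
  refine (hcs.trans hsum).trans ?_
  have e2 : (C * (1 + 2 * (L : ℝ)) * (scale i)⁻¹) ^ 2 =
      (1 + 2 * L) * ((1 + 2 * L) * (C ^ 2 * (2 ^ i)⁻¹)) := by
    rw [← scale_mul_self, mul_pow]; field_simp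
  rw [e2]
  refine le_mul_of_one_le_left (by positivity) ?_
  have : (0 : ℝ) ≤ L := by positivity
  linarith

/-! ### Grids and cells -/

lemma grid_mono {i i' : ℕ} (h : i ≤ i') : grid i ⊆ grid i' := by
  rintro p ⟨k, rfl⟩
  refine ⟨k * 2 ^ (i' - i), ?_⟩
  have e : (2 : ℝ) ^ i' = 2 ^ i * 2 ^ (i' - i) := by rw [← pow_add, Nat.add_sub_cancel' h]
  rw [e]; push_cast; field_simp

lemma designSet_mono (x : ℕ → ℝ) {n n' : ℕ} (h : n ≤ n') : designSet x n ⊆ designSet x n' :=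
  image_mono (Iio_subset_Iio h)

lemma finite_designSet (x : ℕ → ℝ) (n : ℕ) : (designSet x n).Finite := (finite_Iio n).image x

lemma ncard_designSet_le (x : ℕ → ℝ) (n : ℕ) : (designSet x n).ncard ≤ n := by
  have := ncard_image_le (f := x) (finite_Iio n)
  simpa [designSet, ncard_eq_toFinset_card'] using this

lemma exists_mem_cell {p : ℝ} (hp : p ∈ Ico (0 : ℝ) 1) (J : ℕ) : ∃ l < 2 ^ J, p ∈ cell J l := by
  have h0 : (0 : ℝ) < 2 ^ J := by positivity
  have h1 : 0 ≤ p * 2 ^ J := mul_nonneg hp.1 h0.le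
  refine ⟨⌊p * 2 ^ J⌋₊, ?_, ?_⟩
  · rw [Nat.floor_lt h1]; push_cast; nlinarith [hp.2]
  · rw [cell, mem_Ico, div_le_iff₀ h0, lt_div_iff₀ h0]
    exact ⟨Nat.floor_le h1, Nat.lt_floor_add_one _⟩

lemma cell_subset_Ico {J l : ℕ} (hl : l < 2 ^ J) : cell J l ⊆ Ico 0 1 := by
  refine Ico_subset_Ico (by positivity) ?_
  rw [div_le_one (by positivity)]
  exact_mod_cast hl

lemma cell_subset_suppInterval (hL : 1 ≤ L) {j k : ℕ} (hk : k < 2 ^ j) :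
    cell j k ⊆ suppInterval L j k := by
  have : (1 : ℝ) ≤ L := by exact_mod_cast hL
  refine subset_inter (Ico_subset_Ico ?_ ?_) (cell_subset_Ico hk)
  · gcongr; linarith
  · gcongr

/-- A cell of level `J` contains `2^(i-J)` points of the grid. This keeps the sets of admissible
levels bounded, so that their suprema are maxima and not default values. -/
lemma two_pow_le_of_grid_inter_cell_subset {x : ℕ → ℝ} {J l i n : ℕ} (hi : J ≤ i)
    (h : grid i ∩ cell J l ⊆ designSet x n) : 2 ^ (i - J) ≤ n := by
  have e : (2 : ℝ) ^ i = 2 ^ J * 2 ^ (i - J) := by rw [← pow_add, Nat.add_sub_cancel' hi]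
  set g : ℕ → ℝ := fun k => ((l * 2 ^ (i - J) + k : ℕ) : ℝ) / 2 ^ i with hg
  have hinj : InjOn g (Iio (2 ^ (i - J))) := by
    intro a _ b _ hab
    simp only [hg] at hab
    rw [div_left_inj' (by positivity)] at hab
    have := Nat.cast_injective hab
    omega
  have hsub : g '' Iio (2 ^ (i - J)) ⊆ designSet x n := by
    refine Subset.trans ?_ h
    rintro _ ⟨k, hk, rfl⟩
    refine ⟨⟨(l * 2 ^ (i - J) + k : ℕ), by simp [hg]⟩, ?_⟩
    have hk' : ((k : ℕ) : ℝ) < 2 ^ (i - J) := by exact_mod_cast hk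
    have hk0 : (0 : ℝ) ≤ k := by positivity
    have hJ : (0 : ℝ) < 2 ^ J := by positivity
    simp only [hg]
    rw [cell, mem_Ico, e, div_le_div_iff₀ (by positivity) (by positivity),
      div_lt_div_iff₀ (by positivity) (by positivity)]
    push_cast
    constructor <;> nlinarith
  have h1 := (ncard_le_ncard hsub (finite_designSet x n)).trans (ncard_designSet_le x n)
  rw [hinj.ncard_image, ncard_eq_toFinset_card'] at h1
  simpa using h1

lemma card_le_of_mapsTo_grid_inter_cell {x : ℕ → ℝ} {J l i : ℕ} (hi : J ≤ i) {s : Finset ℕ}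
    (hinj : InjOn x s) (h : ∀ t ∈ s, x t ∈ grid i ∩ cell J l) : s.card ≤ 2 ^ (i - J) := by
  have e : (2 : ℝ) ^ i = 2 ^ J * 2 ^ (i - J) := by rw [← pow_add, Nat.add_sub_cancel' hi]
  set F : Finset ℝ := (Finset.Ico (l * 2 ^ (i - J) : ℤ) ((l + 1) * 2 ^ (i - J))).image
    (fun k : ℤ => (k : ℝ) / 2 ^ i) with hF
  have hmaps : ∀ t ∈ s, x t ∈ F := by
    intro t ht
    obtain ⟨⟨k, hk⟩, hc⟩ := h t ht
    rw [cell, mem_Ico, hk, e, div_le_div_iff₀ (by positivity) (by positivity),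
      div_lt_div_iff₀ (by positivity) (by positivity)] at hc
    have hJ : (0 : ℝ) < 2 ^ J := by positivity
    refine Finset.mem_image.2 ⟨k, Finset.mem_Ico.2 ⟨?_, ?_⟩, hk.symm⟩
    · have : (l : ℝ) * 2 ^ (i - J) ≤ k := by nlinarith
      exact_mod_cast this
    · have : (k : ℝ) < (l + 1) * 2 ^ (i - J) := by nlinarith
      exact_mod_cast this
  refine (Finset.card_le_card_of_injOn x hmaps hinj).trans ?_
  refine Finset.card_image_le.trans ?_
  rw [Int.card_Ico, show ((l : ℤ) + 1) * 2 ^ (i - J) - l * 2 ^ (i - J) = ((2 ^ (i - J) : ℕ) : ℤ) by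
    push_cast; ring, Int.toNat_natCast]

lemma card_le_of_mapsTo_grid {x : ℕ → ℝ} {i : ℕ} {s : Finset ℕ}
    (hinj : InjOn x s) (h : ∀ t ∈ s, x t ∈ grid i ∩ Ico 0 1) : s.card ≤ 2 ^ i := by
  refine card_le_of_mapsTo_grid_inter_cell (J := 0) (l := 0) (Nat.zero_le i) hinj fun t ht => ?_
  have := h t ht
  simpa [cell] using this

/-- The finest grid of which the first `n` design points contain the points in a cell. -/
noncomputable def cellLevel (J : ℕ) (x : ℕ → ℝ) (n l : ℕ) : ℕ :=
  sSup {i | grid i ∩ cell J l ⊆ designSet x n}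

lemma bddAbove_cellLevel (J : ℕ) (x : ℕ → ℝ) (n l : ℕ) :
    BddAbove {i | grid i ∩ cell J l ⊆ designSet x n} := by
  refine ⟨J + n, fun i hi => ?_⟩
  by_contra hc
  have h1 := two_pow_le_of_grid_inter_cell_subset (by omega) hi
  have h2 : i - J < 2 ^ (i - J) := Nat.lt_two_pow_self
  omega

lemma le_cellLevel {J : ℕ} {x : ℕ → ℝ} {n l i : ℕ} (h : grid i ∩ cell J l ⊆ designSet x n) :
    i ≤ cellLevel J x n l := le_csSup (bddAbove_cellLevel J x n l) h

lemma subset_of_le_cellLevel {J : ℕ} {x : ℕ → ℝ} {n l i : ℕ}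
    (h0 : grid J ∩ cell J l ⊆ designSet x n) (h : i ≤ cellLevel J x n l) :
    grid i ∩ cell J l ⊆ designSet x n := by
  have h1 : grid (cellLevel J x n l) ∩ cell J l ⊆ designSet x n :=
    Nat.sSup_mem (s := {i | grid i ∩ cell J l ⊆ designSet x n}) ⟨J, h0⟩ (bddAbove_cellLevel J x n l)
  exact (inter_subset_inter_left _ (grid_mono h)).trans h1

/-! ### The while loop -/

lemma LoopHead.le {J total start n : ℕ} {p x : ℕ → ℝ} (h : LoopHead J p total x start n) :
    start ≤ n := by
  induction h with
  | enter => exact le_rfl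
  | pass => omega

lemma injOn_Iio_of_injOn_Ico {x : ℕ → ℝ} {n n' : ℕ} (h1 : InjOn x (Iio n))
    (h2 : InjOn x (Ico n n')) (h3 : ∀ t ∈ Ico n n', x t ∉ designSet x n) : InjOn x (Iio n') := by
  intro a ha b hb hab
  by_cases han : a < n <;> by_cases hbn : b < n
  · exact h1 han hbn hab
  · exact absurd ⟨a, han, hab⟩ (h3 b ⟨by omega, hb⟩)
  · exact absurd ⟨b, hbn, hab.symm⟩ (h3 a ⟨by omega, ha⟩)
  · exact h2 ⟨by omega, ha⟩ ⟨by omega, hb⟩ hab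

/-- The dyadic numbers in `[0,1)`. -/
def dyadics : Set ℝ := {p | ∃ i, p ∈ grid i} ∩ Ico 0 1

lemma countable_dyadics : dyadics.Countable := by
  refine Countable.mono inter_subset_left ?_
  have : {p : ℝ | ∃ i, p ∈ grid i} = ⋃ i, range (fun k : ℤ => (k : ℝ) / 2 ^ i) := by
    ext p; simp [grid, eq_comm]
  rw [this]
  exact countable_iUnion fun i => countable_range _

lemma LoopHead.injOn {J total start n : ℕ} {p x : ℕ → ℝ} (h : LoopHead J p total x start n)
    (h0 : InjOn x (Iio start)) (hd : ∀ t < start, x t ∈ dyadics) :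
    InjOn x (Iio n) ∧ ∀ t < n, x t ∈ dyadics := by
  induction h with
  | enter => exact ⟨h0, hd⟩
  | pass n n' l i h hn hl _ _ hnn' _ hinj hsub _ ih =>
    refine ⟨injOn_Iio_of_injOn_Ico ih.1 hinj fun t ht => (hsub ⟨t, ht, rfl⟩).2, fun t ht => ?_⟩
    by_cases htn : t < n
    · exact ih.2 t htn
    · have := (hsub ⟨t, ⟨by omega, ht⟩, rfl⟩).1
      exact ⟨⟨i, this.1⟩, cell_subset_Ico hl this.2⟩

/-- The points added by the loop lie in grids which, relative to the target density, are not much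
finer than the grids in any other cell. -/
lemma LoopHead.invariant {J total start n : ℕ} {p x : ℕ → ℝ} (h : LoopHead J p total x start n)
    (hstart : 0 < start) (hgrid : grid J ∩ Ico 0 1 ⊆ designSet x start) (hp : ∀ l, 0 ≤ p l) :
    ∀ t ∈ Ico start n, ∃ l < 2 ^ J, ∃ i ≥ J, x t ∈ grid (i + 1) ∩ cell J l ∧
      ∀ l' < 2 ^ J, p l' * 2 ^ i ≤ p l * 2 ^ cellLevel J x n l' := by
  induction h with
  | enter => intro t ht; simp at ht
  | pass n n' l i h hn hl hmax hi hnn' _ hinj hsub _ ih =>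
    have hle := h.le
    have hg : ∀ l < 2 ^ J, grid J ∩ cell J l ⊆ designSet x n := fun l hl =>
      (inter_subset_inter_right _ (cell_subset_Ico hl)).trans
        (hgrid.trans (designSet_mono x hle))
    have hmono : ∀ l' < 2 ^ J, (2 : ℝ) ^ cellLevel J x n l' ≤ 2 ^ cellLevel J x n' l' := by
      intro l' hl'
      refine pow_le_pow_right₀ (by norm_num) (le_cellLevel ?_)
      exact (subset_of_le_cellLevel (hg l' hl') le_rfl).trans (designSet_mono x hnn'.le)
    intro t ht
    by_cases htn : t < n
    · obtain ⟨l₁, hl₁, i₁, hi₁, hx, hall⟩ := ih t ⟨ht.1, htn⟩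
      exact ⟨l₁, hl₁, i₁, hi₁, hx, fun l' hl' => (hall l' hl').trans
        (mul_le_mul_of_nonneg_left (hmono l' hl') (hp _))⟩
    · have hiJ : J < i := by
        by_contra hc
        obtain ⟨q, hq⟩ := hi.1
        exact hq.2 (hg l hl ⟨grid_mono (by omega) hq.1.1, hq.1.2⟩)
      -- As `i` is the least incomplete level, the finest complete one is `i - 1`, so the effective
      -- density of the chosen cell is `2^(i-1)/n`. Maximality of `p/q` then compares it with any
      -- other cell, whose level can only grow in later passes.
      have hcl : cellLevel J x n l ≤ i - 1 := by
        by_contra hc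
        obtain ⟨q, hq⟩ := hi.1
        exact hq.2 (subset_of_le_cellLevel (hg l hl) (by omega : i ≤ cellLevel J x n l) hq.1)
      have hcl' : i - 1 ≤ cellLevel J x n l := by
        apply le_cellLevel
        by_contra hc
        obtain ⟨q, hq1, hq2⟩ := not_subset.1 hc
        have := hi.2 (show i - 1 ∈ {i | (newPoints J x n l i).Nonempty} from ⟨q, hq1, hq2⟩)
        omega
      refine ⟨l, hl, i - 1, by omega, ?_, fun l' hl' => ?_⟩
      · rw [Nat.sub_add_cancel (by omega)]
        exact (hsub ⟨t, ⟨by omega, ht.2⟩, rfl⟩).1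
      · have h1 := hmax l' hl'
        rw [effectiveDensity, effectiveDensity] at h1
        change _ / ((n : ℝ)⁻¹ * 2 ^ cellLevel J x n l') ≤ _ / ((n : ℝ)⁻¹ * 2 ^ cellLevel J x n l) at h1
        have hn0 : (0 : ℝ) < n := by exact_mod_cast (by omega : 0 < n)
        rw [le_antisymm hcl hcl', div_le_div_iff₀ (by positivity) (by positivity)] at h1
        have h2 : p l' * 2 ^ (i - 1) ≤ p l * 2 ^ cellLevel J x n l' := by
          have h3 : (n : ℝ)⁻¹ * (p l' * 2 ^ (i - 1)) ≤ (n : ℝ)⁻¹ * (p l * 2 ^ cellLevel J x n l') := by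
            linarith
          exact le_of_mul_le_mul_left h3 (by positivity)
        exact h2.trans (mul_le_mul_of_nonneg_left (hmono l' hl') (hp _))

/-- Fix the cell `l₀`. By the invariant, every point the loop adds to cell `l` lies in a grid of
level `i + 1` with `2^i ≤ B l`, where `B l` is the resolution of `l₀` multiplied by `p l / p l₀`. So
cell `l` receives at most `2 * B l / 2^J` points; summing over the cells bounds the resolution at
`l₀` from below. -/
lemma LoopHead.count {J total start n : ℕ} {p x : ℕ → ℝ} (h : LoopHead J p total x start n)
    (hstart : 0 < start) (hgrid : grid J ∩ Ico 0 1 ⊆ designSet x start) (hp : ∀ l, 0 < p l)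
    (hinj : InjOn x (Iio n)) {l₀ : ℕ} (hl₀ : l₀ < 2 ^ J) :
    ((n - start : ℕ) : ℝ) * (p l₀ * 2 ^ J) ≤
      2 * 2 ^ cellLevel J x n l₀ * ∑ l ∈ Finset.range (2 ^ J), p l := by
  classical
  have hinv := h.invariant hstart hgrid (fun l => (hp l).le)
  set B : ℕ → ℝ := fun l => p l * 2 ^ cellLevel J x n l₀ / p l₀ with hB
  set S : ℕ → Finset ℕ := fun l => (Finset.Ico start n).filter
    (fun t => ∃ i ≥ J, x t ∈ grid (i + 1) ∩ cell J l ∧ (2 : ℝ) ^ i ≤ B l) with hS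
  have hcover : Finset.Ico start n ⊆ (Finset.range (2 ^ J)).biUnion S := by
    intro t ht
    obtain ⟨l, hl, i, hi, hx, hall⟩ := hinv t (by simpa using ht)
    refine Finset.mem_biUnion.2 ⟨l, Finset.mem_range.2 hl, Finset.mem_filter.2 ⟨ht, i, hi, hx, ?_⟩⟩
    rw [hB, le_div_iff₀ (hp l₀), mul_comm]
    exact hall l₀ hl₀
  have hcard : ∀ l, ((S l).card : ℝ) ≤ 2 * B l / 2 ^ J := by
    intro l
    have hB0 : 0 ≤ B l := div_nonneg (mul_nonneg (hp l).le (by positivity)) (hp l₀).le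
    rcases (S l).eq_empty_or_nonempty with he | ⟨t, ht⟩
    · rw [he]; simp; positivity
    obtain ⟨_, i, hi, _, hiB⟩ := Finset.mem_filter.1 ht
    -- All points counted in `S l` lie in one grid of level `m + 1`, where `2^m` is the largest
    -- power of two not exceeding `B l`.
    have hle : ∀ i : ℕ, (2 : ℝ) ^ i ≤ B l → i ≤ Nat.log 2 ⌊B l⌋₊ := by
      intro i hi
      apply Nat.le_log_of_pow_le (by norm_num)
      apply Nat.le_floor
      exact_mod_cast hi
    set m := Nat.log 2 ⌊B l⌋₊ with hm
    have hJm : J ≤ m := hi.trans (hle i hiB)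
    have h1 : (S l).card ≤ 2 ^ (m + 1 - J) := by
      refine card_le_of_mapsTo_grid_inter_cell (l := l) (by omega) (x := x) ?_ ?_
      · refine hinj.mono fun t ht => ?_
        have := (Finset.mem_filter.1 (Finset.mem_coe.1 ht)).1
        exact (Finset.mem_Ico.1 this).2
      · intro t ht
        obtain ⟨_, i, hi, hx, hiB⟩ := Finset.mem_filter.1 ht
        exact ⟨grid_mono (Nat.succ_le_succ (hle i hiB)) hx.1, hx.2⟩
    have h2 : (2 : ℝ) ^ m ≤ B l := by
      have hf : ⌊B l⌋₊ ≠ 0 := by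
        have : 1 ≤ B l := (one_le_pow₀ (by norm_num)).trans hiB
        exact (Nat.floor_pos.2 this).ne'
      have h3 := Nat.pow_log_le_self 2 hf
      calc (2 : ℝ) ^ m ≤ ⌊B l⌋₊ := by exact_mod_cast h3
        _ ≤ B l := Nat.floor_le hB0
    rw [le_div_iff₀ (by positivity)]
    calc ((S l).card : ℝ) * 2 ^ J ≤ 2 ^ (m + 1 - J) * 2 ^ J := by
          gcongr; exact_mod_cast h1
      _ = 2 * 2 ^ m := by rw [← pow_add, Nat.sub_add_cancel (by omega), pow_succ]; ring
      _ ≤ 2 * B l := by linarith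
  have h1 : ((n - start : ℕ) : ℝ) ≤ ∑ l ∈ Finset.range (2 ^ J), 2 * B l / 2 ^ J := by
    have h2 := (Finset.card_le_card hcover).trans Finset.card_biUnion_le
    rw [Nat.card_Ico] at h2
    calc ((n - start : ℕ) : ℝ) ≤ ((∑ l ∈ Finset.range (2 ^ J), (S l).card : ℕ) : ℝ) := by
          exact_mod_cast h2
      _ ≤ _ := by push_cast; exact Finset.sum_le_sum fun l _ => hcard l
  have h2 : ∑ l ∈ Finset.range (2 ^ J), 2 * B l / 2 ^ J =
      2 * 2 ^ cellLevel J x n l₀ * (∑ l ∈ Finset.range (2 ^ J), p l) / (p l₀ * 2 ^ J) := by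
    rw [Finset.mul_sum, Finset.sum_div]
    refine Finset.sum_congr rfl fun l _ => ?_
    have := (hp l₀).ne'
    simp only [hB]; field_simp
  rw [h2, le_div_iff₀ (mul_pos (hp l₀) (by positivity))] at h1
  exact h1

/-! ### The target density -/

lemma card_cells_le (hL : 1 ≤ L) (J j k : ℕ) (s : Finset ℕ)
    (hs : ∀ l ∈ s, cell J l ⊆ suppInterval L j k) : (s.card : ℝ) ≤ 2 * L * 2 ^ J / 2 ^ j := by
  have hL' : (1 : ℝ) ≤ L := by exact_mod_cast hL
  set a : ℝ := ((k : ℝ) - L + 1) / 2 ^ j * 2 ^ J with ha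
  set b : ℝ := ((k : ℝ) + L) / 2 ^ j * 2 ^ J with hb
  have hsub : s ⊆ Finset.Ico ⌈a⌉₊ ⌊b⌋₊ := by
    intro l hl
    have h1 := (hs l hl).trans inter_subset_left
    have hlt : (l : ℝ) / 2 ^ J < (l + 1) / 2 ^ J := by gcongr; linarith
    rw [cell, Ico_subset_Ico_iff hlt, le_div_iff₀ (by positivity), div_le_iff₀ (by positivity)] at h1
    rw [Finset.mem_Ico]
    refine ⟨Nat.ceil_le.2 h1.1, Nat.lt_of_succ_le (Nat.le_floor ?_)⟩
    push_cast; exact h1.2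
  have hc := Finset.card_le_card hsub
  rw [Nat.card_Ico] at hc
  have hb0 : 0 ≤ b := by positivity
  have h1 : ((⌊b⌋₊ - ⌈a⌉₊ : ℕ) : ℝ) ≤ 2 * L * 2 ^ J / 2 ^ j := by
    rcases le_total ⌈a⌉₊ ⌊b⌋₊ with h | h
    · rw [Nat.cast_sub h]
      have h2 := Nat.floor_le hb0
      have h3 := Nat.le_ceil a
      have h4 : b - a = (2 * L - 1) * (2 ^ J / 2 ^ j) := by rw [ha, hb]; ring
      have h5 : (0 : ℝ) < 2 ^ J / 2 ^ j := by positivity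
      have h6 : 2 * (L : ℝ) * 2 ^ J / 2 ^ j = 2 * L * (2 ^ J / 2 ^ j) := by ring
      nlinarith
    · rw [Nat.sub_eq_zero_of_le h]; simp; positivity
  exact (by exact_mod_cast hc : (s.card : ℝ) ≤ ((⌊b⌋₊ - ⌈a⌉₊ : ℕ) : ℝ)).trans h1

/-- The ranks run through `1, …, 2^j`, so this is a harmonic sum, at most `1 + j log 2`. It uses up
one of the two factors `j₁` in the denominator of the target density. -/
lemma sum_inv_ranking_le {j₁ j : ℕ} {b : ℕ → ℕ → ℝ} {r : ℕ → ℕ → ℕ} (hr : IsRanking j₀ j₁ b r)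
    (h0 : j₀ ≤ j) (h1 : j < j₁) : ∑ k ∈ Finset.range (2 ^ j), ((r j k : ℝ))⁻¹ ≤ j₁ := by
  have hb := (hr j h0 h1).1
  have e : ∑ k ∈ Finset.range (2 ^ j), ((r j k : ℝ))⁻¹ = ∑ q ∈ Finset.Icc 1 (2 ^ j : ℕ), ((q : ℕ) : ℝ)⁻¹ := by
    refine Finset.sum_bij (fun k _ => r j k) ?_ ?_ ?_ (fun _ _ => rfl)
    · intro k hk; simpa using hb.mapsTo (by simpa using hk : k ∈ Iio (2 ^ j))
    · intro k hk k' hk' h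
      exact hb.injOn (by simpa using hk : k ∈ Iio (2 ^ j)) (by simpa using hk' : k' ∈ Iio (2 ^ j)) h
    · intro q hq
      obtain ⟨k, hk, rfl⟩ := hb.surjOn (by simpa using hq : q ∈ Icc 1 (2 ^ j))
      exact ⟨k, by simpa using hk, rfl⟩
  rw [e]
  have h2 := harmonic_le_one_add_log (2 ^ j)
  rw [harmonic_eq_sum_Icc] at h2
  push_cast at h2
  refine h2.trans ?_
  rw [Real.log_pow]
  have h3 : (j : ℝ) + 1 ≤ j₁ := by exact_mod_cast h1
  have h4 := Real.log_two_lt_d9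
  have h5 : (0 : ℝ) ≤ j := by positivity
  nlinarith

/-- Replacing the supremum by a sum is affordable: at each level, the ranking sum and the
`O(2^(J-j))` cells per support give `2L * 2^J / j₁`, and there are at most `j₁` levels. -/
lemma targetDensity_bounds (hL : 1 ≤ L) {A lam : ℝ} (hA : 0 < A) (hlam : 0 < lam) (J : ℕ) {j₁ : ℕ}
    (hj₁ : 0 < j₁) {b : ℕ → ℕ → ℝ} {r : ℕ → ℕ → ℕ} (hr : IsRanking j₀ j₁ b r) :
    (∀ l, A * lam ≤ targetDensity L j₀ A lam J j₁ b r l) ∧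
    ∑ l ∈ Finset.range (2 ^ J), targetDensity L j₀ A lam J j₁ b r l ≤
      2 ^ J * (A * (lam + 2 * L)) := by
  classical
  have hj₁' : (0 : ℝ) < j₁ := by exact_mod_cast hj₁
  set U : ℕ → ℝ := fun l => lam + ∑ j ∈ Finset.Ico j₀ j₁, ∑ k ∈ Finset.range (2 ^ j),
    if cell J l ⊆ suppInterval L j k then 2 ^ j / ((r j k : ℝ) * (j₁ : ℝ) ^ 2) else 0 with hU
  have hbound : ∀ l, ∀ v ∈ ({lam} ∪ {v | ∃ j k, j₀ ≤ j ∧ j < j₁ ∧ k < 2 ^ j ∧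
      cell J l ⊆ suppInterval L j k ∧ b j k ≠ 0 ∧ v = 2 ^ j / ((r j k : ℝ) * (j₁ : ℝ) ^ 2)} : Set ℝ),
      v ≤ U l := by
    intro l v hv
    have hnn : ∀ j k, 0 ≤ (if cell J l ⊆ suppInterval L j k then
        2 ^ j / ((r j k : ℝ) * (j₁ : ℝ) ^ 2) else 0) := by
      intro j k; split_ifs <;> positivity
    rcases hv with hv | ⟨j, k, h0, h1, hk, hc, _, rfl⟩
    · rw [mem_singleton_iff.1 hv, hU]
      exact le_add_of_nonneg_right (Finset.sum_nonneg fun j _ => Finset.sum_nonneg fun k _ => hnn j k)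
    · have h2 := Finset.single_le_sum (f := fun k => if cell J l ⊆ suppInterval L j k then
        2 ^ j / ((r j k : ℝ) * (j₁ : ℝ) ^ 2) else 0) (fun k _ => hnn j k) (Finset.mem_range.2 hk)
      have h3 := Finset.single_le_sum (f := fun j => ∑ k ∈ Finset.range (2 ^ j),
        if cell J l ⊆ suppInterval L j k then 2 ^ j / ((r j k : ℝ) * (j₁ : ℝ) ^ 2) else 0)
        (fun j _ => Finset.sum_nonneg fun k _ => hnn j k) (Finset.mem_Ico.2 ⟨h0, h1⟩)
      simp only [if_pos hc] at h2
      exact (h2.trans h3).trans (le_add_of_nonneg_left hlam.le)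
  refine ⟨fun l => ?_, ?_⟩
  · refine mul_le_mul_of_nonneg_left ?_ hA.le
    exact le_csSup ⟨U l, fun v hv => hbound l v hv⟩ (Or.inl rfl)
  · have h1 : ∀ l, targetDensity L j₀ A lam J j₁ b r l ≤ A * U l := fun l =>
      mul_le_mul_of_nonneg_left (csSup_le ⟨lam, Or.inl rfl⟩ (hbound l)) hA.le
    refine (Finset.sum_le_sum fun l _ => h1 l).trans ?_
    rw [← Finset.mul_sum]
    have h2 : ∑ l ∈ Finset.range (2 ^ J), U l ≤ 2 ^ J * (lam + 2 * L) := by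
      simp only [hU]
      rw [Finset.sum_add_distrib, Finset.sum_const, Finset.card_range, nsmul_eq_mul, mul_add]
      push_cast
      gcongr
      rw [Finset.sum_comm]
      have h3 : ∀ j ∈ Finset.Ico j₀ j₁, ∑ l ∈ Finset.range (2 ^ J), ∑ k ∈ Finset.range (2 ^ j),
          (if cell J l ⊆ suppInterval L j k then (2 : ℝ) ^ j / ((r j k : ℝ) * (j₁ : ℝ) ^ 2) else 0) ≤
          2 * (L : ℝ) * 2 ^ J / j₁ := by
        intro j hj
        rw [Finset.mem_Ico] at hj
        rw [Finset.sum_comm]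
        calc _ ≤ ∑ k ∈ Finset.range (2 ^ j), 2 * (L : ℝ) * 2 ^ J / (j₁ : ℝ) ^ 2 * ((r j k : ℝ))⁻¹ := by
              refine Finset.sum_le_sum fun k _ => ?_
              rw [← Finset.sum_filter, Finset.sum_const, nsmul_eq_mul]
              have hc := card_cells_le hL J j k
                ((Finset.range (2 ^ J)).filter (fun l => cell J l ⊆ suppInterval L j k))
                (fun l hl => (Finset.mem_filter.1 hl).2)
              calc _ ≤ (2 * L * 2 ^ J / 2 ^ j) * (2 ^ j / ((r j k : ℝ) * (j₁ : ℝ) ^ 2)) :=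
                    mul_le_mul_of_nonneg_right hc (by positivity)
                _ = _ := by rw [div_mul_div_cancel₀ (by positivity), mul_comm (r j k : ℝ), ← div_div]; rfl
          _ ≤ 2 * L * 2 ^ J / (j₁ : ℝ) ^ 2 * j₁ := by
              rw [← Finset.mul_sum]
              exact mul_le_mul_of_nonneg_left (sum_inv_ranking_le hr hj.1 hj.2) (by positivity)
          _ = _ := by field_simp
      refine (Finset.sum_le_card_nsmul _ _ _ h3).trans ?_
      rw [Nat.card_Ico, nsmul_eq_mul]
      calc ((j₁ - j₀ : ℕ) : ℝ) * (2 * L * 2 ^ J / j₁) ≤ j₁ * (2 * L * 2 ^ J / j₁) := by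
            gcongr; exact Nat.sub_le _ _
        _ = _ := by field_simp
    calc _ ≤ A * (2 ^ J * (lam + 2 * L)) := mul_le_mul_of_nonneg_left h2 hA.le
      _ = _ := by ring

/-! ### Stages and levels -/

lemma Tuning.stage_pos (T : Tuning j₀) (m : ℕ) : 0 < T.stage m := by
  obtain ⟨a, b, ha, hab⟩ := T.stage_ratio
  induction m with
  | zero =>
    obtain ⟨i, hi⟩ := T.stage_zero
    rw [hi]; positivity
  | succ m ih =>
    have h1 : (0 : ℝ) < T.stage m := by exact_mod_cast ih
    have h2 : (0 : ℝ) < T.stage (m + 1) := by nlinarith [(hab m).1]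
    exact_mod_cast h2

lemma Tuning.stage_strictMono (T : Tuning j₀) : StrictMono T.stage := by
  obtain ⟨a, b, ha, hab⟩ := T.stage_ratio
  refine strictMono_nat_of_lt_succ fun m => ?_
  have h1 : (0 : ℝ) < T.stage m := by exact_mod_cast T.stage_pos m
  have h2 : (T.stage m : ℝ) < T.stage (m + 1) := by nlinarith [(hab m).1]
  exact_mod_cast h2

lemma Tuning.exists_jmax_bounds (T : Tuning j₀) : ∃ c C : ℝ, 0 < c ∧ 0 < C ∧
    ∀ᶠ n : ℕ in atTop, c * (n / Real.log n) ≤ 2 ^ T.jmax n ∧ 2 ^ T.jmax n ≤ C * (n / Real.log n) := by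
  obtain ⟨h1, h2⟩ := T.jmax_theta
  obtain ⟨C, hC0, hC⟩ := h1.exists_pos
  obtain ⟨c, hc0, hc⟩ := h2.exists_pos
  refine ⟨c⁻¹, C, inv_pos.2 hc0, hC0, ?_⟩
  filter_upwards [hC.bound, hc.bound, eventually_ge_atTop 3] with n h3 h4 hn
  have hn' : (1 : ℝ) < n := by exact_mod_cast (by omega : 1 < n)
  have hpos : 0 < (n : ℝ) / Real.log n := div_pos (by linarith) (Real.log_pos hn')
  have hpos2 : (0 : ℝ) < 2 ^ T.jmax n := by positivity
  rw [Real.norm_of_nonneg hpos.le, Real.norm_of_nonneg hpos2.le] at h3 h4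
  refine ⟨?_, h3⟩
  rwa [inv_mul_le_iff₀ hc0]

lemma tendsto_log_natCast : Tendsto (fun n : ℕ => Real.log n) atTop atTop :=
  Real.tendsto_log_atTop.comp tendsto_natCast_atTop_atTop

/-- As `2^jmax` is of order `n / log n`, the coarse grid that opens a stage takes a negligible share
of its points. -/
lemma Tuning.eventually_jmax_le (T : Tuning j₀) {η : ℝ} (hη : 0 < η) :
    ∀ᶠ n : ℕ in atTop, (2 : ℝ) ^ T.jmax n ≤ η * n := by
  obtain ⟨c, C, hc, hC, h⟩ := T.exists_jmax_bounds
  filter_upwards [h, tendsto_log_natCast.eventually_ge_atTop (C / η), eventually_ge_atTop 3]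
    with n h1 h2 hn
  have hn' : (1 : ℝ) < n := by exact_mod_cast (by omega : 1 < n)
  have hl := Real.log_pos hn'
  refine h1.2.trans ?_
  rw [div_le_iff₀ hη] at h2
  rw [← mul_div_assoc, div_le_iff₀ hl]
  nlinarith

/-! ### Designs chosen by the algorithm -/

lemma IsRun.prefix {W : WaveletBasis N L j₀} {T : Tuning j₀} {y x : ℕ → ℝ} (h : IsRun W T y x)
    (m : ℕ) : InjOn x (Iio (T.stage m)) ∧ ∀ t < T.stage m, x t ∈ dyadics := by
  induction m with
  | zero =>
    have hpos : (0 : ℝ) < T.stage 0 := by exact_mod_cast T.stage_pos 0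
    constructor
    · intro a ha b hb hab
      rw [h.1 a ha, h.1 b hb, div_left_inj' hpos.ne'] at hab
      exact_mod_cast hab
    · intro t ht
      obtain ⟨i, hi⟩ := T.stage_zero
      rw [h.1 t ht]
      refine ⟨⟨i, t, by rw [hi]; push_cast; rfl⟩, by positivity, ?_⟩
      rw [div_lt_one hpos]
      exact_mod_cast ht
  | succ m ih =>
    obtain ⟨r, _, n', h1, h2, hinj, himg, hloop⟩ := h.2 m
    refine hloop.injOn ?_ ?_
    · refine injOn_Iio_of_injOn_Ico ih.1 hinj fun t ht => ?_
      have : x t ∈ x '' Ico (T.stage m) n' := ⟨t, ht, rfl⟩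
      rw [himg] at this
      exact this.2
    · intro t ht
      by_cases htm : t < T.stage m
      · exact ih.2 t htm
      · have : x t ∈ x '' Ico (T.stage m) n' := ⟨t, ⟨by omega, ht⟩, rfl⟩
        rw [himg] at this
        exact ⟨⟨_, this.1.1⟩, this.1.2⟩

lemma IsRun.injective {W : WaveletBasis N L j₀} {T : Tuning j₀} {y x : ℕ → ℝ} (h : IsRun W T y x) :
    Function.Injective x := by
  intro a b hab
  have h1 := T.stage_strictMono.le_apply (x := max a b + 1)
  exact (h.prefix (max a b + 1)).1 (mem_Iio.2 (by omega)) (mem_Iio.2 (by omega)) hab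

lemma IsRun.mem_dyadics {W : WaveletBasis N L j₀} {T : Tuning j₀} {y x : ℕ → ℝ}
    (h : IsRun W T y x) (t : ℕ) : x t ∈ dyadics := by
  have h1 := T.stage_strictMono.le_apply (x := t + 1)
  exact (h.prefix (t + 1)).2 t (by omega)

/-- At the end of each stage, the design contains a grid of mesh width of the order of the reciprocal
of the number of points. -/
lemma exists_grid_subset_stage (W : WaveletBasis N L j₀) (T : Tuning j₀) :
    ∃ c : ℝ, 0 < c ∧ ∃ m₀ : ℕ, ∀ y x, IsRun W T y x → ∀ m ≥ m₀, ∀ i : ℕ,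
      (2 : ℝ) ^ i ≤ c * T.stage (m + 1) → grid i ∩ Ico 0 1 ⊆ designSet x (T.stage (m + 1)) := by
  obtain ⟨a, b, ha, hab⟩ := T.stage_ratio
  -- A stage has at least `2η` times its final number of points to place; its coarse grid takes at
  -- most half of these, so the loop places at least the fraction `η`.
  set η : ℝ := (1 - a⁻¹) / 2 with hη
  have hη0 : 0 < η := by
    have : a⁻¹ < 1 := inv_lt_one_of_one_lt₀ ha
    rw [hη]; linarith
  have hlam := T.lam_pos
  have hL : (0 : ℝ) ≤ L := by positivity
  have hev : ∀ᶠ m : ℕ in atTop, (2 : ℝ) ^ T.jmax (T.stage (m + 1)) ≤ η * T.stage (m + 1) :=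
    ((tendsto_add_atTop_nat 1).eventually
      (T.stage_strictMono.tendsto_atTop.eventually (T.eventually_jmax_le hη0)))
  obtain ⟨m₀, hm₀⟩ := eventually_atTop.1 hev
  refine ⟨η * T.lam / (2 * (T.lam + 2 * L)), by positivity, m₀, fun y x hrun m hm i hi => ?_⟩
  obtain ⟨r, hr, n', h1, h2, hinj, himg, hloop⟩ := hrun.2 m
  set S := T.stage (m + 1) with hS
  set J := T.jmax S with hJ
  have hSpos : (0 : ℝ) < S := by exact_mod_cast T.stage_pos (m + 1)
  have hgrid : grid J ∩ Ico 0 1 ⊆ designSet x n' := by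
    intro p hp
    by_cases hpd : p ∈ designSet x (T.stage m)
    · exact designSet_mono x h1 hpd
    · have : p ∈ x '' Ico (T.stage m) n' := by rw [himg]; exact ⟨hp, hpd⟩
      obtain ⟨t, ht, rfl⟩ := this
      exact ⟨t, ht.2, rfl⟩
  have hstart : 0 < n' := lt_of_lt_of_le (T.stage_pos m) h1
  obtain ⟨hp1, hp2⟩ := targetDensity_bounds W.one_le_L T.A_pos T.lam_pos J
    (lt_of_le_of_lt (Nat.zero_le _) (T.lt_jmax (T.stage m))) hr
  have hA := T.A_pos
  have hppos : ∀ l, 0 < targetDensity L j₀ T.A T.lam J (T.jmax (T.stage m))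
      (betaThr W T x y (T.stage m)) r l := fun l => (mul_pos hA hlam).trans_le (hp1 l)
  have hn' : (n' : ℝ) ≤ T.stage m + 2 ^ J := by
    have hc : (Finset.Ico (T.stage m) n').card ≤ 2 ^ J := by
      refine card_le_of_mapsTo_grid (x := x) (by simpa using hinj) fun t ht => ?_
      have : x t ∈ x '' Ico (T.stage m) n' := ⟨t, by simpa using ht, rfl⟩
      rw [himg] at this
      exact this.1
    rw [Nat.card_Ico] at hc
    have : n' ≤ T.stage m + 2 ^ J := by omega
    exact_mod_cast this
  have hJS : (2 : ℝ) ^ J ≤ η * S := hm₀ m hm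
  have hloopn : η * S ≤ ((S - n' : ℕ) : ℝ) := by
    rw [Nat.cast_sub h2]
    have h3 : (T.stage m : ℝ) ≤ a⁻¹ * S := by
      rw [← div_eq_inv_mul, le_div_iff₀ (by linarith), mul_comm]
      exact (hab m).1
    have h4 : a⁻¹ = 1 - 2 * η := by rw [hη]; ring
    rw [h4] at h3
    linarith
  rintro q ⟨hq1, hq2⟩
  obtain ⟨l₀, hl₀, hql⟩ := exists_mem_cell hq2 J
  have hcount := hloop.count hstart hgrid hppos (hrun.prefix (m + 1)).1 hl₀
  have hgJ : grid J ∩ cell J l₀ ⊆ designSet x S :=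
    (inter_subset_inter_right _ (cell_subset_Ico hl₀)).trans
      (hgrid.trans (designSet_mono x h2))
  refine subset_of_le_cellLevel hgJ ?_ ⟨hq1, hql⟩
  set lev := cellLevel J x S l₀ with hlev
  -- Only the floor `A * lam` at `l₀` and the total mass of the target density enter; `A` and `2^J`
  -- cancel.
  have hmain : η * S * (T.A * T.lam * 2 ^ J) ≤
      2 * 2 ^ lev * (2 ^ J * (T.A * (T.lam + 2 * L))) := by
    calc _ ≤ ((S - n' : ℕ) : ℝ) * (targetDensity L j₀ T.A T.lam J (T.jmax (T.stage m))
          (betaThr W T x y (T.stage m)) r l₀ * 2 ^ J) :=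
          mul_le_mul hloopn (mul_le_mul_of_nonneg_right (hp1 l₀) (by positivity)) (by positivity)
            (by positivity)
      _ ≤ _ := hcount
      _ ≤ _ := mul_le_mul_of_nonneg_left hp2 (by positivity)
  have h5 : η * T.lam * S ≤ 2 ^ lev * (2 * (T.lam + 2 * L)) := by
    have hpos : (0 : ℝ) < T.A * 2 ^ J := by positivity
    refine le_of_mul_le_mul_left ?_ hpos
    calc T.A * 2 ^ J * (η * T.lam * S) = η * S * (T.A * T.lam * 2 ^ J) := by ring
      _ ≤ _ := hmain
      _ = _ := by ring
  have h6 : (2 : ℝ) ^ i ≤ 2 ^ lev := by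
    refine hi.trans ?_
    rw [div_mul_eq_mul_div, div_le_iff₀ (by positivity)]
    exact h5
  exact (pow_le_pow_iff_right₀ (by norm_num)).1 h6

lemma exists_grid_subset (W : WaveletBasis N L j₀) (T : Tuning j₀) :
    ∃ c : ℝ, 0 < c ∧ ∃ n₀ : ℕ, ∀ y x, IsRun W T y x → ∀ n ≥ n₀, ∀ i : ℕ,
      (2 : ℝ) ^ i ≤ c * n → grid i ∩ Ico 0 1 ⊆ designSet x n := by
  obtain ⟨c, hc, m₀, h⟩ := exists_grid_subset_stage W T
  obtain ⟨a, b, ha, hab⟩ := T.stage_ratio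
  have hb : 0 < b := by
    have h1 : (0 : ℝ) < T.stage 1 := by exact_mod_cast T.stage_pos 1
    have h2 : (0 : ℝ) < T.stage 0 := by exact_mod_cast T.stage_pos 0
    have := h1.trans_le (hab 0).2
    exact pos_of_mul_pos_left this h2.le
  refine ⟨c / b, by positivity, T.stage (m₀ + 1), fun y x hrun n hn i hi => ?_⟩
  classical
  -- The last completed stage has at least `n / b` points, so its grid is already fine enough during
  -- the next stage.
  set m := Nat.findGreatest (fun m => T.stage m ≤ n) n with hm
  have h1 : m₀ + 1 ≤ m :=
    Nat.le_findGreatest (T.stage_strictMono.le_apply.trans hn) hn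
  have h2 : T.stage m ≤ n :=
    Nat.findGreatest_spec (P := fun m => T.stage m ≤ n) (T.stage_strictMono.le_apply.trans hn) hn
  have h3 : n < T.stage (m + 1) := by
    by_contra hcon
    push Not at hcon
    have := Nat.le_findGreatest (P := fun m => T.stage m ≤ n)
      (T.stage_strictMono.le_apply.trans hcon) hcon
    omega
  obtain ⟨m', hm'⟩ : ∃ m', m = m' + 1 := ⟨m - 1, by omega⟩
  rw [hm'] at h2 h3
  refine (h y x hrun m' (by omega) i ?_).trans (designSet_mono x h2)
  refine hi.trans ?_
  have h4 : (n : ℝ) ≤ b * T.stage (m' + 1) := by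
    refine le_trans ?_ (hab (m' + 1)).2
    exact_mod_cast h3.le
  calc c / b * n ≤ c / b * (b * T.stage (m' + 1)) := by gcongr
    _ = _ := by field_simp

/-! ### Sums of Gaussian variables with predictable weights -/

/-- A function of sequences which only depends on the first `n` terms. -/
def DependsOnFirst {α : Type*} (n : ℕ) (g : (ℕ → ℝ) → α) : Prop :=
  ∀ e e' : ℕ → ℝ, (∀ i < n, e i = e' i) → g e = g e'

lemma DependsOnFirst.mono {α : Type*} {n n' : ℕ} {g : (ℕ → ℝ) → α} (h : DependsOnFirst n g)
    (hn : n ≤ n') : DependsOnFirst n' g := fun e e' he => h e e' fun i hi => he i (by omega)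

/-- The law of i.i.d. centred Gaussian variables. -/
noncomputable abbrev gaussianNoise (v : ℝ≥0) : Measure (ℕ → ℝ) :=
  Measure.infinitePi (fun _ : ℕ => gaussianReal 0 v)

/-- The sequence with the terms from the `n`-th on replaced by `0`. -/
def truncate (n : ℕ) (e : ℕ → ℝ) (i : ℕ) : ℝ := if i < n then e i else 0

lemma measurable_truncate (n : ℕ) : Measurable (truncate n) := by
  refine measurable_pi_iff.2 fun i => ?_
  by_cases h : i < n
  · simpa [truncate, h] using measurable_pi_apply i
  · simp [truncate, h]

lemma DependsOnFirst.truncate_eq {α : Type*} {n : ℕ} {g : (ℕ → ℝ) → α} (h : DependsOnFirst n g)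
    (e : ℕ → ℝ) : g (truncate n e) = g e := h _ _ fun i hi => by simp [truncate, hi]

/-- Zero-padding keeps the past inside the sequence space, so functions of the first `n` terms can
be evaluated on it directly in the Fubini argument. -/
lemma indepFun_truncate (v : ℝ≥0) (n : ℕ) :
    IndepFun (truncate n) (fun e : ℕ → ℝ => e n) (gaussianNoise v) := by
  have h0 : iIndepFun (fun (i : ℕ) (e : ℕ → ℝ) => e i) (gaussianNoise v) :=
    iIndepFun_infinitePi (P := fun _ : ℕ => gaussianReal 0 v) (X := fun _ x => x)
      (fun _ => measurable_id)
  have h1 := h0.indepFun_finset (Finset.range n) {n} (by simp) (fun i => measurable_pi_apply i)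
  have hm : Measurable (fun (z : Finset.range n → ℝ) (i : ℕ) =>
      if h : i ∈ Finset.range n then z ⟨i, h⟩ else 0) := by
    refine measurable_pi_iff.2 fun i => ?_
    by_cases h : i ∈ Finset.range n
    · simpa [h] using measurable_pi_apply _
    · simp [h]
  have h2 := h1.comp hm
    (ψ := fun z : ({n} : Finset ℕ) → ℝ => z ⟨n, by simp⟩)
    (measurable_pi_apply (X := fun _ : ({n} : Finset ℕ) => ℝ) _)
  convert h2 using 1
  · ext e i
    simp [truncate]
  · rfl

lemma lintegral_exp_gaussian (v : ℝ≥0) (a : ℝ) :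
    ∫⁻ u, ENNReal.ofReal (Real.exp (a * u - v * a ^ 2 / 2)) ∂(gaussianReal 0 v) = 1 := by
  have h1 : ∀ u : ℝ, Real.exp (a * u - v * a ^ 2 / 2) =
      Real.exp (-(v * a ^ 2 / 2)) * Real.exp (a * u) := by
    intro u; rw [← Real.exp_add]; congr 1; ring
  simp_rw [h1]
  rw [← ofReal_integral_eq_lintegral_ofReal ((integrable_exp_mul_gaussianReal a).const_mul _)
    (ae_of_all _ fun _ => by positivity), integral_const_mul]
  have h2 := mgf_gaussianReal (p := gaussianReal 0 v) (X := id) (μ := 0) (v := v) (by simp) a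
  simp only [mgf, id] at h2
  rw [h2, ← Real.exp_add]
  simp

/-- The exponential martingale. The weight at time `n` and the earlier factors are functions of the
first `n` terms, so the `n`-th noise term can be integrated out by independence, contributing a
Gaussian integral equal to `1`. Lower integrals make integrability unnecessary. -/
lemma lintegral_exp_sum_eq_one {v : ℝ≥0} {c : ℕ → (ℕ → ℝ) → ℝ} (hc : ∀ t, Measurable (c t))
    (hdep : ∀ t, DependsOnFirst t (c t)) (lam : ℝ) (n : ℕ) :
    ∫⁻ e, ENNReal.ofReal (Real.exp (∑ t ∈ Finset.range n,
      (lam * c t e * e t - v * (lam * c t e) ^ 2 / 2))) ∂(gaussianNoise v) = 1 := by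
  induction n with
  | zero => simp
  | succ n ih =>
    set F : (ℕ → ℝ) → ℝ≥0∞ := fun e => ENNReal.ofReal (Real.exp (∑ t ∈ Finset.range n,
      (lam * c t e * e t - v * (lam * c t e) ^ 2 / 2))) with hF
    set G : (ℕ → ℝ) × ℝ → ℝ≥0∞ := fun p => F p.1 *
      ENNReal.ofReal (Real.exp (lam * c n p.1 * p.2 - v * (lam * c n p.1) ^ 2 / 2)) with hG
    have hFm : Measurable F := by
      refine ENNReal.measurable_ofReal.comp (Real.measurable_exp.comp ?_)
      refine Finset.measurable_sum _ fun t _ => ?_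
      have := hc t
      fun_prop
    have hGm : Measurable G := by
      have := hc n
      fun_prop
    have hFdep : DependsOnFirst n F := by
      intro e e' he
      simp only [hF]
      congr 2
      refine Finset.sum_congr rfl fun t ht => ?_
      have ht := Finset.mem_range.1 ht
      rw [(hdep t).mono ht.le e e' he, he t ht]
    have h1 : ∀ e : ℕ → ℝ, ENNReal.ofReal (Real.exp (∑ t ∈ Finset.range (n + 1),
        (lam * c t e * e t - v * (lam * c t e) ^ 2 / 2))) = G (truncate n e, e n) := by
      intro e
      simp only [hG]
      rw [hFdep.truncate_eq, (hdep n).truncate_eq, Finset.sum_range_succ, Real.exp_add,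
        ENNReal.ofReal_mul (Real.exp_pos _).le]
    simp_rw [h1]
    have hm1 := measurable_truncate n
    have hm2 : Measurable (fun e : ℕ → ℝ => e n) := measurable_pi_apply n
    have hprod := (indepFun_iff_map_prod_eq_prod_map_map hm1.aemeasurable hm2.aemeasurable).1
      (indepFun_truncate v n)
    have hmap : (gaussianNoise v).map (fun e : ℕ → ℝ => e n) = gaussianReal 0 v :=
      Measure.infinitePi_map_eval (fun _ : ℕ => gaussianReal 0 v) n
    rw [← lintegral_map (f := G) (g := fun e : ℕ → ℝ => (truncate n e, e n)) hGm
      (hm1.prodMk hm2), hprod, hmap, lintegral_prod _ hGm.aemeasurable]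
    simp only [hG]
    have h2 : ∀ z : ℕ → ℝ, ∫⁻ u, F z * ENNReal.ofReal (Real.exp (lam * c n z * u -
        v * (lam * c n z) ^ 2 / 2)) ∂(gaussianReal 0 v) = F z := by
      intro z
      rw [lintegral_const_mul _ (by fun_prop), lintegral_exp_gaussian, mul_one]
    simp_rw [h2]
    rw [lintegral_map hFm hm1]
    simp_rw [hFdep.truncate_eq]
    exact ih

/-- A Gaussian tail bound for sums with predictable weights. -/
lemma measure_abs_sum_ge_le {v : ℝ≥0} (hv : 0 < v) {c : ℕ → (ℕ → ℝ) → ℝ}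
    (hc : ∀ t, Measurable (c t)) (hdep : ∀ t, DependsOnFirst t (c t)) {n : ℕ} {V : ℝ} (hV : 0 < V)
    (hcV : ∀ e, ∑ t ∈ Finset.range n, c t e ^ 2 ≤ V) {a : ℝ} (ha : 0 < a) :
    gaussianNoise v {e | a ≤ |∑ t ∈ Finset.range n, c t e * e t|} ≤
      ENNReal.ofReal (2 * Real.exp (-a ^ 2 / (2 * v * V))) := by
  have hv' : (0 : ℝ) < v := by exact_mod_cast hv
  have one_sided : ∀ lam : ℝ, gaussianNoise v {e | v * V * lam ^ 2 ≤
      lam * ∑ t ∈ Finset.range n, c t e * e t} ≤ ENNReal.ofReal (Real.exp (-(v * V * lam ^ 2 / 2))) := by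
    intro lam
    set F : (ℕ → ℝ) → ℝ≥0∞ := fun e => ENNReal.ofReal (Real.exp (∑ t ∈ Finset.range n,
      (lam * c t e * e t - v * (lam * c t e) ^ 2 / 2))) with hF
    have hFm : Measurable F := by
      refine ENNReal.measurable_ofReal.comp (Real.measurable_exp.comp ?_)
      refine Finset.measurable_sum _ fun t _ => ?_
      have := hc t
      fun_prop
    have h1 : {e | v * V * lam ^ 2 ≤ lam * ∑ t ∈ Finset.range n, c t e * e t} ⊆
        {e | ENNReal.ofReal (Real.exp (v * V * lam ^ 2 / 2)) ≤ F e} := by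
      intro e he
      rw [mem_ofPred_eq] at he ⊢
      apply ENNReal.ofReal_le_ofReal
      apply Real.exp_le_exp.2
      have h2 : ∑ t ∈ Finset.range n, (lam * c t e * e t - v * (lam * c t e) ^ 2 / 2) =
          lam * (∑ t ∈ Finset.range n, c t e * e t) -
            v * lam ^ 2 / 2 * ∑ t ∈ Finset.range n, c t e ^ 2 := by
        rw [Finset.sum_sub_distrib, Finset.mul_sum, Finset.mul_sum]
        congr 1 <;> exact Finset.sum_congr rfl fun t _ => by ring
      rw [h2]
      have h3 : v * lam ^ 2 / 2 * ∑ t ∈ Finset.range n, c t e ^ 2 ≤ v * lam ^ 2 / 2 * V :=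
        mul_le_mul_of_nonneg_left (hcV e) (by positivity)
      linarith
    refine (measure_mono h1).trans ((meas_ge_le_lintegral_div hFm.aemeasurable
      (by simp [Real.exp_pos]) ENNReal.ofReal_ne_top).trans ?_)
    rw [lintegral_exp_sum_eq_one hc hdep, one_div, ← ENNReal.ofReal_inv_of_pos (Real.exp_pos _),
      ← Real.exp_neg]
  -- The optimal parameter in the Chernoff bound; its negative treats the lower tail.
  set lam := a / (v * V) with hlam
  have hlam0 : 0 < lam := by positivity
  have e1 : v * V * lam ^ 2 = lam * a := by rw [hlam]; field_simp
  have e2 : v * V * lam ^ 2 / 2 = a ^ 2 / (2 * v * V) := by rw [hlam]; field_simp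
  have hsub : {e : ℕ → ℝ | a ≤ |∑ t ∈ Finset.range n, c t e * e t|} ⊆
      {e | v * V * lam ^ 2 ≤ lam * ∑ t ∈ Finset.range n, c t e * e t} ∪
      {e | v * V * (-lam) ^ 2 ≤ (-lam) * ∑ t ∈ Finset.range n, c t e * e t} := by
    intro e he
    rw [mem_ofPred_eq, le_abs] at he
    rcases he with he | he
    · left
      rw [mem_ofPred_eq, e1]
      exact mul_le_mul_of_nonneg_left he hlam0.le
    · right
      rw [mem_ofPred_eq, neg_sq, e1, neg_mul, ← mul_neg]
      exact mul_le_mul_of_nonneg_left he hlam0.le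
  refine (measure_mono hsub).trans ((measure_union_le _ _).trans
    ((add_le_add (one_sided lam) (one_sided (-lam))).trans ?_))
  rw [neg_sq, e2, ← ENNReal.ofReal_add (Real.exp_pos _).le (Real.exp_pos _).le, ← two_mul, neg_div]

/-! ### The design as a function of the noise -/

/-- The design points when the regression function is `f` and the noise is `e`. -/
noncomputable def design (point : (n : ℕ) → (Fin n → ℝ) → ℝ) (f : ℝ → ℝ) (e : ℕ → ℝ) (t : ℕ) : ℝ :=
  point t (fun i => observations point f e i)

lemma observations_eq (point : (n : ℕ) → (Fin n → ℝ) → ℝ) (f : ℝ → ℝ) (e : ℕ → ℝ) (t : ℕ) :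
    observations point f e t = f (design point f e t) + e t := by
  rw [observations, design]

lemma dependsOnFirst_observations (point : (n : ℕ) → (Fin n → ℝ) → ℝ) (f : ℝ → ℝ) (t : ℕ) :
    DependsOnFirst (t + 1) (fun e => observations point f e t) := by
  induction t using Nat.strong_induction_on with
  | _ t ih =>
    intro e e' he
    have h : (fun i : Fin t => observations point f e i) = fun i : Fin t => observations point f e' i :=
      funext fun i => (ih i i.2).mono (by omega) e e' he
    beta_reduce
    rw [observations_eq point f e t, observations_eq point f e' t, he t (by omega), design, design, h]

lemma dependsOnFirst_design (point : (n : ℕ) → (Fin n → ℝ) → ℝ) (f : ℝ → ℝ) (t : ℕ) :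
    DependsOnFirst t (fun e => design point f e t) := by
  intro e e' he
  simp only [design]
  congr 1
  ext i
  exact (dependsOnFirst_observations point f i).mono (by omega) e e' he

lemma isRun_design {W : WaveletBasis N L j₀} {T : Tuning j₀} (D : Implementation W T)
    (f : ℝ → ℝ) (e : ℕ → ℝ) : IsRun W T (observations D.point f e) (design D.point f e) :=
  D.isRun _

/-- Measurability of `f` on all of `ℝ` is not needed: the design consists of dyadic numbers, so the
observations see only the restriction of `f` to a countable set. -/
lemma measurable_indicator_of_countable {s : Set ℝ} (hs : s.Countable) (f : ℝ → ℝ) :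
    Measurable (s.indicator f) := by
  refine measurable_const.measurable_of_countable_ne (f := fun _ => (0 : ℝ)) ?_
  refine hs.mono fun x hx => ?_
  by_contra h
  exact hx (by simp [h])

lemma measurable_observations {W : WaveletBasis N L j₀} {T : Tuning j₀} (D : Implementation W T)
    (f : ℝ → ℝ) (t : ℕ) : Measurable (fun e => observations D.point f e t) := by
  induction t using Nat.strong_induction_on with
  | _ t ih =>
    have h1 : (fun e => observations D.point f e t) = fun e =>
        dyadics.indicator f (D.point t (fun i => observations D.point f e i)) + e t := by
      ext e
      rw [observations_eq]
      have := (isRun_design D f e).mem_dyadics t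
      rw [design] at this ⊢
      rw [indicator_of_mem this]
    rw [h1]
    refine Measurable.add ?_ (measurable_pi_apply t)
    refine (measurable_indicator_of_countable countable_dyadics f).comp
      ((D.measurable_point t).comp ?_)
    exact measurable_pi_iff.2 fun i => ih i i.2

lemma measurable_design {W : WaveletBasis N L j₀} {T : Tuning j₀} (D : Implementation W T)
    (f : ℝ → ℝ) (t : ℕ) : Measurable (fun e => design D.point f e t) :=
  (D.measurable_point t).comp (measurable_pi_iff.2 fun i => measurable_observations D f i)

/-! ### Stochastic errors of the grid estimates -/

open Classical in
/-- The weight of the noise at the point `p` in the grid estimate of level `i` of the coefficient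
of `b`. -/
noncomputable def weight (W : WaveletBasis N L j₀) (i : ℕ) (b : ℝ → ℝ) (p : ℝ) : ℝ :=
  ∑ l ∈ Finset.range (2 ^ i), if p = (l : ℝ) / 2 ^ i then (scale i)⁻¹ * ip (W.φ i l) b else 0

lemma measurable_weight (W : WaveletBasis N L j₀) (i : ℕ) (b : ℝ → ℝ) :
    Measurable (weight W i b) :=
  Finset.measurable_sum _ fun _ _ =>
    Measurable.ite (measurableSet_singleton _) measurable_const measurable_const

/-- The stochastic error of the grid estimate of level `i` of the coefficient of `b`. -/
noncomputable def stochasticError (W : WaveletBasis N L j₀) (x e : ℕ → ℝ) (n i : ℕ) (b : ℝ → ℝ) : ℝ :=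
  ∑ t ∈ Finset.range n, weight W i b (x t) * e t

lemma weight_eq_zero (W : WaveletBasis N L j₀) (i : ℕ) (b : ℝ → ℝ) {p : ℝ}
    (hp : ∀ l : ℕ, l < 2 ^ i → p ≠ (l : ℝ) / 2 ^ i) : weight W i b p = 0 :=
  Finset.sum_eq_zero fun l hl => if_neg (hp l (Finset.mem_range.1 hl))

lemma weight_eq (W : WaveletBasis N L j₀) (i : ℕ) (b : ℝ → ℝ) {l : ℕ} (hl : l < 2 ^ i) :
    weight W i b ((l : ℝ) / 2 ^ i) = (scale i)⁻¹ * ip (W.φ i l) b := by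
  rw [weight, Finset.sum_eq_single_of_mem l (Finset.mem_range.2 hl), if_pos rfl]
  intro m _ hm
  rw [if_neg]
  rw [div_left_inj' (by positivity)]
  exact fun h => hm (Nat.cast_injective h).symm

/-- Design points are distinct, so each grid point is counted at most once, whatever design was
chosen; over the whole grid the weights give `2^{-i}` times the Parseval sum. -/
lemma sum_weight_sq_le {W : WaveletBasis N L j₀} {j k i : ℕ} {b : ℝ → ℝ} (hb : IsAtom W j k b)
    (hi : j < i) {x : ℕ → ℝ} (hx : Function.Injective x) (n : ℕ) :
    ∑ t ∈ Finset.range n, weight W i b (x t) ^ 2 ≤ (2 ^ i)⁻¹ := by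
  classical
  have hs := scale_pos i
  set F : Finset ℝ := (Finset.range (2 ^ i)).image (fun l : ℕ => (l : ℝ) / 2 ^ i) with hF
  have h1 : ∑ t ∈ Finset.range n, weight W i b (x t) ^ 2 =
      ∑ p ∈ (Finset.range n).image x, weight W i b p ^ 2 := by
    rw [Finset.sum_image (fun a _ b _ h => hx h)]
  have hinj : InjOn (fun l : ℕ => (l : ℝ) / 2 ^ i) (Finset.range (2 ^ i)) := by
    intro a _ b _ hab
    simp only [div_left_inj' (show (2 : ℝ) ^ i ≠ 0 by positivity)] at hab
    exact Nat.cast_injective hab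
  have h2 : ∑ p ∈ (Finset.range n).image x, weight W i b p ^ 2 ≤ ∑ p ∈ F, weight W i b p ^ 2 := by
    rw [← Finset.sum_filter_ne_zero]
    refine Finset.sum_le_sum_of_subset_of_nonneg (fun p hp => ?_) (fun _ _ _ => sq_nonneg _)
    by_contra hpF
    apply (Finset.mem_filter.1 hp).2
    rw [weight_eq_zero, zero_pow two_ne_zero]
    rintro l hl rfl
    exact hpF (Finset.mem_image.2 ⟨l, Finset.mem_range.2 hl, rfl⟩)
  have h3 : ∑ p ∈ F, weight W i b p ^ 2 = (2 ^ i)⁻¹ := by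
    rw [hF, Finset.sum_image hinj]
    have : ∀ l ∈ Finset.range (2 ^ i), weight W i b ((l : ℝ) / 2 ^ i) ^ 2 =
        (2 ^ i)⁻¹ * ip (W.φ i l) b ^ 2 := by
      intro l hl
      rw [weight_eq W i b (Finset.mem_range.1 hl), mul_pow, ← scale_mul_self, inv_pow, sq (scale i)]
    rw [Finset.sum_congr rfl this, ← Finset.mul_sum, hb.sum_sq hi, mul_one]
  rw [h1, ← h3]
  exact h2

lemma sum_ite_eq_of_mem_designSet {x : ℕ → ℝ} (hx : Function.Injective x) {n : ℕ} {p : ℝ}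
    (hp : p ∈ designSet x n) (g : ℕ → ℝ) (a : ℝ) :
    ∑ t ∈ Finset.range n, (if x t = p then a + g t else 0) =
      a + ∑ t ∈ Finset.range n, (if x t = p then g t else 0) := by
  obtain ⟨t, ht, rfl⟩ := hp
  have ht : t ∈ Finset.range n := by simpa using ht
  simp only [hx.eq_iff]
  rw [Finset.sum_ite_eq_of_mem' _ _ _ ht, Finset.sum_ite_eq_of_mem' _ _ _ ht]

/-- The grid estimate as the sum of its mean value and its stochastic error. -/
lemma gridCoeff_eq {W : WaveletBasis N L j₀} {j k i n : ℕ} {b : ℝ → ℝ} (hb : IsAtom W j k b)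
    {x y e : ℕ → ℝ} {f : ℝ → ℝ} (hx : Function.Injective x) (hy : ∀ t, y t = f (x t) + e t)
    (hi : i ∈ levels L x n j k) :
    gridCoeff W x y n i b =
      ∑ l ∈ Finset.range (2 ^ i), (scale i)⁻¹ * f (l / 2 ^ i) * ip (W.φ i l) b +
        stochasticError W x e n i b := by
  classical
  have h1 : stochasticError W x e n i b = ∑ l ∈ Finset.range (2 ^ i),
      (scale i)⁻¹ * (∑ t ∈ Finset.range n, if x t = (l : ℝ) / 2 ^ i then e t else 0) *
        ip (W.φ i l) b := by
    simp only [stochasticError, weight, Finset.sum_mul, Finset.mul_sum]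
    rw [Finset.sum_comm]
    refine Finset.sum_congr rfl fun l _ => Finset.sum_congr rfl fun t _ => ?_
    split_ifs <;> ring
  rw [h1, ← Finset.sum_add_distrib, gridCoeff]
  refine Finset.sum_congr rfl fun l hl => ?_
  have hl := Finset.mem_range.1 hl
  by_cases hs : suppInterval L i l ⊆ suppInterval L j k
  · have hp : (l : ℝ) / 2 ^ i ∈ designSet x n :=
      hi.2 ⟨hs (cell_left_mem_suppInterval W.one_le_L hl), l, by simp⟩
    have h2 : obsAt x y n ((l : ℝ) / 2 ^ i) = f (l / 2 ^ i) +
        ∑ t ∈ Finset.range n, if x t = (l : ℝ) / 2 ^ i then e t else 0 := by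
      rw [← sum_ite_eq_of_mem_designSet hx hp, obsAt]
      refine Finset.sum_congr rfl fun t _ => ?_
      by_cases h : x t = (l : ℝ) / 2 ^ i
      · rw [if_pos h, if_pos h, hy, h]
      · rw [if_neg h, if_neg h]
    rw [h2]; ring
  -- Outside `S_{j,k}` the coefficient vanishes, so the value `0` of `obsAt` at an unobserved point
  -- does no harm.
  · rw [(hb.refines.expansion hi.1 (hb.le.trans hi.1.le)).1 l hl hs]
    ring

/-! ### The exceptional event -/

/-- The noise sequences for which a given grid estimate has a large stochastic error. -/
def largeError {W : WaveletBasis N L j₀} {T : Tuning j₀} (D : Implementation W T) (f : ℝ → ℝ)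
    (κ' : ℝ) (n j i : ℕ) (b : ℝ → ℝ) : Set (ℕ → ℝ) :=
  {e | j < i ∧ κ' * (T.σ * (scale i)⁻¹ * √(2 * Real.log n)) ≤
    |stochasticError W (design D.point f e) e n i b|}

/-- With squared weights at most `2^{-i}`, the Gaussian exponent for this deviation is `κ'^2 log n`,
at every grid level. -/
lemma measure_largeError_le {W : WaveletBasis N L j₀} {T : Tuning j₀} (D : Implementation W T)
    (f : ℝ → ℝ) {κ' : ℝ} (hκ' : 0 < κ') {n : ℕ} (hn : 2 ≤ n) {j k i : ℕ} {b : ℝ → ℝ}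
    (hb : IsAtom W j k b) : gaussianNoise (T.σ ^ 2).toNNReal (largeError D f κ' n j i b) ≤
      ENNReal.ofReal (2 * Real.exp (-(κ' ^ 2 * Real.log n))) := by
  by_cases hi : j < i
  swap
  · have : largeError D f κ' n j i b = ∅ := by
      ext e; simp [largeError, hi]
    rw [this, measure_empty]; exact zero_le
  have hσ := T.σ_pos
  have hs := scale_pos i
  have hlog : 0 < Real.log n := Real.log_pos (by exact_mod_cast (by omega : 1 < n))
  have hv : ((T.σ ^ 2).toNNReal : ℝ) = T.σ ^ 2 := Real.coe_toNNReal _ (by positivity)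
  have h := measure_abs_sum_ge_le (v := (T.σ ^ 2).toNNReal) (by
      rw [Real.toNNReal_pos]; positivity)
    (c := fun t e => weight W i b (design D.point f e t))
    (fun t => (measurable_weight W i b).comp (measurable_design D f t))
    (fun t e e' he => congrArg _ (dependsOnFirst_design D.point f t e e' he))
    (n := n) (V := (2 ^ i)⁻¹) (by positivity)
    (fun e => sum_weight_sq_le hb hi (isRun_design D f e).injective n)
    (a := κ' * (T.σ * (scale i)⁻¹ * √(2 * Real.log n))) (by positivity)
  refine (measure_mono fun e he => he.2).trans (h.trans (le_of_eq ?_))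
  congr 3
  rw [hv, mul_pow, mul_pow, mul_pow, Real.sq_sqrt (by positivity), ← scale_mul_self]
  field_simp

/-- The noise sequences for which some grid estimate which the procedure may use at time `n` has a
large stochastic error. -/
def exceptional {W : WaveletBasis N L j₀} {T : Tuning j₀} (D : Implementation W T) (f : ℝ → ℝ)
    (κ' : ℝ) (n : ℕ) : Set (ℕ → ℝ) :=
  (⋃ k ∈ Finset.range (2 ^ j₀), ⋃ i ∈ Finset.range (⌊4 * Real.log n⌋₊ + 1),
    largeError D f κ' n j₀ i (W.φ j₀ k)) ∪
  ⋃ j ∈ Finset.Ico j₀ (T.jmax n), ⋃ k ∈ Finset.range (2 ^ j),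
    ⋃ i ∈ Finset.range (⌊4 * Real.log n⌋₊ + 1), largeError D f κ' n j i (W.ψ j k)

lemma measure_biUnion_le_card_mul {α : Type*} [MeasurableSpace α] (μ : Measure α) (s : Finset ℕ)
    (A : ℕ → Set α) {q : ℝ≥0∞} (h : ∀ i ∈ s, μ (A i) ≤ q) : μ (⋃ i ∈ s, A i) ≤ s.card * q := by
  refine (measure_biUnion_finset_le s A).trans ?_
  rw [← nsmul_eq_mul]
  exact Finset.sum_le_card_nsmul _ _ _ h

lemma measure_exceptional_le {W : WaveletBasis N L j₀} {T : Tuning j₀} (D : Implementation W T)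
    (f : ℝ → ℝ) {κ' : ℝ} (hκ' : 0 < κ') {n : ℕ} (hn : 2 ≤ n) :
    gaussianNoise (T.σ ^ 2).toNNReal (exceptional D f κ' n) ≤
      ENNReal.ofReal (2 * 2 ^ T.jmax n * ((⌊4 * Real.log n⌋₊ + 1) *
        (2 * Real.exp (-(κ' ^ 2 * Real.log n))))) := by
  set R := ⌊4 * Real.log n⌋₊ + 1 with hR
  set q := ENNReal.ofReal (2 * Real.exp (-(κ' ^ 2 * Real.log n))) with hq
  have h1 : gaussianNoise (T.σ ^ 2).toNNReal (exceptional D f κ' n) ≤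
      (2 ^ j₀ : ℕ) * (R * q) + ∑ j ∈ Finset.Ico j₀ (T.jmax n), (2 ^ j : ℕ) * (R * q) := by
    refine (measure_union_le _ _).trans (add_le_add ?_ ?_)
    · refine (measure_biUnion_le_card_mul _ _ _ (q := R * q) fun k hk => ?_).trans (by simp)
      refine (measure_biUnion_le_card_mul _ _ _ (q := q) fun i hi => ?_).trans
        (by rw [Finset.card_range])
      exact measure_largeError_le D f hκ' hn (isAtom_φ W le_rfl (Finset.mem_range.1 hk))
    · refine (measure_biUnion_finset_le _ _).trans (Finset.sum_le_sum fun j hj => ?_)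
      refine (measure_biUnion_le_card_mul _ _ _ (q := R * q) fun k hk => ?_).trans (by simp)
      refine (measure_biUnion_le_card_mul _ _ _ (q := q) fun i hi => ?_).trans
        (by rw [Finset.card_range])
      exact measure_largeError_le D f hκ' hn
        (isAtom_ψ W (Finset.mem_Ico.1 hj).1 (Finset.mem_range.1 hk))
  have h2 : 2 ^ j₀ + ∑ j ∈ Finset.Ico j₀ (T.jmax n), 2 ^ j ≤ 2 * 2 ^ T.jmax n := by
    have h3 : 2 ^ j₀ ≤ 2 ^ T.jmax n := Nat.pow_le_pow_right (by norm_num) (T.lt_jmax n).le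
    have h4 : ∑ j ∈ Finset.Ico j₀ (T.jmax n), 2 ^ j ≤ ∑ j ∈ Finset.range (T.jmax n), 2 ^ j :=
      Finset.sum_le_sum_of_subset (fun j hj => by
        rw [Finset.mem_range]; exact (Finset.mem_Ico.1 hj).2)
    rw [Nat.geomSum_eq le_rfl] at h4
    simp only [Nat.add_one_sub_one, Nat.div_one] at h4
    omega
  refine h1.trans ?_
  rw [← Finset.sum_mul, ← add_mul, ENNReal.ofReal_mul (by positivity),
    ENNReal.ofReal_mul (q := 2 * Real.exp _) (by positivity)]
  refine mul_le_mul' ?_ (mul_le_mul' (le_of_eq ?_) le_rfl)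
  · calc ((2 ^ j₀ : ℕ) : ℝ≥0∞) + ∑ j ∈ Finset.Ico j₀ (T.jmax n), ((2 ^ j : ℕ) : ℝ≥0∞)
        = ((2 ^ j₀ + ∑ j ∈ Finset.Ico j₀ (T.jmax n), 2 ^ j : ℕ) : ℝ≥0∞) := by push_cast; rfl
      _ ≤ ((2 * 2 ^ T.jmax n : ℕ) : ℝ≥0∞) := by exact_mod_cast h2
      _ = ENNReal.ofReal (((2 * 2 ^ T.jmax n : ℕ)) : ℝ) := (ENNReal.ofReal_natCast _).symm
      _ = _ := by push_cast; rfl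
  · rw [← ENNReal.ofReal_natCast, hR]; push_cast; rfl

/-- There are `O(n / log n)` coefficients and `O(log n)` grid levels, each with probability at most
`2 n^{-κ'^2}`. The total `O(n^{1-κ'^2})` does not depend on `f`, whence the uniformity. -/
lemma eventually_measure_exceptional_le {W : WaveletBasis N L j₀} {T : Tuning j₀}
    (D : Implementation W T) {κ' : ℝ} (hκ' : 1 < κ') {δ : ℝ} (hδ : 0 < δ) :
    ∀ᶠ n : ℕ in atTop, ∀ f : ℝ → ℝ,
      gaussianNoise (T.σ ^ 2).toNNReal (exceptional D f κ' n) ≤ ENNReal.ofReal δ := by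
  obtain ⟨c, C, hc, hC, hjm⟩ := T.exists_jmax_bounds
  have hκ2 : 0 < κ' ^ 2 - 1 := by nlinarith
  have hlim : Tendsto (fun n : ℕ => 20 * C * Real.exp (-((κ' ^ 2 - 1) * Real.log n))) atTop
      (𝓝 (20 * C * 0)) :=
    ((Real.tendsto_exp_neg_atTop_nhds_zero.comp
      (tendsto_log_natCast.const_mul_atTop hκ2))).const_mul _
  rw [mul_zero] at hlim
  filter_upwards [hjm, hlim.eventually_le_const hδ, tendsto_log_natCast.eventually_ge_atTop 1,
    eventually_ge_atTop 2] with n h1 h2 h3 hn f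
  refine (measure_exceptional_le D f (by linarith) hn).trans (ENNReal.ofReal_le_ofReal ?_)
  refine le_trans ?_ h2
  have hn0 : (0 : ℝ) < n := by exact_mod_cast (by omega : 0 < n)
  have hf : (⌊4 * Real.log n⌋₊ : ℝ) + 1 ≤ 5 * Real.log n := by
    have := Nat.floor_le (show 0 ≤ 4 * Real.log n by linarith)
    linarith
  have he : Real.exp (-((κ' ^ 2 - 1) * Real.log n)) = n * Real.exp (-(κ' ^ 2 * Real.log n)) := by
    nth_rewrite 2 [← Real.exp_log hn0]
    rw [← Real.exp_add]; congr 1; ring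
  rw [he]
  calc _ ≤ 2 * (C * (n / Real.log n)) * (5 * Real.log n * (2 * Real.exp (-(κ' ^ 2 * Real.log n)))) := by
        gcongr; exact h1.2
    _ = _ := by field_simp; ring

/-! ### Accuracy of the estimated coefficients -/

/-- Outside the exceptional event, estimated coefficients have the expected accuracy. -/
lemma exists_coeff_bounds {W : WaveletBasis N L j₀} {T : Tuning j₀}
    (D : Implementation W T) {M : ℝ} (hM : 0 ≤ M) {κ' κ'' : ℝ} (hκ : κ' < κ'') :
    ∃ E : ℝ, 0 < E ∧ ∀ᶠ n : ℕ in atTop, ∀ f ∈ holderClass W (1 / 2) M (Icc 0 1), ∀ e : ℕ → ℝ,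
      ∀ j k b, IsAtom W j k b → j < T.jmax n → k < 2 ^ j →
      (∀ i ∈ Finset.range (⌊4 * Real.log n⌋₊ + 1), e ∉ largeError D f κ' n j i b) →
      (levels L (design D.point f e) n j k).Nonempty ∧
      |gridCoeff W (design D.point f e) (observations D.point f e) n
        (levelIndex L (design D.point f e) n j k) b - ip f b| ≤
          κ'' * noiseSize L T.σ (design D.point f e) n j k ∧
      noiseSize L T.σ (design D.point f e) n j k ≤ E * √(Real.log n / n) := by
  obtain ⟨C, hC0, hC⟩ := exists_bias_bound W hM
  obtain ⟨c, hc0, n₀, hgrid⟩ := exists_grid_subset W T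
  have hσ := T.σ_pos
  refine ⟨2 * T.σ / √c, by positivity, ?_⟩
  have hsq : Tendsto (fun n : ℕ => √(2 * Real.log n)) atTop atTop :=
    Real.tendsto_sqrt_atTop.comp (tendsto_log_natCast.const_mul_atTop (by norm_num))
  filter_upwards [eventually_ge_atTop n₀, T.eventually_jmax_le (half_pos hc0),
    T.eventually_jmax_le one_pos, tendsto_log_natCast.eventually_ge_atTop 1,
    hsq.eventually_ge_atTop (C / (T.σ * (κ'' - κ'))),
    (tendsto_natCast_atTop_atTop (R := ℝ)).eventually_ge_atTop (1 / c), eventually_ge_atTop 2]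
    with n hn₀ hjm1 hjm2 hlog hbias hcn hn2 f hf e j k b hb hj hk hbad
  have hn0 : (0 : ℝ) < n := by exact_mod_cast (by omega : 0 < n)
  set x := design D.point f e with hx
  have hrun : IsRun W T (observations D.point f e) x := isRun_design D f e
  have hjm : (2 : ℝ) ^ j ≤ 2 ^ T.jmax n := pow_le_pow_right₀ (by norm_num) hj.le
  have hcn1 : 1 ≤ c * n := by rwa [div_le_iff₀ hc0, mul_comm] at hcn
  -- The level `i₁` of the guaranteed uniform grid. It exceeds `j` because `2^j < 2^jmax ≤ (c/2) n <
  -- 2^i₁`.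
  obtain ⟨i₁, hi₁, hi₁'⟩ := exists_nat_pow_near hcn1 (one_lt_two (α := ℝ))
  have hji₁ : j < i₁ := by
    have : (2 : ℝ) ^ j < 2 ^ i₁ := by
      have h1 : (2 : ℝ) ^ j < 2 ^ T.jmax n := pow_lt_pow_right₀ (by norm_num) hj
      rw [pow_succ] at hi₁'
      linarith
    exact (pow_lt_pow_iff_right₀ (by norm_num)).1 this
  have hmem₁ : i₁ ∈ levels L x n j k :=
    ⟨hji₁, fun p hp => hgrid _ x hrun n hn₀ i₁ hi₁ ⟨hp.2, hp.1.2⟩⟩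
  have hbdd : ∀ i ∈ levels L x n j k, i ≤ ⌊4 * Real.log n⌋₊ := by
    intro i hi
    have h1 := two_pow_le_of_grid_inter_cell_subset (l := k) (le_of_lt hi.1)
      (fun p hp => hi.2 ⟨cell_subset_suppInterval W.one_le_L hk hp.2, hp.1⟩)
    have h2 : (2 : ℝ) ^ i ≤ (n : ℝ) ^ 2 := by
      calc (2 : ℝ) ^ i = 2 ^ (i - j) * 2 ^ j := by rw [← pow_add, Nat.sub_add_cancel (le_of_lt hi.1)]
        _ ≤ n * n := by
          have h3 : (2 : ℝ) ^ (i - j) ≤ n := by exact_mod_cast h1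
          have h4 : (2 : ℝ) ^ j ≤ n := by linarith
          exact mul_le_mul h3 h4 (by positivity) hn0.le
        _ = _ := by ring
    have h3 := Real.log_le_log (by positivity) h2
    rw [Real.log_pow, Real.log_pow] at h3
    push_cast at h3
    apply Nat.le_floor
    have h4 := Real.log_two_gt_d9
    have h5 : (0 : ℝ) ≤ i := by positivity
    nlinarith
  have hbdd' : BddAbove (levels L x n j k) := ⟨_, hbdd⟩
  set i := levelIndex L x n j k with hi
  have hmem : i ∈ levels L x n j k := Nat.sSup_mem ⟨i₁, hmem₁⟩ hbdd'
  have hi₁i : i₁ ≤ i := le_csSup hbdd' hmem₁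
  have hs := scale_pos i
  refine ⟨⟨i₁, hmem₁⟩, ?_, ?_⟩
  · rw [gridCoeff_eq hb hrun.injective (observations_eq D.point f e) hmem]
    have h1 := hC f hf j k b hb i hmem.1
    have h2 : |stochasticError W x e n i b| ≤ κ' * (T.σ * (scale i)⁻¹ * √(2 * Real.log n)) := by
      by_contra h
      push Not at h
      exact hbad i (Finset.mem_range.2 (Nat.lt_succ_of_le (hbdd i hmem))) ⟨hmem.1, h.le⟩
    -- The bias lacks the factor `√(log n)` and is absorbed into the gap between `κ'` and `κ''`.
    have h3 : C * (scale i)⁻¹ ≤ (κ'' - κ') * (T.σ * (scale i)⁻¹ * √(2 * Real.log n)) := by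
      have hpos : 0 < T.σ * (κ'' - κ') := mul_pos hσ (by linarith)
      rw [div_le_iff₀ hpos] at hbias
      calc C * (scale i)⁻¹ ≤ (√(2 * Real.log n) * (T.σ * (κ'' - κ'))) * (scale i)⁻¹ := by gcongr
        _ = _ := by ring
    rw [noiseSize, ← hi, add_sub_right_comm]
    refine (abs_add_le _ _).trans ?_
    linarith
  · rw [noiseSize, ← hi]
    apply le_of_sq_le_sq _ (by positivity)
    rw [mul_pow, mul_pow, mul_pow, Real.sq_sqrt (by linarith), Real.sq_sqrt (by positivity), div_pow,
      Real.sq_sqrt hc0.le, inv_pow, sq (scale i), scale_mul_self]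
    have h1 : c * n ≤ 2 * 2 ^ i := by
      have : (2 : ℝ) ^ i₁ ≤ 2 ^ i := pow_le_pow_right₀ (by norm_num) hi₁i
      rw [pow_succ] at hi₁'
      linarith
    have h2 : ((2 : ℝ) ^ i)⁻¹ ≤ 2 / (c * n) := by
      rw [inv_le_comm₀ (by positivity) (by positivity), inv_div, div_le_iff₀ (by norm_num)]
      linarith
    calc T.σ ^ 2 * (2 ^ i)⁻¹ * (2 * Real.log n) ≤ T.σ ^ 2 * (2 / (c * n)) * (2 * Real.log n) := by
          gcongr
      _ = _ := by field_simp

/-- If the estimate is kept, then `|β| ≥ (κ - κ'') nz`, so an error of size `κ'' nz` is also a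
multiple of `|β|`. If it is set to zero, the error is `|β| ≤ (κ + κ'') nz`. The constant is just
large enough to cover all cases at once. -/
lemma abs_sub_le_of_threshold {β βh nz κ κ'' : ℝ} (hκ'' : 0 < κ'') (hκ : κ'' < κ)
    (h : |βh - β| ≤ κ'' * nz) (hnz : 0 ≤ nz) {βT : ℝ}
    (hT : (κ * nz ≤ |βh| ∧ βT = βh) ∨ (|βh| < κ * nz ∧ βT = 0)) :
    |βT - β| ≤ (κ + κ'' + 1 + κ'' / (κ - κ'')) * |β| ∧
      |βT - β| ≤ (κ + κ'' + 1 + κ'' / (κ - κ'')) * nz := by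
  have hd : 0 < κ - κ'' := by linarith
  have hq : 0 < κ'' / (κ - κ'') := by positivity
  have hβ := abs_nonneg β
  rcases hT with ⟨h1, rfl⟩ | ⟨h1, rfl⟩
  · have h2 : (κ - κ'') * nz ≤ |β| := by
      have := abs_sub_abs_le_abs_sub βT β
      linarith
    have h3 : κ'' * nz ≤ κ'' / (κ - κ'') * |β| := by
      calc κ'' * nz = κ'' / (κ - κ'') * ((κ - κ'') * nz) := by field_simp
        _ ≤ _ := by gcongr
    constructor
    · have : 0 ≤ (κ + κ'' + 1) * |β| := mul_nonneg (by linarith) hβ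
      linarith
    · have : 0 ≤ (κ + 1 + κ'' / (κ - κ'')) * nz := mul_nonneg (by linarith) hnz
      linarith
  · rw [zero_sub, abs_neg]
    have h2 := abs_sub_abs_le_abs_sub β βh
    rw [abs_sub_comm] at h2
    constructor
    · have : 0 ≤ (κ + κ'' + κ'' / (κ - κ'')) * |β| := mul_nonneg (by linarith) hβ
      linarith
    · have : 0 ≤ (1 + κ'' / (κ - κ'')) * nz := mul_nonneg (by linarith) hnz
      linarith

/-! ### Summation over levels -/

/-- The two terms of the minimum agree when `2^j = X = R^(1/(2s+1))`. Below this level the summands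
grow like `2^{j/2} R^{-1/2}`, above it they decay like `2^{-js}`; both geometric sums are of order
`X^{-s} = R^{-α(s)}`. -/
lemma exists_sum_min_le {s : ℝ} (hs : 0 < s) : ∃ K : ℝ, 0 < K ∧ ∀ R : ℝ, 1 ≤ R → ∀ a b : ℕ,
    ∑ j ∈ Finset.Ico a b, scale j * min ((2 : ℝ) ^ (-((j : ℝ) * (s + 1 / 2)))) (√(1 / R)) ≤
      K * R ^ (-rateExponent s) := by
  have ht := inv_sqrt_two_lt_one
  have ht' : 0 < 1 - (√2)⁻¹ := by linarith
  set u : ℝ := (2 : ℝ) ^ (-s) with hu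
  have hu0 : 0 < u := by positivity
  have hu1 : u < 1 := Real.rpow_lt_one_of_one_lt_of_neg (by norm_num) (by linarith)
  have hu' : 0 < 1 - u := by linarith
  refine ⟨1 / (1 - (√2)⁻¹) + 1 / (1 - u), by positivity, fun R hR a b => ?_⟩
  have hR0 : 0 < R := by linarith
  have h2s : 0 < 2 * s + 1 := by linarith
  set X : ℝ := R ^ (1 / (2 * s + 1)) with hX
  have hX1 : 1 ≤ X := Real.one_le_rpow hR (by positivity)
  have hX0 : 0 < X := by linarith
  have hXs : X ^ (-s) = R ^ (-rateExponent s) := by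
    rw [hX, ← Real.rpow_mul hR0.le, rateExponent]; congr 1; field_simp
  have hXr : √(1 / R) = X ^ (-s) * (√X)⁻¹ := by
    rw [Real.sqrt_eq_rpow, Real.sqrt_eq_rpow, ← Real.rpow_neg hX0.le, ← Real.rpow_add hX0, hX,
      ← Real.rpow_mul hR0.le, one_div, Real.inv_rpow hR0.le, ← Real.rpow_neg hR0.le]
    congr 1; field_simp; ring
  obtain ⟨p, hp, hp'⟩ := exists_nat_pow_near hX1 (one_lt_two (α := ℝ))
  set g : ℕ → ℝ := fun j => scale j * min ((2 : ℝ) ^ (-((j : ℝ) * (s + 1 / 2)))) (√(1 / R)) with hg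
  have hg0 : ∀ j, 0 ≤ g j := fun j => mul_nonneg (scale_pos j).le (by positivity)
  have hlow : ∀ j ≤ p, g j ≤ X ^ (-s) * (√2)⁻¹ ^ (p - j) := by
    intro j hj
    have h1 : scale j ≤ √X * (√2)⁻¹ ^ (p - j) := by
      have h2 : scale p ≤ √X := by
        rw [Real.le_sqrt (scale_pos p).le hX0.le, sq, scale_mul_self]; exact hp
      have h3 : scale j = scale p * (√2)⁻¹ ^ (p - j) := by
        rw [scale_eq_pow, scale_eq_pow, inv_pow, ← div_eq_mul_inv, eq_div_iff (by positivity),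
          ← pow_add, Nat.add_sub_cancel' hj]
      rw [h3]; gcongr
    calc g j ≤ (√X * (√2)⁻¹ ^ (p - j)) * √(1 / R) :=
          mul_le_mul h1 (min_le_right _ _) (by positivity) (by positivity)
      _ = _ := by rw [hXr]; field_simp
  have hhigh : ∀ j, g j ≤ u ^ j := by
    intro j
    calc g j ≤ scale j * (2 : ℝ) ^ (-((j : ℝ) * (s + 1 / 2))) :=
          mul_le_mul_of_nonneg_left (min_le_left _ _) (scale_pos j).le
      _ = u ^ j := by
        rw [scale, ← Real.rpow_add (by norm_num), hu, ← Real.rpow_natCast, ← Real.rpow_mul (by norm_num)]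
        congr 1; ring
  have hup : u ^ (p + 1) ≤ X ^ (-s) := by
    have : u ^ (p + 1) = ((2 : ℝ) ^ (p + 1)) ^ (-s) := by
      rw [hu, ← Real.rpow_natCast, ← Real.rpow_natCast, ← Real.rpow_mul (by norm_num),
        ← Real.rpow_mul (by norm_num)]
      congr 1; ring
    rw [this]
    exact Real.rpow_le_rpow_of_nonpos hX0 hp'.le (by linarith)
  have hXpos : 0 < X ^ (-s) := by positivity
  calc ∑ j ∈ Finset.Ico a b, g j ≤ ∑ j ∈ Finset.range (max b (p + 1)), g j :=
        Finset.sum_le_sum_of_subset_of_nonneg (fun j hj => by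
          rw [Finset.mem_range]; exact lt_max_of_lt_left (Finset.mem_Ico.1 hj).2) (fun j _ _ => hg0 j)
    _ = ∑ j ∈ Finset.range (p + 1), g j + ∑ j ∈ Finset.Ico (p + 1) (max b (p + 1)), g j :=
        (Finset.sum_range_add_sum_Ico _ (le_max_right _ _)).symm
    _ ≤ ∑ j ∈ Finset.range (p + 1), X ^ (-s) * (√2)⁻¹ ^ (p - j) +
          ∑ j ∈ Finset.Ico (p + 1) (max b (p + 1)), u ^ j :=
        add_le_add (Finset.sum_le_sum fun j hj => hlow j (by
          rw [Finset.mem_range] at hj; omega)) (Finset.sum_le_sum fun j _ => hhigh j)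
    _ ≤ X ^ (-s) * (1 / (1 - (√2)⁻¹)) + X ^ (-s) * (1 / (1 - u)) := by
        refine add_le_add ?_ ?_
        · rw [← Finset.mul_sum, Finset.sum_flip (fun j => (√2)⁻¹ ^ j)]
          refine mul_le_mul_of_nonneg_left ?_ hXpos.le
          have := sum_Ico_pow_le (t := (√2)⁻¹) (by positivity) ht 0 (p + 1)
          rwa [← Finset.range_eq_Ico, pow_zero] at this
        · refine (sum_Ico_pow_le hu0.le hu1 _ _).trans ?_
          rw [mul_one_div]
          gcongr
    _ = _ := by rw [hXs]; ring

/-! ### Localisation -/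

/-- The compact set `J` has positive distance from the complement of the open set `U`, while active
supports shrink to the point. -/
lemma exists_level_suppInterval_subset {I J : Set ℝ}
    (hIopen : ∃ U : Set ℝ, IsOpen U ∧ I = U ∩ Icc 0 1) (hJ : IsClosed J) (hJI : J ⊆ I) (L : ℕ) :
    ∃ j₁ : ℕ, ∀ j ≥ j₁, ∀ x ∈ J, ∀ k ∈ active L j x, suppInterval L j k ⊆ I := by
  obtain ⟨U, hU, rfl⟩ := hIopen
  have hJc : IsCompact J := isCompact_Icc.of_isClosed_subset hJ (hJI.trans inter_subset_right)
  obtain ⟨η, hη, hsub⟩ := hJc.exists_thickening_subset_open hU (hJI.trans inter_subset_left)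
  obtain ⟨j₁, hj₁⟩ := pow_unbounded_of_one_lt (2 * L / η) (one_lt_two (α := ℝ))
  refine ⟨j₁, fun j hj x hx k hk y hy => ⟨hsub ?_, suppInterval_subset_Icc _ _ _ hy⟩⟩
  rw [Metric.mem_thickening_iff]
  refine ⟨x, hx, ?_⟩
  have h1 := suppInterval_subset_of_mem_active hk y hy
  have h2 : (2 : ℝ) ^ j₁ ≤ 2 ^ j := pow_le_pow_right₀ (by norm_num) hj
  rw [div_lt_iff₀ hη] at hj₁
  rw [Real.dist_eq]
  by_contra hc
  push Not at hc
  have : (2 : ℝ) ^ j₁ * η ≤ 2 ^ j * |y - x| := mul_le_mul h2 hc hη.le (by positivity)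
  linarith

/-- Below the level where active supports enter `I`, the global `C^{1/2}(M)` bound and a larger
constant suffice. -/
lemma exists_local_coeff_bound (W : WaveletBasis N L j₀) {s M : ℝ} (hs : 0 ≤ s) (hM : 0 ≤ M)
    {I J : Set ℝ} (hIopen : ∃ U : Set ℝ, IsOpen U ∧ I = U ∩ Icc 0 1) (hJ : IsClosed J)
    (hJI : J ⊆ I) : ∃ M' : ℝ, 0 ≤ M' ∧
    ∀ f ∈ holderClass W s M I ∩ holderClass W (1 / 2) M (Icc 0 1), ∀ j ≥ j₀, ∀ x ∈ J,
      ∀ k ∈ active L j x, |ip f (W.ψ j k)| ≤ M' * (2 : ℝ) ^ (-((j : ℝ) * (s + 1 / 2))) := by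
  obtain ⟨j₁, hj₁⟩ := exists_level_suppInterval_subset hIopen hJ hJI L
  refine ⟨M * (2 : ℝ) ^ ((j₁ : ℝ) * (s + 1 / 2)), by positivity, fun f hf j hj x hx k hk => ?_⟩
  have hk' := (mem_active.1 hk).1
  have hpos : (0 : ℝ) < (2 : ℝ) ^ ((j : ℝ) * (s + 1 / 2)) := by positivity
  rw [Real.rpow_neg (by norm_num), ← div_eq_mul_inv, le_div_iff₀ hpos, mul_comm]
  rcases le_or_gt j₁ j with h | h
  · refine (hf.1.2.2.2 j hj k hk' (hj₁ j h x hx k hk)).trans ?_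
    exact le_mul_of_one_le_right hM (Real.one_le_rpow (by norm_num) (by positivity))
  · rw [mul_comm]
    have h1 : |ip f (W.ψ j k)| ≤ M := by
      refine (abs_coeff_ψ_le hf.2 hj hk').trans (mul_le_of_le_one_right hM ?_)
      exact inv_le_one_of_one_le₀ (one_le_pow₀ (by norm_num))
    have h2 : (j : ℝ) ≤ j₁ := by exact_mod_cast h.le
    exact mul_le_mul h1 (Real.rpow_le_rpow_of_exponent_le (by norm_num) (by gcongr)) hpos.le hM

/-! ### The error of the estimator -/

lemma betaThr_cases (W : WaveletBasis N L j₀) (T : Tuning j₀) (x y : ℕ → ℝ) (n j k : ℕ)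
    (h : (levels L x n j k).Nonempty) :
    (T.κ * noiseSize L T.σ x n j k ≤ |betaHat W x y n j k| ∧
      betaThr W T x y n j k = betaHat W x y n j k) ∨
    (|betaHat W x y n j k| < T.κ * noiseSize L T.σ x n j k ∧ betaThr W T x y n j k = 0) := by
  by_cases hc : T.κ * noiseSize L T.σ x n j k ≤ |betaHat W x y n j k|
  · exact Or.inl ⟨hc, if_pos ⟨h, hc⟩⟩
  · exact Or.inr ⟨not_le.1 hc, if_neg fun h' => hc h'.2⟩

/-- Extending the thresholded estimates by zero treats the truncated tail of `f` as coefficient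
errors of the same kind as the others. -/
lemma estimator_sub_partialSum (W : WaveletBasis N L j₀) (T : Tuning j₀) (x y : ℕ → ℝ) (n : ℕ)
    (f : ℝ → ℝ) {i : ℕ} (hi : T.jmax n ≤ i) (u : ℝ) :
    estimator W T x y n u - partialSum W f i u =
      ∑ k ∈ Finset.range (2 ^ j₀), (alphaHat W x y n k - ip f (W.φ j₀ k)) * W.φ j₀ k u +
      ∑ j ∈ Finset.Ico j₀ i, ∑ k ∈ Finset.range (2 ^ j),
        ((if j < T.jmax n then betaThr W T x y n j k else 0) - ip f (W.ψ j k)) * W.ψ j k u := by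
  have h1 : ∑ j ∈ Finset.Ico j₀ i, ∑ k ∈ Finset.range (2 ^ j),
      (if j < T.jmax n then betaThr W T x y n j k else 0) * W.ψ j k u =
      ∑ j ∈ Finset.Ico j₀ (T.jmax n), ∑ k ∈ Finset.range (2 ^ j), betaThr W T x y n j k * W.ψ j k u := by
    rw [← Finset.sum_Ico_consecutive _ (T.lt_jmax n).le hi]
    have h2 : ∑ j ∈ Finset.Ico (T.jmax n) i, ∑ k ∈ Finset.range (2 ^ j),
        (if j < T.jmax n then betaThr W T x y n j k else 0) * W.ψ j k u = 0 := by
      refine Finset.sum_eq_zero fun j hj => Finset.sum_eq_zero fun k _ => ?_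
      rw [if_neg (not_lt.2 (Finset.mem_Ico.1 hj).1), zero_mul]
    rw [h2, add_zero]
    refine Finset.sum_congr rfl fun j hj => Finset.sum_congr rfl fun k _ => ?_
    rw [if_pos (Finset.mem_Ico.1 hj).2]
  simp only [sub_mul, Finset.sum_sub_distrib]
  rw [h1, estimator, partialSum]
  ring

/-- Outside the exceptional event, the estimator attains the rate `(n / log n)^(-α(s))` on `J`. -/
lemma exists_estimator_bound {W : WaveletBasis N L j₀} {T : Tuning j₀} (D : Implementation W T)
    {s M : ℝ} (hs : 0 < s) (hM : 0 ≤ M) {I J : Set ℝ}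
    (hIopen : ∃ U : Set ℝ, IsOpen U ∧ I = U ∩ Icc 0 1) (hJ : IsClosed J) (hJI : J ⊆ I)
    {κ' : ℝ} (hκ'0 : 0 < κ') (hκ' : κ' < T.κ) :
    ∃ K : ℝ, 0 < K ∧ ∀ᶠ n : ℕ in atTop,
      ∀ f ∈ holderClass W s M I ∩ holderClass W (1 / 2) M (Icc 0 1), ∀ e ∉ exceptional D f κ' n,
      ∀ x ∈ J, |algorithmEstimate D f e n x - f x| ≤
        K * ((n : ℝ) / Real.log n) ^ (-rateExponent s) := by
  obtain ⟨κ'', hκ1, hκ2⟩ := exists_between hκ'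
  have hκ0 : 0 < κ'' := hκ'0.trans hκ1
  obtain ⟨E, hE0, hE⟩ := exists_coeff_bounds D hM hκ1
  obtain ⟨M', hM'0, hM'⟩ := exists_local_coeff_bound W hs.le hM hIopen hJ hJI
  obtain ⟨Bφ, hBφ0, hBφ⟩ := exists_abs_φ_le W
  obtain ⟨Bψ, hBψ0, hBψ⟩ := exists_abs_ψ_le W
  obtain ⟨K, hK0, hK⟩ := exists_sum_min_le hs
  obtain ⟨c, C, hc, hC, hjm⟩ := T.exists_jmax_bounds
  set G : ℝ := T.κ + κ'' + 1 + κ'' / (T.κ - κ'') with hG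
  have hG1 : 1 ≤ G := by
    have : 0 < κ'' / (T.κ - κ'') := div_pos hκ0 (by linarith)
    linarith [T.one_lt_κ]
  set H : ℝ := G * (M' + E) + M / c with hH
  have hGM : 0 ≤ G * M' := by positivity
  have hGE : 0 ≤ G * E := by positivity
  have hMc : 0 ≤ M / c := by positivity
  have hH0 : 0 ≤ H := by positivity
  have hs0 := scale_pos j₀
  refine ⟨2 ^ j₀ * (κ'' * E * (Bφ * scale j₀)) + 2 * L * (H * Bψ) * K + 1, by positivity, ?_⟩
  filter_upwards [hE, hjm, tendsto_log_natCast.eventually_ge_atTop 1, eventually_ge_atTop 2]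
    with n hEn hjmn hlog hn2 f hf e he u hu
  have hn0 : (0 : ℝ) < n := by exact_mod_cast (by omega : 0 < n)
  have hu1 : u ∈ Icc (0 : ℝ) 1 := by
    obtain ⟨U, _, rfl⟩ := hIopen
    exact (hJI hu).2
  set R : ℝ := n / Real.log n with hR
  have hR1 : 1 ≤ R := by
    rw [hR, one_le_div (by linarith)]
    exact (Real.log_le_sub_one_of_pos hn0).trans (by linarith)
  have hR0 : 0 < R := by linarith
  have hρR : √(Real.log n / n) = √(1 / R) := by rw [hR, one_div_div]
  set ρ := √(1 / R) with hρ
  have hρ0 : 0 ≤ ρ := Real.sqrt_nonneg _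
  have hρ1 : ρ ≤ 1 := by
    exact Real.sqrt_le_one.2 ((div_le_one hR0).2 hR1)
  -- The scaling coefficients have the parametric error `R^{-1/2}`, which is smaller since `α(s) ≤
  -- 1/2`.
  have hρα : ρ ≤ R ^ (-rateExponent s) := by
    rw [hρ, Real.sqrt_eq_rpow, one_div R, Real.inv_rpow hR0.le, ← Real.rpow_neg hR0.le]
    refine Real.rpow_le_rpow_of_exponent_le hR1 (neg_le_neg ?_)
    rw [rateExponent, div_le_div_iff₀ (by positivity) (by norm_num)]
    linarith
  rw [algorithmEstimate]
  change |estimator W T (design D.point f e) (observations D.point f e) n u - f u| ≤ _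
  set x := design D.point f e with hx
  set y := observations D.point f e with hy
  rw [exceptional, mem_union, not_or] at he
  simp only [mem_iUnion, not_exists] at he
  have hα : ∀ k < 2 ^ j₀, |alphaHat W x y n k - ip f (W.φ j₀ k)| ≤ κ'' * (E * ρ) := by
    intro k hk
    obtain ⟨_, h1, h2⟩ := hEn f hf.2 e j₀ k _ (isAtom_φ W le_rfl hk) (T.lt_jmax n) hk
      (he.1 k (Finset.mem_range.2 hk))
    rw [hρR] at h2
    exact h1.trans (mul_le_mul_of_nonneg_left h2 hκ0.le)
  have hβ : ∀ j ≥ j₀, ∀ k ∈ active L j u,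
      |(if j < T.jmax n then betaThr W T x y n j k else 0) - ip f (W.ψ j k)| ≤
        H * min ((2 : ℝ) ^ (-((j : ℝ) * (s + 1 / 2)))) ρ := by
    intro j hj k hk
    have hk' := (mem_active.1 hk).1
    have hloc := hM' f hf j hj u hu k hk
    have hpw : (0 : ℝ) ≤ (2 : ℝ) ^ (-((j : ℝ) * (s + 1 / 2))) := by positivity
    have hMG : M' ≤ G * M' := le_mul_of_one_le_left hM'0 hG1
    rw [mul_min_of_nonneg _ _ hH0]
    split_ifs with hjm'
    · obtain ⟨h0, h1, h2⟩ := hEn f hf.2 e j k _ (isAtom_ψ W hj hk') hjm' hk'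
        (he.2 j (Finset.mem_Ico.2 ⟨hj, hjm'⟩) k (Finset.mem_range.2 hk'))
      rw [hρR] at h2
      have hnz : 0 ≤ noiseSize L T.σ x n j k := by
        have := T.σ_pos
        have := scale_pos (levelIndex L x n j k)
        rw [noiseSize]; positivity
      obtain ⟨h3, h4⟩ := abs_sub_le_of_threshold hκ0 hκ2 h1 hnz (betaThr_cases W T x y n j k h0)
      refine le_min (h3.trans ?_) (h4.trans ?_)
      · calc G * |ip f (W.ψ j k)| ≤ G * (M' * (2 : ℝ) ^ (-((j : ℝ) * (s + 1 / 2)))) := by gcongr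
          _ ≤ _ := by
            rw [← mul_assoc]
            exact mul_le_mul_of_nonneg_right (by linarith) hpw
      · calc G * noiseSize L T.σ x n j k ≤ G * (E * ρ) := by gcongr
          _ ≤ _ := by
            rw [← mul_assoc]
            exact mul_le_mul_of_nonneg_right (by linarith) hρ0
    -- From level `jmax n` on, `C^{1/2}(M)` gives `|β| ≤ M * 2^{-j} ≤ (M/c) ρ^2`, and `ρ ≤ 1`; so
    -- the minimum bound holds here too.
    · rw [zero_sub, abs_neg]
      refine le_min (hloc.trans (mul_le_mul_of_nonneg_right (by linarith) hpw)) ?_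
      refine (abs_coeff_ψ_le hf.2 hj hk').trans ?_
      have h1 : c * R ≤ 2 ^ j :=
        hjmn.1.trans (pow_le_pow_right₀ (by norm_num) (not_lt.1 hjm'))
      have h2 : ((2 : ℝ) ^ j)⁻¹ ≤ (c * R)⁻¹ := inv_anti₀ (by positivity) h1
      have h3 : ρ * ρ = 1 / R := Real.mul_self_sqrt (by positivity)
      calc M * (2 ^ j)⁻¹ ≤ M * (c * R)⁻¹ := by gcongr
        _ = M / c * (ρ * ρ) := by rw [h3]; field_simp
        _ ≤ M / c * (ρ * 1) := by gcongr
        _ ≤ H * ρ := by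
          rw [mul_one]
          exact mul_le_mul_of_nonneg_right (by linarith) hρ0
  rw [abs_sub_comm]
  refine abs_sub_le_of_partialSum hf.1 hu1 (i₀ := T.jmax n) fun i hi => ?_
  rw [abs_sub_comm, estimator_sub_partialSum W T x y n f hi u]
  have hpart1 : |∑ k ∈ Finset.range (2 ^ j₀), (alphaHat W x y n k - ip f (W.φ j₀ k)) * W.φ j₀ k u| ≤
      2 ^ j₀ * (κ'' * E * (Bφ * scale j₀)) * ρ := by
    refine (Finset.abs_sum_le_sum_abs _ _).trans ?_
    refine (Finset.sum_le_card_nsmul _ _ (κ'' * E * (Bφ * scale j₀) * ρ) fun k hk => ?_).trans ?_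
    · have hk := Finset.mem_range.1 hk
      rw [abs_mul]
      calc _ ≤ (κ'' * (E * ρ)) * (Bφ * scale j₀) :=
            mul_le_mul (hα k hk) (hBφ j₀ le_rfl k hk u hu1) (abs_nonneg _) (by positivity)
        _ = _ := by ring
    · rw [Finset.card_range, nsmul_eq_mul]; push_cast; exact le_of_eq (by ring)
  have hpart2 : |∑ j ∈ Finset.Ico j₀ i, ∑ k ∈ Finset.range (2 ^ j),
      ((if j < T.jmax n then betaThr W T x y n j k else 0) - ip f (W.ψ j k)) * W.ψ j k u| ≤
      2 * L * (H * Bψ) * (K * R ^ (-rateExponent s)) := by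
    refine (Finset.abs_sum_le_sum_abs _ _).trans ?_
    calc _ ≤ ∑ j ∈ Finset.Ico j₀ i, 2 * L * (H * Bψ) *
          (scale j * min ((2 : ℝ) ^ (-((j : ℝ) * (s + 1 / 2)))) ρ) := by
          refine Finset.sum_le_sum fun j hj => ?_
          have hj := (Finset.mem_Ico.1 hj).1
          have hsj := scale_pos j
          have hmin : (0 : ℝ) ≤ min ((2 : ℝ) ^ (-((j : ℝ) * (s + 1 / 2)))) ρ :=
            le_min (by positivity) hρ0
          rw [mul_assoc (2 * (L : ℝ))]
          refine abs_sum_le_of_active (x := u) (fun k hk hk' => ?_) (fun k hk => ?_) (by positivity)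
          · rw [(W.eq_zero_of_notMem_active hj hk hu1 hk').2, mul_zero]
          · rw [abs_mul]
            calc _ ≤ (H * min ((2 : ℝ) ^ (-((j : ℝ) * (s + 1 / 2)))) ρ) * (Bψ * scale j) :=
                  mul_le_mul (hβ j hj k hk) (hBψ j hj k (mem_active.1 hk).1 u hu1) (abs_nonneg _)
                    (by positivity)
              _ = _ := by ring
      _ ≤ _ := by
          rw [← Finset.mul_sum]
          exact mul_le_mul_of_nonneg_left (hK R hR1 j₀ i) (by positivity)
  have hpos : 0 ≤ R ^ (-rateExponent s) := by positivity
  have hpart1' := hpart1.trans (mul_le_mul_of_nonneg_left hρα (by positivity))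
  refine (abs_add_le _ _).trans ((add_le_add hpart1' hpart2).trans ?_)
  nlinarith

/-! ### Transfer from the canonical noise sequence to `Ω`, and the theorem. -/

lemma map_noise_eq {Ω : Type*} [MeasurableSpace Ω] {μ : Measure Ω} [IsProbabilityMeasure μ]
    {ε : ℕ → Ω → ℝ} {v : ℝ≥0} (hε : ∀ n, HasLaw (ε n) (gaussianReal 0 v) μ)
    (hindep : iIndepFun ε μ) : μ.map (fun ω n => ε n ω) = gaussianNoise v := by
  rw [hindep.map_fun_eq_infinitePi_map₀' fun n => (hε n).aemeasurable]
  congr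
  ext1 n
  exact (hε n).map_eq

end AdaptiveSensing

theorem theorem7 {N L j₀ : ℕ} (W : AdaptiveSensing.WaveletBasis N L j₀)
    (T : AdaptiveSensing.Tuning j₀) (D : AdaptiveSensing.Implementation W T)
    {Ω : Type*} [MeasurableSpace Ω] (μ : Measure Ω) [IsProbabilityMeasure μ]
    (ε : ℕ → Ω → ℝ) (hε : ∀ n, HasLaw (ε n) (gaussianReal 0 (T.σ ^ 2).toNNReal) μ)
    (hindep : iIndepFun ε μ)
    (s M : ℝ) (hs : 1 / 2 ≤ s) (hsN : s < N) (hM : 0 < M)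
    (I J : Set ℝ) (hI : I.OrdConnected) (hIopen : ∃ U : Set ℝ, IsOpen U ∧ I = U ∩ Icc 0 1)
    (hJ : IsClosed J) (hJI : J ⊆ I) :
    ∀ δ : ℝ, 0 < δ → ∃ K : ℝ, 0 < K ∧ ∃ n₁ : ℕ, ∀ n ≥ n₁,
      ∀ f ∈ AdaptiveSensing.holderClass W s M I ∩
          AdaptiveSensing.holderClass W (1 / 2) M (Icc 0 1),
        μ {ω | ENNReal.ofReal
              (K * ((n : ℝ) / Real.log n) ^ (-AdaptiveSensing.rateExponent s)) <
            ⨆ x ∈ J, ‖AdaptiveSensing.algorithmEstimate D f (fun t => ε t ω) n x - f x‖ₑ}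
          ≤ ENNReal.ofReal δ := by
  intro δ hδ
  -- `κ' > 1` makes the union bound vanish; `κ' < κ` leaves room for the bias and the threshold.
  obtain ⟨κ', hκ1, hκ2⟩ := exists_between T.one_lt_κ
  obtain ⟨K, hK0, hK⟩ := AdaptiveSensing.exists_estimator_bound D (by linarith : 0 < s) hM.le hIopen
    hJ hJI (by linarith : 0 < κ') hκ2
  obtain ⟨n₁, hn₁⟩ := eventually_atTop.1
    (hK.and (AdaptiveSensing.eventually_measure_exceptional_le D hκ1 hδ))
  refine ⟨K, hK0, n₁, fun n hn f hf => ?_⟩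
  obtain ⟨h1, h2⟩ := hn₁ n hn
  have hmeas : AEMeasurable (fun ω n => ε n ω) μ :=
    aemeasurable_pi_lambda _ fun n => (hε n).aemeasurable
  -- Only an inclusion and the outer-measure inequality for the image law are used, so neither the
  -- supremum event nor the exceptional event has to be shown measurable.
  refine le_trans (measure_mono (t := (fun ω n => ε n ω) ⁻¹' AdaptiveSensing.exceptional D f κ' n) ?_)
    ((Measure.le_map_apply hmeas _).trans ?_)
  · intro ω hω
    by_contra hc
    refine absurd (mem_ofPred_eq ▸ hω) (not_lt.2 (iSup₂_le fun x hx => ?_))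
    rw [Real.enorm_eq_ofReal_abs]
    exact ENNReal.ofReal_le_ofReal (h1 f hf _ hc x hx)
  · rw [AdaptiveSensing.map_noise_eq hε hindep]
    exact h2 f
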